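/- Let $n\ge 2$, let $\Omega\subset\mathbb{R}^n$ be open (for instance a bounded Lipschitz domain), and let $\varkappa\ge 1$, $\mathfrak m>0$. Let $A=(a_{k\ell})$ be a symmetric matrix with $a_{k\ell}\in C^{2,1}(\overline\Omega)$, $\|a_{k\ell}\|_{C^{2,1}(\overline\Omega)}\le\mathfrak m$ and $\varkappa^{-1}|\xi|^2\le (A(x)\xi|\xi)\le\varkappa|\xi|^2$ for $x\in\Omega$, $\xi\in\mathbb{R}^n$. **Pseudo-convexity.** For a matrix function $A$ and $h\in C^2$ put $$\Theta_A(h)=2A\nabla^2h\,A+\Upsilon_A(h),\quad (\Upsilon_A(h))_{k\ell}=\sum_{m}\Lambda^m_{k\ell}(A)\,\partial_mh,\quad \Lambda^m_{k\ell}(A)=-\sum_p\partial_pa_{k\ell}\,a_{pm}+2\sum_pa_{kp}\,\partial_pa_{\ell m}.$$ $h$ is $A$-pseudo-convex with constant $\kappa>0$ in $U$ if $\nabla h\neq 0$ and $(\Theta_A(h)\xi|\xi)\ge\kappa|\xi|^2$ ($\xi\in\mathbb{R}^n$) on $\overline U$. Let $\omega\subset\Omega$ be an open neighborhood of $\tilde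 x\in\Omega$, $\theta\in C^{3,1}(\overline\omega)$, $\nabla\theta(\tilde x)\ne0$, $H=\{x\in\omega;\ \theta(x)=\theta(\tilde x)\}$. Choose an orthogonal matrix $\mathcal O$ such that $\hat\theta(x)=\theta(\tilde x+\mathcal O^tx)-\theta(\tilde x)$ satisfies $\nabla'\hat\theta(0)=0$ and $\partial_n\hat\theta(0)>0$; near $0$ the set $\{\hat\theta=0\}$ is a graph $x_n=\vartheta(x')$ with $\vartheta$ of class $C^{3,1}$. Let $\hat A(x)=\mathcal OA(\tilde x+\mathcal O^tx)\mathcal O^t$, $\varphi(x',x_n)=(x',x_n-\vartheta(x')+|x'|^2)$, $\tilde A(y)=\varphi'(\varphi^{-1}(y))\,\hat A(\varphi^{-1}(y))\,(\varphi')^t(\varphi^{-1}(y))$. $H$ is called $A$-pseudo-convex (at $\tilde x$, with respect to the side $\theta\ge\theta(\tilde x)$) if $\tilde\psi_0(y)=(y_n-1)^2+|y'|^2$ is $\tilde A$-pseudo-convex, with some constant $\kappa>0$, in the image by $\varphi$ of some neighborhood of $0$. **Theorem.** Suppose that $H$ is $A$-pseudo-convex. Then there exist a neighborhood $\mathcal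 B\subset\omega$ of $\tilde x$ and $\mathfrak t^\ast>0$ such that for each $\mathfrak t\ge\mathfrak t^\ast$ there is $0<\tau\le\mathfrak t$ with the following property. Let $q_0,\dots,q_n,p\in L^\infty(\Omega\times(-\mathfrak t,\mathfrak t);\mathbb{C})$ have norms at most $\mathfrak m$ and put $$\mathcal L_A^wu=\operatorname{div}(A\nabla u)-\partial_t^2u+q_0\partial_tu+\sum_{j=1}^nq_j\partial_ju+pu .$$ If $u\in H^2(\omega\times(-\mathfrak t,\mathfrak t);\mathbb{C})$ satisfies $\mathcal L_A^wu=0$ in $\omega\times(-\mathfrak t,\mathfrak t)$ and $\operatorname{supp}(u(\cdot,t))\subset H_+=\{x\in\omega;\ \theta(x)\ge\theta(\tilde x)\}$ for (almost) every $t\in(-\mathfrak t,\mathfrak t)$, then $u=0$ (almost everywhere) in $\mathcal B\times(-\tau,\tau)$. -/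

import Mathlib

open MeasureTheory Set Topology
open scoped ENNReal Matrix

noncomputable section

namespace WaveUC

/-! ### Spaces

The space dimension is `n = d + 1`, so that `x = (x', x_n)` with `x'` in dimension `d`. -/

/-- Euclidean space of dimension `d`. -/
abbrev Eu (d : ℕ) : Type := EuclideanSpace ℝ (Fin d)

/-- Space-time `ℝⁿ × ℝ` with `n = d + 1`; a point is `(x, t)`. -/
abbrev SpaceTime (d : ℕ) : Type := Eu (d + 1) × ℝ

/-- The first `d` coordinates `x'` of `x = (x', x_n)`. -/
def initPart {d : ℕ} (x : Eu (d + 1)) : Eu d := WithLp.toLp 2 (fun i => x i.castSucc)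

/-! ### Classical derivatives and the spaces `C^{k,1}` -/

/-- The partial derivative `∂_k f`. -/
def pd {m : ℕ} (k : Fin m) (f : Eu m → ℝ) (x : Eu m) : ℝ :=
  fderiv ℝ f x (EuclideanSpace.single k 1)

/-- The Jacobian matrix `F' = (∂_ℓ F_k)`. -/
def jacobian {m : ℕ} (F : Eu m → Eu m) (x : Eu m) : Matrix (Fin m) (Fin m) ℝ :=
  Matrix.of fun k l => pd l (fun z => F z k) x

/-- The Hessian matrix `∇²f = (∂²_{kℓ} f)`. -/
def hessian {m : ℕ} (f : Eu m → ℝ) (x : Eu m) : Matrix (Fin m) (Fin m) ℝ :=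
  Matrix.of fun k l => pd k (pd l f) x

/-- The `C^{k,1}` norm over an open set `U`: the suprema of the derivatives of order `≤ k`, plus the
best Lipschitz constant of the derivative of order `k`. -/
def ckOneNorm {m : ℕ} (k : ℕ) (U : Set (Eu m)) (f : Eu m → ℝ) : ℝ≥0∞ :=
  (∑ j ∈ Finset.range (k + 1), ⨆ x ∈ U, ‖iteratedFDeriv ℝ j f x‖ₑ) +
    ⨆ x ∈ U, ⨆ y ∈ U, edist (iteratedFDeriv ℝ k f x) (iteratedFDeriv ℝ k f y) / edist x y

/-- `f` is of class `C^{k,1}` on the open set `U`, up to the boundary. -/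
def IsCkOneOn {m : ℕ} (k : ℕ) (U : Set (Eu m)) (f : Eu m → ℝ) : Prop :=
  ContDiffOn ℝ k f U ∧ ckOneNorm k U f < ⊤

/-- The class `ℳ(Ω, ϰ, 𝔪)` of symmetric, uniformly elliptic matrices with `C^{2,1}` coefficients. -/
structure IsAdmissible {m : ℕ} (Ω : Set (Eu m)) (ϰ 𝔪 : ℝ)
    (A : Eu m → Matrix (Fin m) (Fin m) ℝ) : Prop where
  symm : ∀ x ∈ Ω, (A x).IsSymm
  lower : ∀ x ∈ Ω, ∀ ξ : Fin m → ℝ, ϰ⁻¹ * (ξ ⬝ᵥ ξ) ≤ ξ ⬝ᵥ (A x *ᵥ ξ)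
  upper : ∀ x ∈ Ω, ∀ ξ : Fin m → ℝ, ξ ⬝ᵥ (A x *ᵥ ξ) ≤ ϰ * (ξ ⬝ᵥ ξ)
  regular : ∀ k l, IsCkOneOn 2 Ω (fun x => A x k l)
  norm_le : ∀ k l, ckOneNorm 2 Ω (fun x => A x k l) ≤ ENNReal.ofReal 𝔪

/-! ### Pseudo-convexity -/

/-- `Λ_{kℓ}^m(A) = -∑_p ∂_p a_{kℓ} a_{pm} + 2 ∑_p a_{kp} ∂_p a_{ℓm}`. -/
def Lam {m : ℕ} (A : Eu m → Matrix (Fin m) (Fin m) ℝ) (k l j : Fin m) (x : Eu m) : ℝ :=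
  -(∑ p, pd p (fun z => A z k l) x * A x p j) + 2 * ∑ p, A x k p * pd p (fun z => A z l j) x

/-- `Υ_A(h)_{kℓ} = ∑_m Λ_{kℓ}^m(A) ∂_m h`. -/
def Upsilon {m : ℕ} (A : Eu m → Matrix (Fin m) (Fin m) ℝ) (h : Eu m → ℝ) (x : Eu m) :
    Matrix (Fin m) (Fin m) ℝ :=
  Matrix.of fun k l => ∑ j, Lam A k l j x * pd j h x

/-- `Θ_A(h) = 2 A ∇²h A + Υ_A(h)`. -/
def Theta {m : ℕ} (A : Eu m → Matrix (Fin m) (Fin m) ℝ) (h : Eu m → ℝ) (x : Eu m) :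
    Matrix (Fin m) (Fin m) ℝ :=
  (2 : ℝ) • (A x * hessian h x * A x) + Upsilon A h x

/-- `h` is `A`-pseudo-convex with constant `κ` in `U`. -/
def IsPseudoConvex {m : ℕ} (A : Eu m → Matrix (Fin m) (Fin m) ℝ) (h : Eu m → ℝ) (κ : ℝ)
    (U : Set (Eu m)) : Prop :=
  ∀ x ∈ closure U, ContDiffAt ℝ 2 h x ∧ (∃ k, pd k h x ≠ 0) ∧
    ∀ ξ : Fin m → ℝ, κ * (ξ ⬝ᵥ ξ) ≤ ξ ⬝ᵥ (Theta A h x *ᵥ ξ)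

/-! ### Pseudo-convex hypersurfaces -/

/-- The point `x̃ + Oᵗ x` with coordinates `x` in the frame centred at `x̃` and rotated by `O`. -/
def fromFrame {m : ℕ} (O : Matrix (Fin m) (Fin m) ℝ) (xt x : Eu m) : Eu m :=
  xt + WithLp.toLp 2 (Oᵀ *ᵥ x.ofLp)

/-- The matrix `Â(x) = O A(x̃ + Oᵗ x) Oᵗ` read in the frame `(x̃, O)`. -/
def hatMatrix {m : ℕ} (O : Matrix (Fin m) (Fin m) ℝ) (xt : Eu m)
    (A : Eu m → Matrix (Fin m) (Fin m) ℝ) (x : Eu m) : Matrix (Fin m) (Fin m) ℝ :=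
  O * A (fromFrame O xt x) * Oᵀ

/-- The function `θ(x̃ + Oᵗ x) - θ(x̃)` read in the frame `(x̃, O)`. -/
def hatFun {m : ℕ} (O : Matrix (Fin m) (Fin m) ℝ) (xt : Eu m) (θ : Eu m → ℝ) (x : Eu m) : ℝ :=
  θ (fromFrame O xt x) - θ xt

/-- `φ(x', x_n) = (x', x_n - ϑ(x') + |x'|²)`. -/
def straighten {d : ℕ} (ϑ : Eu d → ℝ) (x : Eu (d + 1)) : Eu (d + 1) :=
  x + EuclideanSpace.single (Fin.last d) (-ϑ (initPart x) + ‖initPart x‖ ^ 2)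

/-- `φ⁻¹(y', y_n) = (y', y_n + ϑ(y') - |y'|²)`. -/
def straightenInv {d : ℕ} (ϑ : Eu d → ℝ) (y : Eu (d + 1)) : Eu (d + 1) :=
  y + EuclideanSpace.single (Fin.last d) (ϑ (initPart y) - ‖initPart y‖ ^ 2)

lemma initPart_add_single_last {d : ℕ} (x : Eu (d + 1)) (c : ℝ) :
    initPart (x + EuclideanSpace.single (Fin.last d) c) = initPart x := by
  ext i
  simp [initPart, Fin.castSucc_ne_last]

lemma straightenInv_straighten {d : ℕ} (ϑ : Eu d → ℝ) (x : Eu (d + 1)) :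
    straightenInv ϑ (straighten ϑ x) = x := by
  have h : initPart (straighten ϑ x) = initPart x := initPart_add_single_last _ _
  rw [straightenInv, h, straighten]
  ext i
  by_cases hi : i = Fin.last d
  · subst hi
    simp
    ring
  · simp [hi]

lemma straighten_straightenInv {d : ℕ} (ϑ : Eu d → ℝ) (y : Eu (d + 1)) :
    straighten ϑ (straightenInv ϑ y) = y := by
  have h : initPart (straightenInv ϑ y) = initPart y := initPart_add_single_last _ _
  rw [straighten, h, straightenInv]
  ext i
  by_cases hi : i = Fin.last d
  · subst hi
    simp
    ring
  · simp [hi]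

/-- `Ã(y) = φ'(φ⁻¹(y)) Â(φ⁻¹(y)) φ'(φ⁻¹(y))ᵗ`. -/
def tildeMatrix {d : ℕ} (ϑ : Eu d → ℝ)
    (Ahat : Eu (d + 1) → Matrix (Fin (d + 1)) (Fin (d + 1)) ℝ) (y : Eu (d + 1)) :
    Matrix (Fin (d + 1)) (Fin (d + 1)) ℝ :=
  jacobian (straighten ϑ) (straightenInv ϑ y) * Ahat (straightenInv ϑ y) *
    (jacobian (straighten ϑ) (straightenInv ϑ y))ᵀ

/-- `ψ̃₀(y) = (y_n - 1)² + |y'|²`. -/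
def psiTilde {d : ℕ} (y : Eu (d + 1)) : ℝ := (y (Fin.last d) - 1) ^ 2 + ‖initPart y‖ ^ 2

/-- The hypersurface `H = {x ∈ ω ; θ(x) = θ(x̃)}`, oriented by the side `θ ≥ θ(x̃)`, is
`A`-pseudo-convex at `x̃`. In a frame centred at `x̃` whose last axis points along `∇θ(x̃) ≠ 0`, `H`
is a graph `x_n = ϑ(x')` near `0` (and `{θ ≥ θ(x̃)}` is the side `x_n ≥ ϑ(x')`); in the coordinates
`y = φ(x)`, where `H` is the paraboloid `y_n = |y'|²`, the function `ψ̃₀` is required to be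
pseudo-convex with respect to the transported matrix in `φ(W)`, for some neighbourhood `W` of `0`. -/
def IsPseudoConvexHypersurface {d : ℕ} (A : Eu (d + 1) → Matrix (Fin (d + 1)) (Fin (d + 1)) ℝ)
    (ω : Set (Eu (d + 1))) (θ : Eu (d + 1) → ℝ) (xt : Eu (d + 1)) : Prop :=
  ∃ O ∈ Matrix.orthogonalGroup (Fin (d + 1)) ℝ,
    -- the frame is adapted to `∇θ(x̃)`
    (∀ k : Fin d, pd k.castSucc (hatFun O xt θ) 0 = 0) ∧
    0 < pd (Fin.last d) (hatFun O xt θ) 0 ∧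
    ∃ (ϑ : Eu d → ℝ) (V : Set (Eu d)) (W : Set (Eu (d + 1))),
      IsOpen V ∧ IsCkOneOn 3 V ϑ ∧ IsOpen W ∧ 0 ∈ W ∧
      (∀ x ∈ closure W, fromFrame O xt x ∈ ω ∧ initPart x ∈ V) ∧
      -- `H` is the graph of `ϑ` in `W`
      (∀ x ∈ W, hatFun O xt θ x = 0 ↔ x (Fin.last d) = ϑ (initPart x)) ∧
      ∃ κ > 0, IsPseudoConvex (tildeMatrix ϑ (hatMatrix O xt A)) psiTilde κ (straighten ϑ '' W)

/-! ### Weak derivatives, Sobolev functions, the wave operator -/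

/-- `g` is the weak derivative of `f` in the direction `v` on the open set `U`. -/
def HasWeakDeriv {d : ℕ} (U : Set (SpaceTime d)) (v : SpaceTime d) (f g : SpaceTime d → ℂ) :
    Prop :=
  LocallyIntegrableOn f U ∧ LocallyIntegrableOn g U ∧
    ∀ φ : SpaceTime d → ℝ, ContDiff ℝ (⊤ : ℕ∞) φ → HasCompactSupport φ → tsupport φ ⊆ U →
      ∫ z in U, (fderiv ℝ φ z v) • f z = -∫ z in U, φ z • g z

open Classical in
/-- The weak derivative of `f` in the direction `v` on `U` (unique up to null sets; `0` if there is
none). -/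
def weakDeriv {d : ℕ} (U : Set (SpaceTime d)) (v : SpaceTime d) (f : SpaceTime d → ℂ) :
    SpaceTime d → ℂ :=
  if h : ∃ g, HasWeakDeriv U v f g then h.choose else 0

/-- Membership in the Sobolev space `H^k(U; ℂ)`. -/
def MemH {d : ℕ} (U : Set (SpaceTime d)) : ℕ → (SpaceTime d → ℂ) → Prop
  | 0, f => MemLp f 2 (volume.restrict U)
  | k + 1, f => MemLp f 2 (volume.restrict U) ∧
      ∀ v : SpaceTime d, ∃ g, HasWeakDeriv U v f g ∧ MemH U k g

/-- The direction of `∂_k`. -/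
def dirX {d : ℕ} (k : Fin (d + 1)) : SpaceTime d := (EuclideanSpace.single k 1, 0)

/-- The direction of `∂_t`. -/
def dirT {d : ℕ} : SpaceTime d := (0, 1)

/-- `Δ_A u = div(A ∇u)` on `U`, in the sense of weak derivatives. -/
def laplaceA {d : ℕ} (U : Set (SpaceTime d))
    (A : Eu (d + 1) → Matrix (Fin (d + 1)) (Fin (d + 1)) ℝ) (u : SpaceTime d → ℂ) :
    SpaceTime d → ℂ :=
  fun z => ∑ l, weakDeriv U (dirX l)
    (fun w => ∑ k, (A w.1 l k : ℂ) * weakDeriv U (dirX k) u w) z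

/-- `ℒ_A^w u = Δ_A u - ∂_t² u + q₀ ∂_t u + ∑_j q_j ∂_j u + p u` on `U`. -/
def waveOp {d : ℕ} (U : Set (SpaceTime d))
    (A : Eu (d + 1) → Matrix (Fin (d + 1)) (Fin (d + 1)) ℝ)
    (q₀ : SpaceTime d → ℂ) (q : Fin (d + 1) → SpaceTime d → ℂ) (p : SpaceTime d → ℂ)
    (u : SpaceTime d → ℂ) : SpaceTime d → ℂ :=
  fun z => laplaceA U A u z - weakDeriv U dirT (weakDeriv U dirT u) z
    + q₀ z * weakDeriv U dirT u z + ∑ j, q j z * weakDeriv U (dirX j) u z + p z * u z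

/-- `f` belongs to `L^∞(Q)` with norm at most `M`. -/
def BoundedBy {d : ℕ} (Q : Set (SpaceTime d)) (M : ℝ) (f : SpaceTime d → ℂ) : Prop :=
  AEStronglyMeasurable f (volume.restrict Q) ∧
    eLpNorm f ∞ (volume.restrict Q) ≤ ENNReal.ofReal M

/-- The (essential) support in the open set `ω` of a function defined up to null sets: the points of
`ω` without a neighbourhood on which `f` vanishes almost everywhere. -/
def essSupport {m : ℕ} (ω : Set (Eu m)) (f : Eu m → ℂ) : Set (Eu m) :=
  {x ∈ ω | ∀ N ∈ 𝓝 x, ¬ ∀ᵐ y ∂(volume.restrict (ω ∩ N)), f y = 0}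

end WaveUC

end

open WaveUC

/-! The principal part of the operator is `div(g∇)` in space-time with `g = diag(A, -1)`, and
uniqueness follows from a Carleman estimate whose weight peaks at `(x̃, 0)` among the points where
`u` may be nonzero.

Weight. Put `h = ψ̃₀ ∘ Φ`, where `Φ` straightens `H` to the paraboloid `y_n = |y'|²`. On the side
`y_n ≥ |y'|²` one has `ψ̃₀ ≤ 1 - y_n + y_n²`, so near `x̃` the function `h` is below `1` on `θ ≥
θ(x̃)`, except at `x̃` itself. Pseudo-convexity is assumed in the coordinates `y` and needed in the
coordinates `x`. The transfer is painless because `Θ` has the coordinate-free expression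
`(Θ(h)∇f|∇f) = 2Γ(f, Γ(f, h)) - Γ(h, Γ(f, f))` in the carré du champ `Γ` (`thetaForm_fderiv`,
`thetaForm_comp`, `exists_weight`). The space-time weight is `φ = h(x) - γt²`. The term `-γt²` makes
`(x̃, 0)` a strict peak but spoils positivity of `Θ` in the time direction. The form `Θ - μg`
repairs this for small `μ` and `γ`, since `-μg` is positive in time (`exists_carleman_data`).

Carleman estimate. With `w = e^{sφ}v`, the conjugated operator is `L - sM - sμw`, where `L = Pw +
s²Γ(φ, φ)w` and `M = 2Γ(φ, w) + (Pφ - μ)w`. Up to divergences, `-LM` equals `Θ(∇w) - μΓ(w, w) +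
s²(Θ(∇φ) + μΓ(φ, φ))w²` plus a harmless cross term (`energy_identity`), and `-4sLM ≤ (L - sM)²`.
Integration gives `carleman_estimate` for real `C³` functions; real and imaginary parts together
with mollification extend it to the localized `H²` function (`carleman_complex`, `carleman_weak`).

Conclusion. Apply it to `χu`, with `χ` a cutoff near `(x̃, 0)`. By compactness some level `a < 1`
exceeds the weight wherever `χ` may vary and `u` may be nonzero (`exists_level`). Above the level
the equation bounds `P(χu)` by first-order terms, which are absorbed for large `s`; below it the
error is at most of size `e^{2sa}`. Letting `s → ∞` forces `u = 0` near the centre inside `{φ > a}`,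
which contains a neighbourhood of `(x̃, 0)` (`ae_eq_zero_of_weighted_le`, `ae_eq_zero_of_carleman`).
-/

noncomputable section

namespace WaveUC

open Filter
open scoped Convolution

set_option linter.unusedSectionVars false

/-! ### Carré du champ calculus -/

section GammaCalculus

variable {E : Type*} [NormedAddCommGroup E] [NormedSpace ℝ E] {ι : Type*} [Fintype ι]

/-- The bilinear form `Γ(f, h) = ∑ g_{ij} ∂_i f ∂_j h`. -/
def gam (e : ι → E) (g : ι → ι → E → ℝ) (f h : E → ℝ) (z : E) : ℝ :=
  ∑ i, ∑ j, g i j z * fderiv ℝ f z (e i) * fderiv ℝ h z (e j)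

/-- The operator `∑ ∂_i (g_{ij} ∂_j f)`. -/
def divOp (e : ι → E) (g : ι → ι → E → ℝ) (f : E → ℝ) (z : E) : ℝ :=
  ∑ i, fderiv ℝ (fun w => ∑ j, g i j w * fderiv ℝ f w (e j)) z (e i)

/-- The second derivative `∂_v ∂_w f`. -/
def secondDeriv (f : E → ℝ) (z v w : E) : ℝ := fderiv ℝ (fun x => fderiv ℝ f x w) z v

/-- The quadratic form of the matrix `Θ_g(h)`. -/
def thetaForm (e : ι → E) (g : ι → ι → E → ℝ) (h : E → ℝ) (z : E) (ξ : ι → ℝ) : ℝ :=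
  2 * (∑ p, ∑ l, (∑ q, g q p z * ξ q) * (∑ q, g q l z * ξ q) * secondDeriv h z (e p) (e l))
    + 2 * (∑ p, (∑ q, g q p z * ξ q) *
        ∑ k, ∑ l, fderiv ℝ (g k l) z (e p) * ξ k * fderiv ℝ h z (e l))
    - ∑ p, (∑ q, g q p z * fderiv ℝ h z (e q)) *
        ∑ k, ∑ l, fderiv ℝ (g k l) z (e p) * ξ k * ξ l

variable {e : ι → E} {g : ι → ι → E → ℝ} {f h k : E → ℝ} {z : E}

lemma differentiableAt_fderiv_apply {F : Type*} [NormedAddCommGroup F] [NormedSpace ℝ F]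
    {f : E → F} (hf : ContDiffAt ℝ 2 f z) (v : E) :
    DifferentiableAt ℝ (fun x => fderiv ℝ f x v) z := by
  have h1 : ContDiffAt ℝ 1 (fderiv ℝ f) z := hf.fderiv_right (by norm_num)
  exact (h1.differentiableAt (by norm_num)).clm_apply (differentiableAt_const v)

lemma secondDeriv_comm (hf : ContDiffAt ℝ 2 f z) (v w : E) :
    secondDeriv f z v w = secondDeriv f z w v := by
  have h1 : DifferentiableAt ℝ (fderiv ℝ f) z :=
    (hf.fderiv_right (m := 1) (by norm_num)).differentiableAt (by norm_num)
  have h2 := hf.isSymmSndFDerivAt (by simp)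
  have key : ∀ v w : E, secondDeriv f z v w = fderiv ℝ (fderiv ℝ f) z v w := by
    intro v w
    rw [secondDeriv, fderiv_clm_apply h1 (differentiableAt_const w)]
    simp
  rw [key, key]
  exact h2 v w

lemma gam_comm (hg : ∀ i j, g i j z = g j i z) : gam e g f h z = gam e g h f z := by
  unfold gam
  rw [Finset.sum_comm]
  refine Finset.sum_congr rfl fun i _ => Finset.sum_congr rfl fun j _ => ?_
  rw [hg]; ring

lemma gam_eq_sum_right : gam e g f h z
    = ∑ p, (∑ q, g q p z * fderiv ℝ f z (e q)) * fderiv ℝ h z (e p) := by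
  unfold gam
  rw [Finset.sum_comm]
  refine Finset.sum_congr rfl fun i _ => ?_
  rw [Finset.sum_mul]

/-- Leibniz rule for the three factors. The last two sums contain the Hessians, whose cancellation
or survival decides the formula for `Θ`. -/
lemma fderiv_gam (hg : ∀ i j, DifferentiableAt ℝ (g i j) z) (hf : ContDiffAt ℝ 2 f z)
    (hh : ContDiffAt ℝ 2 h z) (v : E) :
    fderiv ℝ (gam e g f h) z v =
      (∑ i, ∑ j, fderiv ℝ (g i j) z v * fderiv ℝ f z (e i) * fderiv ℝ h z (e j))
      + (∑ i, ∑ j, g i j z * secondDeriv f z v (e i) * fderiv ℝ h z (e j))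
      + ∑ i, ∑ j, g i j z * fderiv ℝ f z (e i) * secondDeriv h z v (e j) := by
  have hd : HasFDerivAt (gam e g f h) (∑ i, ∑ j,
      ((g i j z * fderiv ℝ f z (e i)) • fderiv ℝ (fun x => fderiv ℝ h x (e j)) z +
       fderiv ℝ h z (e j) • (g i j z • fderiv ℝ (fun x => fderiv ℝ f x (e i)) z
        + fderiv ℝ f z (e i) • fderiv ℝ (g i j) z))) z := by
    unfold gam
    refine HasFDerivAt.fun_sum fun i _ => HasFDerivAt.fun_sum fun j _ => ?_
    exact ((hg i j).hasFDerivAt.mul (differentiableAt_fderiv_apply hf _).hasFDerivAt).mul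
      (differentiableAt_fderiv_apply hh _).hasFDerivAt
  rw [hd.fderiv]
  simp only [sum_apply, add_apply,
    smul_apply, smul_eq_mul, ← Finset.sum_add_distrib, secondDeriv]
  refine Finset.sum_congr rfl fun i _ => Finset.sum_congr rfl fun j _ => ?_
  ring

/-- The carré du champ formula for `Θ_g(h)`. -/
theorem thetaForm_fderiv (hg : ∀ i j, DifferentiableAt ℝ (g i j) z)
    (hs : ∀ i j, g i j z = g j i z) (hf : ContDiffAt ℝ 2 f z) (hh : ContDiffAt ℝ 2 h z) :
    thetaForm e g h z (fun i => fderiv ℝ f z (e i)) =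
      2 * gam e g f (gam e g f h) z - gam e g h (gam e g f f) z := by
  rw [gam_eq_sum_right (f := f) (h := gam e g f h), gam_eq_sum_right (f := h) (h := gam e g f f)]
  simp only [fderiv_gam hg hf hh, fderiv_gam hg hf hf]
  unfold thetaForm
  set V : ι → ℝ := fun p => ∑ q, g q p z * fderiv ℝ f z (e q) with hV
  set W : ι → ℝ := fun p => ∑ q, g q p z * fderiv ℝ h z (e q) with hW
  have e1 : ∀ p, ∑ i, ∑ j, g i j z * secondDeriv f z (e p) (e i) * fderiv ℝ h z (e j)
      = ∑ i, W i * secondDeriv f z (e p) (e i) := by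
    intro p
    refine Finset.sum_congr rfl fun i _ => ?_
    rw [hW, Finset.sum_mul]
    refine Finset.sum_congr rfl fun j _ => ?_
    rw [hs i j]; ring
  have e1' : ∀ p, ∑ i, ∑ j, g i j z * secondDeriv f z (e p) (e i) * fderiv ℝ f z (e j)
      = ∑ i, V i * secondDeriv f z (e p) (e i) := by
    intro p
    refine Finset.sum_congr rfl fun i _ => ?_
    rw [hV, Finset.sum_mul]
    refine Finset.sum_congr rfl fun j _ => ?_
    rw [hs i j]; ring
  have e2 : ∀ (k : E → ℝ) p, ∑ i, ∑ j, g i j z * fderiv ℝ f z (e i) * secondDeriv k z (e p) (e j)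
      = ∑ l, V l * secondDeriv k z (e p) (e l) := by
    intro k p
    rw [Finset.sum_comm]
    refine Finset.sum_congr rfl fun i _ => ?_
    rw [hV, Finset.sum_mul]
  simp only [e1, e1', e2]
  -- The only terms with the Hessian of `f` are `V·∇²f·W` in both brackets; they cancel by symmetry
  -- of the Hessian. Hence the bracket expression depends on `f` only through its gradient at the
  -- point.
  have e3 : ∑ p, W p * ∑ i, V i * secondDeriv f z (e p) (e i)
      = ∑ p, V p * ∑ i, W i * secondDeriv f z (e p) (e i) := by
    simp only [Finset.mul_sum]
    rw [Finset.sum_comm]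
    refine Finset.sum_congr rfl fun i _ => Finset.sum_congr rfl fun j _ => ?_
    rw [secondDeriv_comm hf]; ring
  have e4 : ∑ p, ∑ l, V p * V l * secondDeriv h z (e p) (e l)
      = ∑ p, V p * ∑ l, V l * secondDeriv h z (e p) (e l) := by
    refine Finset.sum_congr rfl fun i _ => ?_
    rw [Finset.mul_sum]
    refine Finset.sum_congr rfl fun j _ => ?_
    ring
  rw [e4]
  simp only [mul_add, Finset.sum_add_distrib]
  rw [e3]
  ring

end GammaCalculus

/-! ### Derivation rules for `Γ` and `P = div(g∇)`, conjugation by the weight, and the energy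
identity. -/

section GammaAlgebra

variable {E : Type*} [NormedAddCommGroup E] [NormedSpace ℝ E] {ι : Type*} [Fintype ι]
  {e : ι → E} {g : ι → ι → E → ℝ} {f h k : E → ℝ} {z : E}

lemma contDiff_fderiv_apply_const {F : Type*} [NormedAddCommGroup F] [NormedSpace ℝ F]
    {f : E → F} {m n : WithTop ℕ∞} (hf : ContDiff ℝ n f) (hmn : m + 1 ≤ n) (v : E) :
    ContDiff ℝ m (fun x => fderiv ℝ f x v) :=
  (hf.fderiv_right hmn).clm_apply contDiff_const

lemma ContDiff.gam {m n : WithTop ℕ∞} (hg : ∀ i j, ContDiff ℝ m (g i j)) (hf : ContDiff ℝ n f)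
    (hh : ContDiff ℝ n h) (hmn : m + 1 ≤ n) : ContDiff ℝ m (gam e g f h) :=
  ContDiff.sum fun i _ => ContDiff.sum fun j _ =>
    ((hg i j).mul (contDiff_fderiv_apply_const hf hmn _)).mul (contDiff_fderiv_apply_const hh hmn _)

lemma ContDiff.flux {m n : WithTop ℕ∞} (hg : ∀ i j, ContDiff ℝ m (g i j)) (hf : ContDiff ℝ n f)
    (hmn : m + 1 ≤ n) (i : ι) : ContDiff ℝ m (fun w => ∑ j, g i j w * fderiv ℝ f w (e j)) :=
  ContDiff.sum fun j _ => (hg i j).mul (contDiff_fderiv_apply_const hf hmn _)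

lemma ContDiff.divOp {k m n : WithTop ℕ∞} (hg : ∀ i j, ContDiff ℝ m (g i j)) (hf : ContDiff ℝ n f)
    (hmn : m + 1 ≤ n) (hkm : k + 1 ≤ m) : ContDiff ℝ k (divOp e g f) :=
  ContDiff.sum fun i _ => contDiff_fderiv_apply_const (ContDiff.flux hg hf hmn i) hkm _

lemma gam_mul_right (hh : DifferentiableAt ℝ h z) (hk : DifferentiableAt ℝ k z) :
    gam e g f (fun x => h x * k x) z = h z * gam e g f k z + k z * gam e g f h z := by
  unfold gam
  rw [fderiv_fun_mul hh hk]
  simp only [add_apply, smul_apply, smul_eq_mul, Finset.mul_sum, ← Finset.sum_add_distrib]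
  refine Finset.sum_congr rfl fun i _ => Finset.sum_congr rfl fun j _ => ?_
  ring

lemma gam_add_right (hh : DifferentiableAt ℝ h z) (hk : DifferentiableAt ℝ k z) :
    gam e g f (fun x => h x + k x) z = gam e g f h z + gam e g f k z := by
  unfold gam
  rw [fderiv_fun_add hh hk]
  simp only [add_apply, ← Finset.sum_add_distrib]
  refine Finset.sum_congr rfl fun i _ => Finset.sum_congr rfl fun j _ => ?_
  ring

lemma gam_const_mul_right (c : ℝ) (hh : DifferentiableAt ℝ h z) :
    gam e g f (fun x => c * h x) z = c * gam e g f h z := by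
  unfold gam
  rw [fderiv_const_mul hh]
  simp only [smul_apply, smul_eq_mul, Finset.mul_sum]
  refine Finset.sum_congr rfl fun i _ => Finset.sum_congr rfl fun j _ => ?_
  ring

lemma gam_exp_right (c : ℝ) (hh : DifferentiableAt ℝ h z) :
    gam e g f (fun x => Real.exp (c * h x)) z = c * Real.exp (c * h z) * gam e g f h z := by
  unfold gam
  rw [fderiv_exp (hh.const_mul c), fderiv_const_mul hh]
  simp only [smul_apply, smul_eq_mul, Finset.mul_sum]
  refine Finset.sum_congr rfl fun i _ => Finset.sum_congr rfl fun j _ => ?_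
  ring

lemma gam_congr_right {f h h' : E → ℝ} {z : E} (hh : h =ᶠ[𝓝 z] h') :
    gam e g f h z = gam e g f h' z := by
  unfold gam
  rw [hh.fderiv_eq]

lemma divOp_mul (hg : ∀ i j, ContDiff ℝ 1 (g i j)) (hs : ∀ i j z, g i j z = g j i z)
    (hf : ContDiff ℝ 2 f) (hh : ContDiff ℝ 2 h) (z : E) :
    divOp e g (fun x => f x * h x) z
      = f z * divOp e g h z + 2 * gam e g f h z + h z * divOp e g f z := by
  have df : Differentiable ℝ f := hf.differentiable (by norm_num)
  have dh : Differentiable ℝ h := hh.differentiable (by norm_num)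
  have e0 : ∀ i, (fun w => ∑ j, g i j w * fderiv ℝ (fun x => f x * h x) w (e j))
      = fun w => f w * (∑ j, g i j w * fderiv ℝ h w (e j))
        + h w * (∑ j, g i j w * fderiv ℝ f w (e j)) := by
    intro i
    funext w
    rw [fderiv_fun_mul (df w) (dh w)]
    simp only [add_apply, smul_apply, smul_eq_mul, Finset.mul_sum, ← Finset.sum_add_distrib]
    refine Finset.sum_congr rfl fun j _ => ?_
    ring
  have dF : ∀ {f : E → ℝ}, ContDiff ℝ 2 f → ∀ i,
      DifferentiableAt ℝ (fun w => ∑ j, g i j w * fderiv ℝ f w (e j)) z := fun hf i =>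
    ((ContDiff.flux hg hf (by norm_num) i).differentiable (by norm_num)) z
  have e1 : 2 * gam e g f h z = gam e g f h z + gam e g h f z := by
    rw [gam_comm (f := h) (fun i j => hs i j z)]; ring
  have e3 : ∀ i, fderiv ℝ (fun w => ∑ j, g i j w * fderiv ℝ (fun x => f x * h x) w (e j)) z (e i)
      = f z * fderiv ℝ (fun w => ∑ j, g i j w * fderiv ℝ h w (e j)) z (e i)
        + (∑ j, g i j z * fderiv ℝ h z (e j)) * fderiv ℝ f z (e i)
        + (h z * fderiv ℝ (fun w => ∑ j, g i j w * fderiv ℝ f w (e j)) z (e i)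
        + (∑ j, g i j z * fderiv ℝ f z (e j)) * fderiv ℝ h z (e i)) := by
    intro i
    rw [e0, fderiv_fun_add ((df z).fun_mul (dF hh i)) ((dh z).fun_mul (dF hf i)),
      fderiv_fun_mul (df z) (dF hh i), fderiv_fun_mul (dh z) (dF hf i)]
    simp only [add_apply, smul_apply, smul_eq_mul]
  unfold divOp
  rw [e1]
  unfold gam
  simp only [e3]
  rw [Finset.mul_sum, Finset.mul_sum, ← Finset.sum_add_distrib, ← Finset.sum_add_distrib,
    ← Finset.sum_add_distrib]
  refine Finset.sum_congr rfl fun i _ => ?_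
  rw [← Finset.sum_add_distrib]
  have e2 : (∑ j, (g i j z * fderiv ℝ f z (e i) * fderiv ℝ h z (e j)
      + g i j z * fderiv ℝ h z (e i) * fderiv ℝ f z (e j)))
      = (∑ j, g i j z * fderiv ℝ h z (e j)) * fderiv ℝ f z (e i)
        + (∑ j, g i j z * fderiv ℝ f z (e j)) * fderiv ℝ h z (e i) := by
    rw [Finset.sum_mul, Finset.sum_mul, ← Finset.sum_add_distrib]
    refine Finset.sum_congr rfl fun j _ => ?_
    ring
  rw [e2]
  ring

lemma divOp_exp (hg : ∀ i j, ContDiff ℝ 1 (g i j)) (hs : ∀ i j z, g i j z = g j i z)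
    (hf : ContDiff ℝ 2 f) (c : ℝ) (z : E) :
    divOp e g (fun x => Real.exp (c * f x)) z
      = Real.exp (c * f z) * (c * divOp e g f z + c ^ 2 * gam e g f f z) := by
  have df : Differentiable ℝ f := hf.differentiable (by norm_num)
  have e0 : ∀ i, (fun w => ∑ j, g i j w * fderiv ℝ (fun x => Real.exp (c * f x)) w (e j))
      = fun w => c * (Real.exp (c * f w) * (∑ j, g i j w * fderiv ℝ f w (e j))) := by
    intro i
    funext w
    rw [fderiv_exp ((df w).const_mul c), fderiv_const_mul (df w)]
    simp only [smul_apply, smul_eq_mul, Finset.mul_sum]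
    refine Finset.sum_congr rfl fun j _ => ?_
    ring
  have dF : ∀ i, DifferentiableAt ℝ (fun w => ∑ j, g i j w * fderiv ℝ f w (e j)) z := fun i =>
    ((ContDiff.flux hg hf (by norm_num) i).differentiable (by norm_num)) z
  have dE : DifferentiableAt ℝ (fun w => Real.exp (c * f w)) z := ((df z).const_mul c).exp
  rw [gam_comm (fun i j => hs i j z)]
  have e3 : ∀ i, fderiv ℝ (fun w => ∑ j, g i j w * fderiv ℝ (fun x => Real.exp (c * f x)) w (e j))
      z (e i) = Real.exp (c * f z) * (c * fderiv ℝ (fun w => ∑ j, g i j w * fderiv ℝ f w (e j)) z (e i)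
        + c ^ 2 * ∑ j, g i j z * fderiv ℝ f z (e i) * fderiv ℝ f z (e j)) := by
    intro i
    have e4 : ∑ j, g i j z * fderiv ℝ f z (e i) * fderiv ℝ f z (e j)
        = fderiv ℝ f z (e i) * ∑ j, g i j z * fderiv ℝ f z (e j) := by
      rw [Finset.mul_sum]
      refine Finset.sum_congr rfl fun j _ => ?_
      ring
    rw [e0, fderiv_const_mul (dE.fun_mul (dF i)), fderiv_fun_mul dE (dF i),
      fderiv_exp ((df z).const_mul c), fderiv_const_mul (df z), e4]
    simp only [add_apply, smul_apply, smul_eq_mul]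
    ring
  unfold divOp gam
  simp only [e3]
  rw [Finset.mul_sum, Finset.mul_sum, ← Finset.sum_add_distrib, Finset.mul_sum]

/-- Conjugation of the operator with the weight `exp (s φ)`. -/
lemma exp_mul_divOp {φ v : E → ℝ} (hg : ∀ i j, ContDiff ℝ 1 (g i j))
    (hs : ∀ i j z, g i j z = g j i z) (hφ : ContDiff ℝ 2 φ) (hv : ContDiff ℝ 2 v) (s : ℝ) (z : E) :
    let w := fun x => Real.exp (s * φ x) * v x
    Real.exp (s * φ z) * divOp e g v z
      = divOp e g w z - 2 * s * gam e g φ w z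
        + (s ^ 2 * gam e g φ φ z - s * divOp e g φ z) * w z := by
  intro w
  have dφ : Differentiable ℝ φ := hφ.differentiable (by norm_num)
  have dv : Differentiable ℝ v := hv.differentiable (by norm_num)
  have hE : ContDiff ℝ 2 (fun x => Real.exp (s * φ x)) := (contDiff_const.mul hφ).exp
  have h1 : divOp e g w z = _ := divOp_mul (e := e) hg hs hE hv z
  have h2 : gam e g φ w z = _ :=
    gam_mul_right (e := e) (g := g) (f := φ) ((hE.differentiable (by norm_num)) z) (dv z)
  have h3 : gam e g (fun x => Real.exp (s * φ x)) v z
      = s * Real.exp (s * φ z) * gam e g φ v z := by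
    rw [gam_comm (fun i j => hs i j z), gam_exp_right s (dφ z), gam_comm (fun i j => hs i j z)]
  rw [h1, h2, h3, gam_exp_right s (dφ z), divOp_exp hg hs hφ]
  ring

/-- The pointwise identity behind the weighted energy estimate: the product of the symmetric part
with the multiplier is a positive form up to divergences. -/
lemma energy_identity {φ w : E → ℝ} (hg : ∀ i j, ContDiff ℝ 2 (g i j))
    (hs : ∀ i j z, g i j z = g j i z) (hφ : ContDiff ℝ 3 φ) (hw : ContDiff ℝ 3 w) (s μ : ℝ) (z : E) :
    let M := fun x => 2 * gam e g φ w x + (divOp e g φ x - μ) * w x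
    let W := fun x => gam e g φ φ x * (w x * w x);
    -((divOp e g w z + s ^ 2 * gam e g φ φ z * w z) * M z)
      = (thetaForm e g φ z (fun i => fderiv ℝ w z (e i)) - μ * gam e g w w z
          + w z * gam e g w (divOp e g φ) z
          + s ^ 2 * (thetaForm e g φ z (fun i => fderiv ℝ φ z (e i)) + μ * gam e g φ φ z) * w z ^ 2)
        - (divOp e g w z * M z + gam e g M w z)
        + (divOp e g φ z * gam e g w w z + gam e g (gam e g w w) φ z)
        - s ^ 2 * (divOp e g φ z * W z + gam e g W φ z) := by
  intro M W
  have one : (1 : WithTop ℕ∞) ≠ 0 := by norm_num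
  have hφ2 : ContDiff ℝ 2 φ := hφ.of_le (by norm_num)
  have hw2 : ContDiff ℝ 2 w := hw.of_le (by norm_num)
  have dg : ∀ i j, DifferentiableAt ℝ (g i j) z := fun i j =>
    ((hg i j).differentiable (by norm_num)) z
  have hsz : ∀ i j, g i j z = g j i z := fun i j => hs i j z
  have hg1 : ∀ i j, ContDiff ℝ 1 (g i j) := fun i j => (hg i j).of_le (by norm_num)
  have dP : DifferentiableAt ℝ (divOp e g φ) z :=
    ((ContDiff.divOp (k := 1) hg hφ (by norm_num) (by norm_num)).differentiable one) z
  have dG : ∀ {a b : E → ℝ}, ContDiff ℝ 2 a → ContDiff ℝ 2 b → DifferentiableAt ℝ (gam e g a b) z :=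
    fun ha hb => ((ContDiff.gam (m := 1) hg1 ha hb (by norm_num)).differentiable one) z
  have dw : DifferentiableAt ℝ w z := (hw.differentiable (by norm_num)) z
  -- For `w`, this trades `2Γ(w, Γ(w, φ))`, which comes from the multiplier, for `Θ(∇w) + Γ(φ, Γ(w,
  -- w))`. For `φ` itself it reduces to `Θ(∇φ) = Γ(φ, Γ(φ, φ))`, the coefficient that appears in
  -- front of `s²w²`.
  have t1 := thetaForm_fderiv (e := e) dg hsz (f := w) (h := φ) hw2.contDiffAt hφ2.contDiffAt
  have t2 := thetaForm_fderiv (e := e) dg hsz (f := φ) (h := φ) hφ2.contDiffAt hφ2.contDiffAt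
  have m1 : gam e g M w z = 2 * gam e g w (gam e g w φ) z + ((divOp e g φ z - μ) * gam e g w w z
      + w z * gam e g w (divOp e g φ) z) := by
    rw [gam_comm hsz]
    change gam e g w (fun x => 2 * gam e g φ w x + (divOp e g φ x - μ) * w x) z = _
    rw [gam_add_right ((dG hφ2 hw2).const_mul 2) ((dP.sub_const μ).fun_mul dw),
      gam_const_mul_right 2 (dG hφ2 hw2), gam_mul_right (dP.sub_const μ) dw]
    have : gam e g w (fun x => divOp e g φ x - μ) z = gam e g w (divOp e g φ) z := by
      unfold gam
      rw [fderiv_sub_const]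
    rw [this]
    have : gam e g φ w = gam e g w φ := by
      funext x
      exact gam_comm fun i j => hs i j x
    rw [this]
  have m2 : gam e g W φ z = gam e g φ φ z * (2 * w z * gam e g φ w z)
      + w z ^ 2 * gam e g φ (gam e g φ φ) z := by
    rw [gam_comm hsz, show gam e g φ W z = _ from gam_mul_right (dG hφ2 hφ2) (dw.fun_mul dw),
      gam_mul_right dw dw]
    ring
  rw [m1, m2, t1, t2, gam_comm hsz (f := gam e g w w)]
  simp only [M, W]
  ring

lemma fderiv_apply_eq_zero_of_notMem_tsupport {F : Type*} [NormedAddCommGroup F] [NormedSpace ℝ F]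
    {f : E → F} (hz : z ∉ tsupport f) (v : E) :
    fderiv ℝ f z v = 0 := by
  have : fderiv ℝ f z = 0 := by
    by_contra hne
    exact hz (support_fderiv_subset ℝ hne)
  rw [this]
  rfl

lemma gam_eq_zero_of_notMem_tsupport_left (hz : z ∉ tsupport f) : gam e g f h z = 0 := by
  refine Finset.sum_eq_zero fun i _ => Finset.sum_eq_zero fun j _ => ?_
  rw [fderiv_apply_eq_zero_of_notMem_tsupport hz]
  ring

lemma gam_eq_zero_of_notMem_tsupport_right (hz : z ∉ tsupport h) : gam e g f h z = 0 := by
  refine Finset.sum_eq_zero fun i _ => Finset.sum_eq_zero fun j _ => ?_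
  rw [fderiv_apply_eq_zero_of_notMem_tsupport hz]
  ring

lemma divOp_eq_zero_of_notMem_tsupport (hz : z ∉ tsupport f) : divOp e g f z = 0 := by
  refine Finset.sum_eq_zero fun i _ => ?_
  have : (fun w => ∑ j, g i j w * fderiv ℝ f w (e j)) =ᶠ[𝓝 z] fun _ => 0 := by
    filter_upwards [(isClosed_tsupport f).isOpen_compl.mem_nhds hz] with w hw
    refine Finset.sum_eq_zero fun j _ => ?_
    rw [fderiv_apply_eq_zero_of_notMem_tsupport hw]
    ring
  rw [this.fderiv_eq]
  simp

end GammaAlgebra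

/-! ### Integration by parts. -/

section EnergyEstimate

variable {E : Type*} [NormedAddCommGroup E] [NormedSpace ℝ E] [FiniteDimensional ℝ E]
  [MeasureSpace E] [BorelSpace E] [(volume : Measure E).IsAddHaarMeasure]
  {ι : Type*} [Fintype ι] {e : ι → E} {g : ι → ι → E → ℝ} {f h k φ : E → ℝ} {z : E}

/-- The integrand is the divergence of `k · g∇f`. Compact support is asked of `k` alone, so that `f`
may be the weight. -/
lemma integral_divOp_mul_add_gam (hg : ∀ i j, ContDiff ℝ 1 (g i j)) (hf : ContDiff ℝ 2 f)
    (hk : ContDiff ℝ 1 k) (hc : HasCompactSupport k) :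
    ∫ z, (divOp e g f z * k z + gam e g k f z) = 0 := by
  have hF : ∀ i, ContDiff ℝ 1 (fun w => ∑ j, g i j w * fderiv ℝ f w (e j)) := fun i =>
    ContDiff.flux hg hf (by norm_num) i
  have key : ∀ i, Integrable (fun z => fderiv ℝ (fun w => ∑ j, g i j w * fderiv ℝ f w (e j)) z (e i)
        * k z + (∑ j, g i j z * fderiv ℝ f z (e j)) * fderiv ℝ k z (e i)) ∧
      ∫ z, (fderiv ℝ (fun w => ∑ j, g i j w * fderiv ℝ f w (e j)) z (e i) * k z
        + (∑ j, g i j z * fderiv ℝ f z (e j)) * fderiv ℝ k z (e i)) = 0 := by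
    intro i
    have i1 : Integrable (fun z => fderiv ℝ (fun w => ∑ j, g i j w * fderiv ℝ f w (e j)) z (e i)
        * k z) :=
      ((contDiff_fderiv_apply_const (m := 0) (hF i) (by norm_num) _).continuous.mul
        hk.continuous).integrable_of_hasCompactSupport hc.mul_left
    have i2 : Integrable (fun z => (∑ j, g i j z * fderiv ℝ f z (e j)) * fderiv ℝ k z (e i)) :=
      ((hF i).continuous.mul
        (contDiff_fderiv_apply_const (m := 0) hk (by norm_num) _).continuous).integrable_of_hasCompactSupport
        (hc.fderiv_apply ℝ (e i)).mul_left
    have i3 : Integrable (fun z => (∑ j, g i j z * fderiv ℝ f z (e j)) * k z) :=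
      ((hF i).continuous.mul hk.continuous).integrable_of_hasCompactSupport hc.mul_left
    refine ⟨i1.add i2, ?_⟩
    rw [integral_add i1 i2, integral_mul_fderiv_eq_neg_fderiv_mul_of_integrable i1 i2 i3
      (fun x _ => (hF i).differentiable one_ne_zero x) (fun x _ => hk.differentiable one_ne_zero x)]
    ring
  have e0 : (fun z => divOp e g f z * k z + gam e g k f z) = fun z => ∑ i,
      (fderiv ℝ (fun w => ∑ j, g i j w * fderiv ℝ f w (e j)) z (e i) * k z
        + (∑ j, g i j z * fderiv ℝ f z (e j)) * fderiv ℝ k z (e i)) := by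
    funext z
    unfold divOp gam
    rw [Finset.sum_mul, ← Finset.sum_add_distrib]
    refine Finset.sum_congr rfl fun i _ => ?_
    rw [Finset.sum_mul]
    congr 1
    refine Finset.sum_congr rfl fun j _ => ?_
    ring
  rw [e0, integral_finsetSum _ fun i _ => (key i).1]
  exact Finset.sum_eq_zero fun i _ => (key i).2

end EnergyEstimate

/-! ### The pointwise form of the Carleman estimate. -/

section CarlemanPointwise

/-- The bookkeeping at one point: `F` is the conjugated operator applied to `w`, `L` and `M` are its
symmetric part and the multiplier, `D = |∇w|²`, the `dᵢ` are divergences and `G` is the weighted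
energy density of `v`. The shift `sμw` is an error of size `s²w²`, which the positive term of size
`s³w²` beats for large `s`. -/
lemma carleman_arith {s c μ B₁ B₂ w D F L M Q d₁ d₂ d₃ G : ℝ} (hs1 : 1 ≤ s) (hc : 0 < c)
    (hB₁ : 0 ≤ B₁) (hB₂ : 0 ≤ B₂) (hs2 : B₁ / c + μ ^ 2 ≤ s * c) (hD : 0 ≤ D)
    (hFL : F + s * μ * w = L - s * M) (hQ : -(L * M) = Q - d₁ + d₂ - s ^ 2 * d₃)
    (lower : c / 2 * D + (s ^ 2 * c - B₁ / (2 * c)) * w ^ 2 ≤ Q)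
    (grad : G ≤ 2 * D + (2 * B₂ + 1) * s ^ 2 * w ^ 2) :
    s * G ≤ (1 + B₂) / c * 2 * F ^ 2 + (1 + B₂) / c * (4 * s) * d₁ - (1 + B₂) / c * (4 * s) * d₂
      + (1 + B₂) / c * (4 * s * s ^ 2) * d₃ := by
  have hspos : 0 < s := by linarith
  -- `-4sLM = (L - sM)² - (L + sM)² ≤ (F + sμw)²`, and the last square is split by `(a + b)² ≤ 2a² +
  -- 2b²`.
  have sq1 : 4 * s * -(L * M) ≤ 2 * F ^ 2 + 2 * s ^ 2 * μ ^ 2 * w ^ 2 := by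
    have h1 : (F + s * μ * w) ^ 2 = (L - s * M) ^ 2 := by rw [hFL]
    have h2 := sq_nonneg (F - s * μ * w)
    have h3 := sq_nonneg (L + s * M)
    linarith
  have sq2 : 4 * s * (c / 2 * D + (s ^ 2 * c - B₁ / (2 * c)) * w ^ 2 - d₁ + d₂ - s ^ 2 * d₃)
      ≤ 4 * s * -(L * M) := by
    refine mul_le_mul_of_nonneg_left ?_ (by positivity)
    linarith
  -- Of the available `4s³c`, half pays for both error terms; this is exactly what the lower bounds
  -- on `s` provide.
  have sbig : 2 * s ^ 3 * c ≤ 4 * s * (s ^ 2 * c - B₁ / (2 * c)) - 2 * s ^ 2 * μ ^ 2 := by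
    have e6 : B₁ / (2 * c) = B₁ / c / 2 := by rw [mul_comm, div_mul_eq_div_div]
    rw [e6]
    have a1 : 0 ≤ B₁ / c := by positivity
    have a2 : B₁ / c ≤ s * (B₁ / c) := le_mul_of_one_le_left a1 hs1
    have a3 : s * (B₁ / c + μ ^ 2) ≤ s * (s * c) := mul_le_mul_of_nonneg_left hs2 hspos.le
    have a4 : 2 * s * (B₁ / c + s * μ ^ 2) ≤ 2 * s * (s * (s * c)) :=
      mul_le_mul_of_nonneg_left (by linarith) (by positivity)
    linarith
  have sbig' := mul_le_mul_of_nonneg_right sbig (sq_nonneg w)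
  have total : 2 * s * c * D + 2 * s ^ 3 * c * w ^ 2
      ≤ 2 * F ^ 2 + 4 * s * d₁ - 4 * s * d₂ + 4 * s * s ^ 2 * d₃ := by
    linarith
  have fin := mul_le_mul_of_nonneg_left total (show 0 ≤ (1 + B₂) / c by positivity)
  have lhs : s * G ≤ (1 + B₂) / c * (2 * s * c * D + 2 * s ^ 3 * c * w ^ 2) := by
    have e7 : (1 + B₂) / c * (2 * s * c * D + 2 * s ^ 3 * c * w ^ 2)
        = (1 + B₂) * (2 * s * D + 2 * s ^ 3 * w ^ 2) := by field_simp
    rw [e7]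
    refine (mul_le_mul_of_nonneg_left grad hspos.le).trans ?_
    have a1 : 0 ≤ B₂ * (s * D) := by positivity
    have a2 : 0 ≤ s ^ 3 * w ^ 2 := by positivity
    linarith
  linarith

variable {E : Type*} [NormedAddCommGroup E] [NormedSpace ℝ E]
  {ι : Type*} [Fintype ι] {e : ι → E} {g : ι → ι → E → ℝ} {φ : E → ℝ}

/-- The conjugation formula, the energy identity and the positivity of the two forms combine at each
point. The three brackets on the right are divergences, kept in the form in which they integrate to
zero. Positivity is asked only for `z ∈ K`, because `v` vanishes near every other point. -/
lemma carleman_pointwise {K : Set E} (hg : ∀ i j, ContDiff ℝ 2 (g i j))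
    (hs : ∀ i j z, g i j z = g j i z) (hφ : ContDiff ℝ 3 φ) {μ c : ℝ} (hc : 0 < c) {z : E}
    (hpos : z ∈ K → ∀ ξ : ι → ℝ,
      c * ∑ i, ξ i ^ 2 ≤ thetaForm e g φ z ξ - μ * ∑ i, ∑ j, g i j z * ξ i * ξ j)
    (hpos' : z ∈ K → c ≤ thetaForm e g φ z (fun i => fderiv ℝ φ z (e i)) + μ * gam e g φ φ z)
    {B₁ B₂ : ℝ} (hB₁ : z ∈ K → ∑ i, (∑ j, g i j z * fderiv ℝ (divOp e g φ) z (e j)) ^ 2 ≤ B₁)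
    (hB₂ : z ∈ K → ∑ i, fderiv ℝ φ z (e i) ^ 2 ≤ B₂) (hB₁' : 0 ≤ B₁) (hB₂' : 0 ≤ B₂)
    {s : ℝ} (hs1 : 1 ≤ s) (hs2 : B₁ / c + μ ^ 2 ≤ s * c) {v : E → ℝ} (hv : ContDiff ℝ 3 v)
    (hvK : tsupport v ⊆ K) {w M W : E → ℝ} (hw : w = fun x => Real.exp (s * φ x) * v x)
    (hM : M = fun x => 2 * gam e g φ w x + (divOp e g φ x - μ) * w x)
    (hW : W = fun x => gam e g φ φ x * (w x * w x)) :
    s * (Real.exp (2 * s * φ z) * (∑ i, fderiv ℝ v z (e i) ^ 2 + v z ^ 2))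
      ≤ (1 + B₂) / c * 2 * (Real.exp (2 * s * φ z) * divOp e g v z ^ 2)
        + (1 + B₂) / c * (4 * s) * (divOp e g w z * M z + gam e g M w z)
        - (1 + B₂) / c * (4 * s) * (divOp e g φ z * gam e g w w z + gam e g (gam e g w w) φ z)
        + (1 + B₂) / c * (4 * s * s ^ 2) * (divOp e g φ z * W z + gam e g W φ z) := by
  have hspos : 0 < s := by linarith
  have hv2 : ContDiff ℝ 2 v := hv.of_le (by norm_num)
  have hE : ContDiff ℝ 3 (fun x => Real.exp (s * φ x)) := (contDiff_const.mul hφ).exp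
  have hwC : ContDiff ℝ 3 w := hw ▸ hE.mul hv
  have hwt : tsupport w ⊆ tsupport v :=
    hw ▸  closure_mono (Function.support_mul_subset_right _ _)
  have hg1 : ∀ i j, ContDiff ℝ 1 (g i j) := fun i j => (hg i j).of_le (by norm_num)
  have hφ2 : ContDiff ℝ 2 φ := hφ.of_le (by norm_num)
  have id1 : Real.exp (s * φ z) * divOp e g v z = divOp e g w z - 2 * s * gam e g φ w z
      + (s ^ 2 * gam e g φ φ z - s * divOp e g φ z) * w z :=
    hw ▸ exp_mul_divOp (e := e) hg1 hs hφ2 hv2 s z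
  have id2 : -((divOp e g w z + s ^ 2 * gam e g φ φ z * w z) * M z)
      = (thetaForm e g φ z (fun i => fderiv ℝ w z (e i)) - μ * gam e g w w z
          + w z * gam e g w (divOp e g φ) z
          + s ^ 2 * (thetaForm e g φ z (fun i => fderiv ℝ φ z (e i)) + μ * gam e g φ φ z) * w z ^ 2)
        - (divOp e g w z * M z + gam e g M w z)
        + (divOp e g φ z * gam e g w w z + gam e g (gam e g w w) φ z)
        - s ^ 2 * (divOp e g φ z * W z + gam e g W φ z) :=
    hM ▸ hW ▸ energy_identity (e := e) hg hs hφ hwC s μ z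
  have lower : c / 2 * (∑ i, fderiv ℝ w z (e i) ^ 2) + (s ^ 2 * c - B₁ / (2 * c)) * w z ^ 2 ≤
      thetaForm e g φ z (fun i => fderiv ℝ w z (e i)) - μ * gam e g w w z
        + w z * gam e g w (divOp e g φ) z
        + s ^ 2 * (thetaForm e g φ z (fun i => fderiv ℝ φ z (e i)) + μ * gam e g φ φ z)
          * w z ^ 2 := by
    -- Off the support of `w` both sides are zero, so positivity is needed on `K` only.
    by_cases hz : z ∈ tsupport w
    · have hzK := hvK (hwt hz)
      have p1 := hpos hzK (fun i => fderiv ℝ w z (e i))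
      have p2 : c * w z ^ 2 ≤ (thetaForm e g φ z (fun i => fderiv ℝ φ z (e i))
          + μ * gam e g φ φ z) * w z ^ 2 := mul_le_mul_of_nonneg_right (hpos' hzK) (sq_nonneg _)
      -- Young's inequality for the cross term `w Γ(w, Pφ)`: it costs half of `c|∇w|²` and a
      -- multiple of `w²` without the factor `s²`.
      have p3 : -(c / 2 * (∑ i, fderiv ℝ w z (e i) ^ 2)) - B₁ / (2 * c) * w z ^ 2
          ≤ w z * gam e g w (divOp e g φ) z := by
        have q1 : gam e g w (divOp e g φ) z = ∑ i, fderiv ℝ w z (e i) *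
            ∑ j, g i j z * fderiv ℝ (divOp e g φ) z (e j) := by
          unfold gam
          refine Finset.sum_congr rfl fun i _ => ?_
          rw [Finset.mul_sum]
          refine Finset.sum_congr rfl fun j _ => ?_
          ring
        set b : ι → ℝ := fun i => ∑ j, g i j z * fderiv ℝ (divOp e g φ) z (e j) with hb
        have q2 : ∑ i, b i ^ 2 ≤ B₁ := hB₁ hzK
        have q3 : -(c / 2 * (∑ i, fderiv ℝ w z (e i) ^ 2)) - (∑ i, b i ^ 2) / (2 * c) * w z ^ 2
            ≤ w z * ∑ i, fderiv ℝ w z (e i) * b i := by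
          have q4 : ∀ i, -(c / 2 * fderiv ℝ w z (e i) ^ 2) - b i ^ 2 / (2 * c) * w z ^ 2
              ≤ w z * (fderiv ℝ w z (e i) * b i) := by
            intro i
            have : 0 ≤ (c * fderiv ℝ w z (e i) + b i * w z) ^ 2 / (2 * c) := by positivity
            have e5 : (c * fderiv ℝ w z (e i) + b i * w z) ^ 2 / (2 * c)
              = c / 2 * fderiv ℝ w z (e i) ^ 2 + b i ^ 2 / (2 * c) * w z ^ 2
                + w z * (fderiv ℝ w z (e i) * b i) := by
              field_simp
              ring
            linarith
          have q5 := Finset.sum_le_sum fun i (_ : i ∈ Finset.univ) => q4 i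
          rw [Finset.sum_sub_distrib, Finset.sum_neg_distrib, ← Finset.mul_sum, ← Finset.mul_sum,
            ← Finset.sum_mul, ← Finset.sum_div] at q5
          exact q5
        have q6 : (∑ i, b i ^ 2) / (2 * c) * w z ^ 2 ≤ B₁ / (2 * c) * w z ^ 2 := by gcongr
        rw [q1]
        linarith
      have p4 := mul_le_mul_of_nonneg_left p2 (sq_nonneg s)
      have p5 : ∑ i, ∑ j, g i j z * fderiv ℝ w z (e i) * fderiv ℝ w z (e j) = gam e g w w z := rfl
      rw [p5] at p1
      linarith
    · rw [gam_eq_zero_of_notMem_tsupport_right hz, gam_eq_zero_of_notMem_tsupport_left hz,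
        image_eq_zero_of_notMem_tsupport hz]
      simp only [fderiv_apply_eq_zero_of_notMem_tsupport hz]
      simp [thetaForm]
  -- Passing back from `w` to `v` costs `s|∇φ||w|`, whose square `s²w²` is controlled by the
  -- zero-order term.
  have dvw : ∀ i, Real.exp (s * φ z) * fderiv ℝ v z (e i)
      = fderiv ℝ w z (e i) - s * fderiv ℝ φ z (e i) * w z := by
    intro i
    have dφ := (hφ.differentiable (by norm_num)) z
    rw [hw, fderiv_fun_mul ((hE.differentiable (by norm_num)) z)
      ((hv.differentiable (by norm_num)) z), fderiv_exp (dφ.const_mul s), fderiv_const_mul dφ]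
    simp only [add_apply, smul_apply, smul_eq_mul]
    ring
  have exp2 : Real.exp (2 * s * φ z) = Real.exp (s * φ z) ^ 2 := by
    rw [← Real.exp_nat_mul]
    congr 1
    push_cast
    ring
  have grad : Real.exp (2 * s * φ z) * (∑ i, fderiv ℝ v z (e i) ^ 2 + v z ^ 2)
      ≤ 2 * (∑ i, fderiv ℝ w z (e i) ^ 2) + (2 * B₂ + 1) * s ^ 2 * w z ^ 2 := by
    by_cases hz : z ∈ tsupport v
    · have q2 : ∑ i, fderiv ℝ φ z (e i) ^ 2 ≤ B₂ :=
        hB₂ (hvK hz)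
      have q3 : ∑ i, (Real.exp (s * φ z) * fderiv ℝ v z (e i)) ^ 2
          ≤ ∑ i, (2 * fderiv ℝ w z (e i) ^ 2 + 2 * s ^ 2 * w z ^ 2 * fderiv ℝ φ z (e i) ^ 2) := by
        refine Finset.sum_le_sum fun i _ => ?_
        rw [dvw]
        nlinarith [sq_nonneg (fderiv ℝ w z (e i) + s * fderiv ℝ φ z (e i) * w z)]
      rw [Finset.sum_add_distrib, ← Finset.mul_sum, ← Finset.mul_sum] at q3
      have q4 : 2 * s ^ 2 * w z ^ 2 * ∑ i, fderiv ℝ φ z (e i) ^ 2 ≤ 2 * s ^ 2 * w z ^ 2 * B₂ := by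
        gcongr
      have q5 : w z ^ 2 ≤ s ^ 2 * w z ^ 2 := le_mul_of_one_le_left (sq_nonneg _) (one_le_pow₀ hs1)
      have q6 : Real.exp (2 * s * φ z) * (∑ i, fderiv ℝ v z (e i) ^ 2 + v z ^ 2)
          = ∑ i, (Real.exp (s * φ z) * fderiv ℝ v z (e i)) ^ 2 + w z ^ 2 := by
        simp only [mul_pow, exp2, ← Finset.mul_sum, hw]
        ring
      rw [q6]
      linarith
    · rw [image_eq_zero_of_notMem_tsupport hz, Finset.sum_eq_zero fun i _ => by
        rw [fderiv_apply_eq_zero_of_notMem_tsupport hz]; ring]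
      have : 0 ≤ ∑ i, fderiv ℝ w z (e i) ^ 2 := Finset.sum_nonneg fun i _ => sq_nonneg _
      have : 0 ≤ (2 * B₂ + 1) * s ^ 2 * w z ^ 2 := by positivity
      simp only [ne_eq, OfNat.ofNat_ne_zero, not_false_eq_true, zero_pow, add_zero, mul_zero]
      linarith
  have hF2 : Real.exp (2 * s * φ z) * divOp e g v z ^ 2 = (Real.exp (s * φ z) * divOp e g v z) ^ 2 := by
    rw [exp2]; ring
  rw [hF2]
  refine carleman_arith hs1 hc hB₁' hB₂' hs2 (Finset.sum_nonneg fun i _ => sq_nonneg _) ?_ id2 lower grad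
  rw [id1, hM]
  ring

end CarlemanPointwise

/-! ### The integrated Carleman estimate for smooth real functions. -/

section CarlemanEstimate

variable {E : Type*} [NormedAddCommGroup E] [NormedSpace ℝ E] [FiniteDimensional ℝ E]
  [MeasureSpace E] [BorelSpace E] [(volume : Measure E).IsAddHaarMeasure]
  {ι : Type*} [Fintype ι] {e : ι → E} {g : ι → ι → E → ℝ} {f h k φ : E → ℝ} {z : E}

lemma integrable_divOp_mul_add_gam (hg : ∀ i j, ContDiff ℝ 1 (g i j)) (hf : ContDiff ℝ 2 f)
    (hk : ContDiff ℝ 1 k) (hc : HasCompactSupport k) :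
    Integrable (fun z => divOp e g f z * k z + gam e g k f z) := by
  have c1 : Continuous (divOp e g f) :=
    (ContDiff.divOp (k := 0) hg hf (by norm_num) (by norm_num)).continuous
  have c2 : Continuous (gam e g k f) :=
    (ContDiff.gam (m := 0) (n := 1) (fun i j => (hg i j).of_le (by norm_num)) hk
      (hf.of_le (by norm_num)) (by norm_num)).continuous
  refine ((c1.mul hk.continuous).add c2).integrable_of_hasCompactSupport ?_
  refine HasCompactSupport.intro hc fun z hz => ?_
  change divOp e g f z * k z + gam e g k f z = 0
  rw [gam_eq_zero_of_notMem_tsupport_left hz, image_eq_zero_of_notMem_tsupport hz]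
  ring

lemma integral_le_of_le_add_divergences {f F d₁ d₂ d₃ : E → ℝ} {s a b c : ℝ} (hf : Integrable f)
    (hF : Integrable F) (i₁ : Integrable d₁) (i₂ : Integrable d₂) (i₃ : Integrable d₃)
    (j₁ : ∫ z, d₁ z = 0) (j₂ : ∫ z, d₂ z = 0) (j₃ : ∫ z, d₃ z = 0)
    (h : ∀ z, s * f z ≤ a * F z + b * d₁ z - b * d₂ z + c * d₃ z) :
    s * ∫ z, f z ≤ a * ∫ z, F z := by
  have k₁ := (hF.const_mul a).add (i₁.const_mul b)
  have k₂ := k₁.sub (i₂.const_mul b)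
  have h5 := integral_mono (hf.const_mul s) (k₂.add (i₃.const_mul c)) h
  rw [integral_const_mul, integral_add' k₂ (i₃.const_mul c), integral_sub' k₁ (i₂.const_mul b),
    integral_add' (hF.const_mul a) (i₁.const_mul b)] at h5
  simp only [integral_const_mul, j₁, j₂, j₃] at h5
  linarith

/-- A Carleman estimate with a weight `φ` for which `Θ_g(φ) - μ g` is positive definite. -/
theorem carleman_estimate {K : Set E} (hK : IsCompact K) (hg : ∀ i j, ContDiff ℝ 2 (g i j))
    (hs : ∀ i j z, g i j z = g j i z) (hφ : ContDiff ℝ 3 φ) {μ c : ℝ} (hc : 0 < c)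
    (hpos : ∀ z ∈ K, ∀ ξ : ι → ℝ,
      c * ∑ i, ξ i ^ 2 ≤ thetaForm e g φ z ξ - μ * ∑ i, ∑ j, g i j z * ξ i * ξ j)
    (hpos' : ∀ z ∈ K, c ≤ thetaForm e g φ z (fun i => fderiv ℝ φ z (e i)) + μ * gam e g φ φ z) :
    ∃ C > 0, ∃ s₀ > 0, ∀ s ≥ s₀, ∀ v : E → ℝ, ContDiff ℝ 3 v → tsupport v ⊆ K →
      s * ∫ z, Real.exp (2 * s * φ z) * (∑ i, fderiv ℝ v z (e i) ^ 2 + v z ^ 2)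
        ≤ C * ∫ z, Real.exp (2 * s * φ z) * divOp e g v z ^ 2 := by
  have hg1 : ∀ i j, ContDiff ℝ 1 (g i j) := fun i j => (hg i j).of_le (by norm_num)
  have hφ2 : ContDiff ℝ 2 φ := hφ.of_le (by norm_num)
  have hP : ContDiff ℝ 1 (divOp e g φ) := ContDiff.divOp hg hφ (by norm_num) (by norm_num)
  have cb : ∀ i, Continuous (fun z => ∑ j, g i j z * fderiv ℝ (divOp e g φ) z (e j)) := fun i =>
    (ContDiff.flux (m := 0) (fun i j => (hg i j).of_le (by norm_num)) hP (by norm_num) i).continuous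
  have c₁ : Continuous fun z => ∑ i, (∑ j, g i j z * fderiv ℝ (divOp e g φ) z (e j)) ^ 2 :=
    continuous_finsetSum _ fun i _ => (cb i).pow 2
  have c₂ : Continuous fun z => ∑ i, fderiv ℝ φ z (e i) ^ 2 := by
    refine continuous_finsetSum _ fun i _ => Continuous.pow ?_ 2
    exact (contDiff_fderiv_apply_const (m := 0) hφ (by norm_num) (e i)).continuous
  obtain ⟨B₁, hB₁⟩ := hK.exists_bound_of_continuousOn c₁.continuousOn
  obtain ⟨B₂, hB₂⟩ := hK.exists_bound_of_continuousOn c₂.continuousOn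
  have hBp : 0 < 1 + |B₂| := by positivity
  -- The threshold consists of the two largeness conditions of `carleman_arith`. The absolute values
  -- supply nonnegativity, which the compactness bounds do not give when `K` is empty.
  refine ⟨(1 + |B₂|) / c * 2, by positivity, max 1 ((|B₁| / c + μ ^ 2) / c), by positivity, ?_⟩
  intro s hs0 v hv hvK
  have hs1 : 1 ≤ s := (le_max_left _ _).trans hs0
  have hs2 : |B₁| / c + μ ^ 2 ≤ s * c := (div_le_iff₀ hc).1 ((le_max_right _ _).trans hs0)
  have hspos : 0 < s := by linarith
  have hv2 : ContDiff ℝ 2 v := hv.of_le (by norm_num)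
  have hvc : HasCompactSupport v := hK.of_isClosed_subset (isClosed_tsupport v) hvK
  have hE : ContDiff ℝ 3 (fun x => Real.exp (s * φ x)) := (contDiff_const.mul hφ).exp
  obtain ⟨w, hw⟩ : ∃ w : E → ℝ, w = fun x => Real.exp (s * φ x) * v x := ⟨_, rfl⟩
  have hwC : ContDiff ℝ 3 w := by rw [hw]; exact hE.mul hv
  have hwc : HasCompactSupport w := by rw [hw]; exact hvc.mul_left
  have hw2 : ContDiff ℝ 2 w := hwC.of_le (by norm_num)
  obtain ⟨M, hM⟩ : ∃ M : E → ℝ, M = fun x => 2 * gam e g φ w x + (divOp e g φ x - μ) * w x := ⟨_, rfl⟩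
  obtain ⟨W, hW⟩ : ∃ W : E → ℝ, W = fun x => gam e g φ φ x * (w x * w x) := ⟨_, rfl⟩
  have hMC : ContDiff ℝ 1 M := by
    rw [hM]
    exact (contDiff_const.mul (ContDiff.gam hg1 hφ2 hw2 (by norm_num))).add
      ((hP.sub contDiff_const).mul (hwC.of_le (by norm_num)))
  have hMc : HasCompactSupport M := by
    refine HasCompactSupport.intro hwc fun z hz => ?_
    simp only [hM]
    rw [gam_eq_zero_of_notMem_tsupport_right hz, image_eq_zero_of_notMem_tsupport hz]
    ring
  have hWC : ContDiff ℝ 1 W := by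
    rw [hW]
    exact (ContDiff.gam hg1 hφ2 hφ2 (by norm_num)).mul
      ((hwC.of_le (by norm_num)).mul (hwC.of_le (by norm_num)))
  have hWc : HasCompactSupport W := by rw [hW]; exact hwc.mul_right.mul_left
  have hGC : ContDiff ℝ 1 (gam e g w w) := ContDiff.gam hg1 hw2 hw2 (by norm_num)
  have hGc : HasCompactSupport (gam e g w w) :=
    HasCompactSupport.intro hwc fun z hz => gam_eq_zero_of_notMem_tsupport_left hz
  have i1 := integrable_divOp_mul_add_gam (e := e) hg1 hw2 hMC hMc
  have i2 := integrable_divOp_mul_add_gam (e := e) hg1 hφ2 hGC hGc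
  have i3 := integrable_divOp_mul_add_gam (e := e) hg1 hφ2 hWC hWc
  have j1 := integral_divOp_mul_add_gam (e := e) hg1 hw2 hMC hMc
  have j2 := integral_divOp_mul_add_gam (e := e) hg1 hφ2 hGC hGc
  have j3 := integral_divOp_mul_add_gam (e := e) hg1 hφ2 hWC hWc
  have i4 : Integrable (fun z => Real.exp (2 * s * φ z) * divOp e g v z ^ 2) := by
    refine Continuous.integrable_of_hasCompactSupport ?_ ?_
    · exact (Real.continuous_exp.comp (continuous_const.mul hφ.continuous)).mul
        ((ContDiff.divOp (k := 0) hg1 hv2 (by norm_num) (by norm_num)).continuous.pow 2)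
    · refine HasCompactSupport.intro hvc fun z hz => ?_
      rw [divOp_eq_zero_of_notMem_tsupport hz]
      ring
  have i5 : Integrable (fun z => Real.exp (2 * s * φ z) *
      (∑ i, fderiv ℝ v z (e i) ^ 2 + v z ^ 2)) := by
    refine Continuous.integrable_of_hasCompactSupport ?_ ?_
    · exact (Real.continuous_exp.comp (continuous_const.mul hφ.continuous)).mul
        ((continuous_finsetSum _ fun i _ => (contDiff_fderiv_apply_const (m := 0) hv (by norm_num)
          _).continuous.pow 2).add (hv.continuous.pow 2))
    · refine HasCompactSupport.intro hvc fun z hz => ?_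
      rw [image_eq_zero_of_notMem_tsupport hz, Finset.sum_eq_zero fun i _ => ?_]
      · ring
      · rw [fderiv_apply_eq_zero_of_notMem_tsupport hz]
        ring
  have key : ∀ z, s * (Real.exp (2 * s * φ z) * (∑ i, fderiv ℝ v z (e i) ^ 2 + v z ^ 2))
      ≤ (1 + |B₂|) / c * 2 * (Real.exp (2 * s * φ z) * divOp e g v z ^ 2)
        + (1 + |B₂|) / c * (4 * s) * (divOp e g w z * M z + gam e g M w z)
        - (1 + |B₂|) / c * (4 * s) * (divOp e g φ z * gam e g w w z + gam e g (gam e g w w) φ z)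
        + (1 + |B₂|) / c * (4 * s * s ^ 2) * (divOp e g φ z * W z + gam e g W φ z) := by
    intro z
    exact carleman_pointwise hg hs hφ hc (hpos z) (hpos' z)
      (fun hz => (le_abs_self _).trans ((hB₁ z hz).trans (le_abs_self _)))
      (fun hz => (le_abs_self _).trans ((hB₂ z hz).trans (le_abs_self _)))
      (abs_nonneg _) (abs_nonneg _) hs1 hs2 hv hvK hw hM hW
  exact integral_le_of_le_add_divergences i5 i4 i1 i2 i3 j1 j2 j3 key

end CarlemanEstimate

/-! ### Invariance of pseudo-convexity -/

/-- The coordinate directions of Euclidean space. -/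
def coordDir (m : ℕ) (k : Fin m) : Eu m := EuclideanSpace.single k 1

/-- The entries of a matrix function. -/
def entries {m : ℕ} (A : Eu m → Matrix (Fin m) (Fin m) ℝ) (k l : Fin m) (x : Eu m) : ℝ := A x k l

lemma differentiableAt_gam {E : Type*} [NormedAddCommGroup E] [NormedSpace ℝ E] {ι : Type*}
    [Fintype ι] {e : ι → E} {g : ι → ι → E → ℝ} {f h : E → ℝ} {z : E}
    (hg : ∀ i j, DifferentiableAt ℝ (g i j) z) (hf : ContDiffAt ℝ 2 f z)
    (hh : ContDiffAt ℝ 2 h z) : DifferentiableAt ℝ (gam e g f h) z := by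
  unfold gam
  refine DifferentiableAt.fun_sum fun i _ => DifferentiableAt.fun_sum fun j _ => ?_
  exact ((hg i j).mul (differentiableAt_fderiv_apply hf _)).mul (differentiableAt_fderiv_apply hh _)

/-- Connects the matrix `Θ_A(h)` of the hypothesis with the form used in the calculus of `Γ`.
Symmetry of `A` at the point is what lets the indices be rearranged; the antisymmetric part of `Υ`
drops out of the quadratic form. -/
lemma dotProduct_Theta_mulVec {m : ℕ} {A : Eu m → Matrix (Fin m) (Fin m) ℝ} {x : Eu m}
    (hA : (A x).IsSymm) (h : Eu m → ℝ) (ξ : Fin m → ℝ) :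
    ξ ⬝ᵥ (Theta A h x *ᵥ ξ) = thetaForm (coordDir m) (entries A) h x ξ := by
  have hs : ∀ k l, A x k l = A x l k := fun k l => (hA.apply k l).symm
  have e1 : ξ ⬝ᵥ ((A x * hessian h x * A x) *ᵥ ξ) = ∑ p, ∑ l, (∑ q, A x q p * ξ q) *
      (∑ q, A x q l * ξ q) * secondDeriv h x (coordDir m p) (coordDir m l) := by
    rw [← Matrix.mulVec_mulVec, ← Matrix.mulVec_mulVec, Matrix.dotProduct_mulVec,
      ← Matrix.mulVec_transpose]
    simp only [dotProduct, Matrix.mulVec, Matrix.transpose_apply, Finset.mul_sum]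
    refine Finset.sum_congr rfl fun p _ => Finset.sum_congr rfl fun l _ => ?_
    have : ∀ q, A x l q = A x q l := fun q => hs l q
    simp only [this, show hessian h x p l = secondDeriv h x (coordDir m p) (coordDir m l) from rfl]
    rw [Finset.sum_mul]
    refine Finset.sum_congr rfl fun q _ => ?_
    ring
  have e2 : ξ ⬝ᵥ (Upsilon A h x *ᵥ ξ) =
      2 * (∑ p, (∑ q, A x q p * ξ q) *
        ∑ k, ∑ l, pd p (fun z => A z k l) x * ξ k * pd l h x)
      - ∑ p, (∑ q, A x q p * pd q h x) * ∑ k, ∑ l, pd p (fun z => A z k l) x * ξ k * ξ l := by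
    have f1 : ξ ⬝ᵥ (Upsilon A h x *ᵥ ξ) = ∑ k, ∑ l, ∑ j, ξ k * ξ l * (Lam A k l j x * pd j h x) := by
      simp only [dotProduct, Matrix.mulVec, Upsilon, Matrix.of_apply, Finset.mul_sum, Finset.sum_mul]
      refine Finset.sum_congr rfl fun k _ => Finset.sum_congr rfl fun l _ =>
        Finset.sum_congr rfl fun j _ => ?_
      ring
    have f2 : ∀ k l j, ξ k * ξ l * (Lam A k l j x * pd j h x)
        = 2 * (∑ p, ξ k * ξ l * (A x k p * pd p (fun z => A z l j) x) * pd j h x)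
          - ∑ p, ξ k * ξ l * (pd p (fun z => A z k l) x * A x p j) * pd j h x := by
      intro k l j
      unfold Lam
      rw [← Finset.sum_mul, ← Finset.sum_mul, ← Finset.mul_sum, ← Finset.mul_sum]
      ring
    rw [f1]
    simp only [f2, Finset.sum_sub_distrib, ← Finset.mul_sum]
    have f3 : ∑ k, ∑ l, ∑ j, ∑ p, ξ k * ξ l * (A x k p * pd p (fun z => A z l j) x) * pd j h x
        = ∑ p, (∑ q, A x q p * ξ q) *
          ∑ k, ∑ l, pd p (fun z => A z k l) x * ξ k * pd l h x := by
      have : ∀ k, ∑ l, ∑ j, ∑ p, ξ k * ξ l * (A x k p * pd p (fun z => A z l j) x) * pd j h x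
          = ∑ p, ∑ l, ∑ j, (A x k p * ξ k) * (pd p (fun z => A z l j) x * ξ l * pd j h x) := by
        intro k
        rw [Finset.sum_congr rfl fun l _ => Finset.sum_comm, Finset.sum_comm]
        refine Finset.sum_congr rfl fun p _ => Finset.sum_congr rfl fun l _ =>
          Finset.sum_congr rfl fun j _ => ?_
        ring
      rw [Finset.sum_congr rfl fun k _ => this k, Finset.sum_comm]
      refine Finset.sum_congr rfl fun p _ => ?_
      rw [Finset.sum_mul]
      simp only [Finset.mul_sum]
    have f4 : ∑ k, ∑ l, ∑ j, ∑ p, ξ k * ξ l * (pd p (fun z => A z k l) x * A x p j) * pd j h x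
        = ∑ p, (∑ q, A x q p * pd q h x) * ∑ k, ∑ l, pd p (fun z => A z k l) x * ξ k * ξ l := by
      have : ∀ k l, ∑ j, ∑ p, ξ k * ξ l * (pd p (fun z => A z k l) x * A x p j) * pd j h x
          = ∑ p, (∑ q, A x q p * pd q h x) * (pd p (fun z => A z k l) x * ξ k * ξ l) := by
        intro k l
        rw [Finset.sum_comm]
        refine Finset.sum_congr rfl fun p _ => ?_
        rw [Finset.sum_mul]
        refine Finset.sum_congr rfl fun j _ => ?_
        rw [hs p j]
        ring
      simp only [this, Finset.mul_sum]
      rw [Finset.sum_congr rfl fun k _ => Finset.sum_comm, Finset.sum_comm]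
    rw [f3, f4]
  rw [Theta, Matrix.add_mulVec, dotProduct_add, Matrix.smul_mulVec, dotProduct_smul, e1, e2,
    smul_eq_mul]
  unfold thetaForm entries pd coordDir
  ring

lemma fderiv_apply_eq_sum {m : ℕ} (f : Eu m → ℝ) (y v : Eu m) :
    fderiv ℝ f y v = ∑ k, v k * fderiv ℝ f y (coordDir m k) := by
  have hv : v = ∑ k, v k • coordDir m k := by
    ext i
    simp [coordDir, Finset.sum_apply, Pi.single_apply]
  conv_lhs => rw [hv]
  simp

lemma sum_comm₄ {m : ℕ} (T : Fin m → Fin m → Fin m → Fin m → ℝ) :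
    ∑ i, ∑ j, ∑ p, ∑ q, T i j p q = ∑ p, ∑ q, ∑ i, ∑ j, T i j p q := by
  have h1 : ∀ i, ∑ j, ∑ p, ∑ q, T i j p q = ∑ p, ∑ q, ∑ j, T i j p q := by
    intro i
    rw [Finset.sum_comm]
    exact Finset.sum_congr rfl fun p _ => Finset.sum_comm
  rw [Finset.sum_congr rfl fun i _ => h1 i, Finset.sum_comm]
  exact Finset.sum_congr rfl fun p _ => Finset.sum_comm

/-! ### Change of variables for `Γ` and `Θ`. -/

section Naturality

variable {m : ℕ} {g g' : Fin m → Fin m → Eu m → ℝ} {F : Eu m → Eu m} {x : Eu m}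

lemma fderiv_comp_eq_sum {f : Eu m → ℝ} (hF : DifferentiableAt ℝ F x)
    (hf : DifferentiableAt ℝ f (F x)) (v : Eu m) :
    fderiv ℝ (f ∘ F) x v = ∑ k, fderiv ℝ (fun z => F z k) x v * fderiv ℝ f (F x) (coordDir m k) := by
  rw [fderiv_comp x hf hF, ContinuousLinearMap.comp_apply, fderiv_apply_eq_sum]
  refine Finset.sum_congr rfl fun k _ => ?_
  have : HasFDerivAt (fun z => F z k) ((EuclideanSpace.proj k).comp (fderiv ℝ F x)) x :=
    (EuclideanSpace.proj (𝕜 := ℝ) k).hasFDerivAt.comp x hF.hasFDerivAt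
  rw [this.fderiv]
  rfl

/-- Chain rule: the hypothesis on `g'` says that it is the push-forward of `g` by `F`, that is,
`g'_{ij} = Γ(F_i, F_j)`. -/
lemma gam_comp {f k : Eu m → ℝ} (hF : DifferentiableAt ℝ F x) (hf : DifferentiableAt ℝ f (F x))
    (hk : DifferentiableAt ℝ k (F x))
    (hg : ∀ i j, g' i j (F x) = gam (coordDir m) g (fun z => F z i) (fun z => F z j) x) :
    gam (coordDir m) g (f ∘ F) (k ∘ F) x = gam (coordDir m) g' f k (F x) := by
  unfold gam at hg ⊢
  simp only [fderiv_comp_eq_sum hF hf, fderiv_comp_eq_sum hF hk, hg]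
  have e1 : ∀ i j, (∑ p, ∑ q, g p q x * fderiv ℝ (fun z => F z i) x (coordDir m p)
      * fderiv ℝ (fun z => F z j) x (coordDir m q)) * fderiv ℝ f (F x) (coordDir m i)
        * fderiv ℝ k (F x) (coordDir m j)
      = ∑ p, ∑ q, g p q x * (fderiv ℝ (fun z => F z i) x (coordDir m p)
        * fderiv ℝ f (F x) (coordDir m i)) * (fderiv ℝ (fun z => F z j) x (coordDir m q)
        * fderiv ℝ k (F x) (coordDir m j)) := by
    intro i j
    simp only [Finset.sum_mul]
    refine Finset.sum_congr rfl fun p _ => Finset.sum_congr rfl fun q _ => ?_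
    ring
  rw [Finset.sum_congr rfl fun i _ => Finset.sum_congr rfl fun j _ => e1 i j, sum_comm₄]
  refine Finset.sum_congr rfl fun p _ => Finset.sum_congr rfl fun q _ => ?_
  simp only [Finset.sum_mul, Finset.mul_sum]
  rw [Finset.sum_comm]

/-- Both sides are iterated `Γ`-brackets by `thetaForm_fderiv`, and `Γ` is natural, so no
transformation law for second derivatives or for `Λ` has to be computed. This is the invariance of
pseudo-convexity under diffeomorphisms. -/
theorem thetaForm_comp {f h : Eu m → ℝ} (hF : ContDiffAt ℝ 2 F x) (hf : ContDiffAt ℝ 2 f (F x))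
    (hh : ContDiffAt ℝ 2 h (F x))
    (hg : ∀ᶠ z in 𝓝 x, ∀ i j,
      g' i j (F z) = gam (coordDir m) g (fun z => F z i) (fun z => F z j) z)
    (hgd : ∀ i j, DifferentiableAt ℝ (g i j) x) (hgd' : ∀ i j, DifferentiableAt ℝ (g' i j) (F x))
    (hs : ∀ i j, g i j x = g j i x) (hs' : ∀ i j, g' i j (F x) = g' j i (F x)) :
    thetaForm (coordDir m) g (h ∘ F) x (fun i => fderiv ℝ (f ∘ F) x (coordDir m i))
      = thetaForm (coordDir m) g' h (F x) (fun i => fderiv ℝ f (F x) (coordDir m i)) := by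
  have hF1 : DifferentiableAt ℝ F x := hF.differentiableAt (by norm_num)
  -- Naturality of the inner bracket is needed on a neighbourhood, because the outer bracket
  -- differentiates it.
  have hev : ∀ {f k : Eu m → ℝ}, ContDiffAt ℝ 2 f (F x) → ContDiffAt ℝ 2 k (F x) →
      gam (coordDir m) g (f ∘ F) (k ∘ F) =ᶠ[𝓝 x] gam (coordDir m) g' f k ∘ F := by
    intro f k hf hk
    have e1 := hF.continuousAt.eventually (hf.eventually (by simp))
    have e2 := hF.continuousAt.eventually (hk.eventually (by simp))
    filter_upwards [hg, hF.eventually (by simp), e1, e2] with z h1 h2 h3 h4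
    exact gam_comp (h2.differentiableAt (by norm_num)) (h3.differentiableAt (by norm_num))
      (h4.differentiableAt (by norm_num)) h1
  have key : ∀ {f k l : Eu m → ℝ}, ContDiffAt ℝ 2 f (F x) → ContDiffAt ℝ 2 k (F x) →
      ContDiffAt ℝ 2 l (F x) →
      gam (coordDir m) g (l ∘ F) (gam (coordDir m) g (f ∘ F) (k ∘ F)) x
        = gam (coordDir m) g' l (gam (coordDir m) g' f k) (F x) := by
    intro f k l hf hk hl
    rw [gam_congr_right (hev hf hk)]
    exact gam_comp hF1 (hl.differentiableAt (by norm_num)) (differentiableAt_gam hgd' hf hk)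
      hg.self_of_nhds
  rw [thetaForm_fderiv hgd hs (hf.comp x hF) (hh.comp x hF), thetaForm_fderiv hgd' hs' hf hh,
    key hf hh hf, key hf hf hh]

end Naturality

/-! ### The straightening diffeomorphism -/

/-- The coordinates of `x` in the frame centred at `x̃` and rotated by `O`. -/
def toFrame {m : ℕ} (O : Matrix (Fin m) (Fin m) ℝ) (xt x : Eu m) : Eu m :=
  WithLp.toLp 2 (O *ᵥ (x - xt).ofLp)

/-- The diffeomorphism which maps `H` to a paraboloid. -/
def flatten {d : ℕ} (O : Matrix (Fin (d + 1)) (Fin (d + 1)) ℝ) (xt : Eu (d + 1)) (ϑ : Eu d → ℝ)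
    (x : Eu (d + 1)) : Eu (d + 1) := straighten ϑ (toFrame O xt x)

/-- The inverse of `flatten`. -/
def unflatten {d : ℕ} (O : Matrix (Fin (d + 1)) (Fin (d + 1)) ℝ) (xt : Eu (d + 1)) (ϑ : Eu d → ℝ)
    (y : Eu (d + 1)) : Eu (d + 1) := fromFrame O xt (straightenInv ϑ y)

section Frame

variable {m : ℕ} {O : Matrix (Fin m) (Fin m) ℝ} {xt : Eu m}

lemma orthogonal_mul_transpose (hO : O ∈ Matrix.orthogonalGroup (Fin m) ℝ) : O * Oᵀ = 1 :=
  (Matrix.mem_orthogonalGroup_iff (Fin m) ℝ).1 hO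

lemma transpose_mul_orthogonal (hO : O ∈ Matrix.orthogonalGroup (Fin m) ℝ) : Oᵀ * O = 1 :=
  mul_eq_one_comm.1 (orthogonal_mul_transpose hO)

lemma toFrame_fromFrame (hO : O ∈ Matrix.orthogonalGroup (Fin m) ℝ) (x : Eu m) :
    toFrame O xt (fromFrame O xt x) = x := by
  simp [toFrame, fromFrame, Matrix.mulVec_mulVec, orthogonal_mul_transpose hO]

lemma fromFrame_toFrame (hO : O ∈ Matrix.orthogonalGroup (Fin m) ℝ) (x : Eu m) :
    fromFrame O xt (toFrame O xt x) = x := by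
  have h : (WithLp.toLp 2 (Oᵀ *ᵥ (O *ᵥ (x - xt).ofLp)) : Eu m) = x - xt := by
    rw [Matrix.mulVec_mulVec, transpose_mul_orthogonal hO, Matrix.one_mulVec]
  rw [fromFrame, toFrame]
  simp only [h]
  abel

lemma toFrame_apply (x : Eu m) (k : Fin m) : toFrame O xt x k = ∑ j, O k j * (x j - xt j) := rfl

lemma fromFrame_apply (x : Eu m) (k : Fin m) :
    fromFrame O xt x k = xt k + ∑ j, O j k * x j := rfl

lemma contDiff_coord {n : WithTop ℕ∞} (j : Fin m) : ContDiff ℝ n (fun x : Eu m => x j) :=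
  (EuclideanSpace.proj (𝕜 := ℝ) j).contDiff

lemma contDiff_toFrame {n : WithTop ℕ∞} : ContDiff ℝ n (toFrame O xt) := by
  refine contDiff_euclidean.2 fun k => ?_
  simp only [toFrame_apply]
  exact ContDiff.sum fun j _ => contDiff_const.mul ((contDiff_coord j).sub contDiff_const)

lemma contDiff_fromFrame {n : WithTop ℕ∞} : ContDiff ℝ n (fromFrame O xt) := by
  refine contDiff_euclidean.2 fun k => ?_
  simp only [fromFrame_apply]
  exact contDiff_const.add (ContDiff.sum fun j _ => contDiff_const.mul (contDiff_coord j))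

lemma fderiv_toFrame_apply (x : Eu m) (k p : Fin m) :
    fderiv ℝ (fun z => toFrame O xt z k) x (coordDir m p) = O k p := by
  have h : HasFDerivAt (fun z => toFrame O xt z k)
      (∑ j, O k j • (EuclideanSpace.proj j : Eu m →L[ℝ] ℝ)) x := by
    simp only [toFrame_apply]
    refine HasFDerivAt.fun_sum fun j _ => ?_
    exact ((EuclideanSpace.proj (𝕜 := ℝ) j).hasFDerivAt.sub_const _).const_mul _
  rw [h.fderiv]
  simp [coordDir]

lemma toFrame_self : toFrame O xt xt = 0 := by
  ext k
  simp [toFrame_apply]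

lemma fromFrame_zero : fromFrame O xt 0 = xt := by
  ext k
  simp [fromFrame_apply]

end Frame

section Flatten

variable {d : ℕ} {O : Matrix (Fin (d + 1)) (Fin (d + 1)) ℝ} {xt : Eu (d + 1)} {ϑ : Eu d → ℝ}

lemma contDiff_initPart {n : WithTop ℕ∞} : ContDiff ℝ n (initPart : Eu (d + 1) → Eu d) :=
  contDiff_euclidean.2 fun i => contDiff_coord i.castSucc

lemma contDiff_single_last {n : WithTop ℕ∞} :
    ContDiff ℝ n (fun c : ℝ => (EuclideanSpace.single (Fin.last d) c : Eu (d + 1))) := by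
  refine contDiff_euclidean.2 fun i => ?_
  by_cases hi : i = Fin.last d
  · subst hi
    have h : (fun c : ℝ => (EuclideanSpace.single (Fin.last d) c : Eu (d + 1)) (Fin.last d)) = id := by
      funext c
      simp
    rw [h]
    exact contDiff_id
  · simpa [hi] using contDiff_const

lemma contDiffAt_straighten {n : WithTop ℕ∞} {x : Eu (d + 1)}
    (h : ContDiffAt ℝ n ϑ (initPart x)) : ContDiffAt ℝ n (straighten ϑ) x := by
  unfold straighten
  refine contDiffAt_id.add (contDiff_single_last.contDiffAt.comp x ?_)
  exact (h.comp x contDiff_initPart.contDiffAt).neg.add (contDiff_initPart.norm_sq ℝ).contDiffAt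

lemma contDiffAt_straightenInv {n : WithTop ℕ∞} {x : Eu (d + 1)}
    (h : ContDiffAt ℝ n ϑ (initPart x)) : ContDiffAt ℝ n (straightenInv ϑ) x := by
  unfold straightenInv
  refine contDiffAt_id.add (contDiff_single_last.contDiffAt.comp x ?_)
  exact (h.comp x contDiff_initPart.contDiffAt).sub (contDiff_initPart.norm_sq ℝ).contDiffAt

lemma contDiff_psiTilde {n : WithTop ℕ∞} : ContDiff ℝ n (psiTilde : Eu (d + 1) → ℝ) :=
  (((contDiff_coord _).sub contDiff_const).pow 2).add (contDiff_initPart.norm_sq ℝ)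

lemma unflatten_flatten (hO : O ∈ Matrix.orthogonalGroup (Fin (d + 1)) ℝ) (x : Eu (d + 1)) :
    unflatten O xt ϑ (flatten O xt ϑ x) = x := by
  rw [unflatten, flatten, straightenInv_straighten, fromFrame_toFrame hO]

lemma flatten_unflatten (hO : O ∈ Matrix.orthogonalGroup (Fin (d + 1)) ℝ) (y : Eu (d + 1)) :
    flatten O xt ϑ (unflatten O xt ϑ y) = y := by
  rw [unflatten, flatten, toFrame_fromFrame hO, straighten_straightenInv]

/-- `Ã = (JO) A (JO)ᵗ` and, by the chain rule, `JO` is the Jacobian of the composite map. This puts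
`Ã` in the form required by `thetaForm_comp`. -/
lemma tildeMatrix_flatten (hO : O ∈ Matrix.orthogonalGroup (Fin (d + 1)) ℝ) {x : Eu (d + 1)}
    (A : Eu (d + 1) → Matrix (Fin (d + 1)) (Fin (d + 1)) ℝ)
    (hϑ : ContDiffAt ℝ 1 ϑ (initPart (toFrame O xt x))) (i j : Fin (d + 1)) :
    entries (tildeMatrix ϑ (hatMatrix O xt A)) i j (flatten O xt ϑ x)
      = gam (coordDir (d + 1)) (entries A) (fun z => flatten O xt ϑ z i)
          (fun z => flatten O xt ϑ z j) x := by
  set J := jacobian (straighten ϑ) (toFrame O xt x) with hJ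
  have h1 : tildeMatrix ϑ (hatMatrix O xt A) (flatten O xt ϑ x) = (J * O) * A x * (J * O)ᵀ := by
    rw [tildeMatrix, flatten, straightenInv_straighten, hatMatrix, fromFrame_toFrame hO, ← hJ,
      Matrix.transpose_mul]
    simp only [Matrix.mul_assoc]
  have hS : ∀ i, DifferentiableAt ℝ (fun y => straighten ϑ y i) (toFrame O xt x) := fun i =>
    ((contDiffAt_euclidean.1 (contDiffAt_straighten hϑ)) i).differentiableAt (by norm_num)
  have h2 : ∀ i p, fderiv ℝ (fun z => flatten O xt ϑ z i) x (coordDir (d + 1) p) = (J * O) i p := by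
    intro i p
    have := fderiv_comp_eq_sum (F := toFrame O xt) (x := x)
      (contDiff_toFrame.contDiffAt.differentiableAt (n := 1) (by norm_num)) (hS i)
      (coordDir (d + 1) p)
    simp only [fderiv_toFrame_apply] at this
    refine this.trans ?_
    rw [Matrix.mul_apply]
    refine Finset.sum_congr rfl fun k _ => ?_
    rw [mul_comm]
    rfl
  unfold gam entries
  simp only [h2, h1, Matrix.mul_apply (M := J * O * A x), Matrix.mul_apply (M := J * O) (N := A x),
    Matrix.transpose_apply, Finset.sum_mul]
  rw [Finset.sum_comm]
  refine Finset.sum_congr rfl fun p _ => Finset.sum_congr rfl fun q _ => ?_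
  ring

end Flatten

/-! ### The weight function attached to a pseudo-convex hypersurface. -/

section Weight

variable {d : ℕ} {O : Matrix (Fin (d + 1)) (Fin (d + 1)) ℝ} {xt : Eu (d + 1)} {ϑ : Eu d → ℝ}
  {θ : Eu (d + 1) → ℝ}

lemma initPart_zero : initPart (0 : Eu (d + 1)) = 0 := by
  ext i
  simp [initPart]

lemma hasDerivAt_add_single_last {f : Eu (d + 1) → ℝ} {x : Eu (d + 1)} {t : ℝ}
    (hf : DifferentiableAt ℝ f (x + EuclideanSpace.single (Fin.last d) t)) :
    HasDerivAt (fun s => f (x + EuclideanSpace.single (Fin.last d) s))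
      (pd (Fin.last d) f (x + EuclideanSpace.single (Fin.last d) t)) t := by
  have h1 : HasDerivAt (fun s : ℝ => x + EuclideanSpace.single (Fin.last d) s)
      (EuclideanSpace.single (Fin.last d) (1 : ℝ)) t := by
    have e : (fun s : ℝ => x + EuclideanSpace.single (Fin.last d) s)
        = fun s => x + s • EuclideanSpace.single (Fin.last d) (1 : ℝ) := by
      funext s
      congr 1
      ext i
      by_cases hi : i = Fin.last d
      · subst hi; simp
      · simp [hi]
    rw [e]
    simpa using ((hasDerivAt_id t).smul_const
      (EuclideanSpace.single (Fin.last d) (1 : ℝ))).const_add x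
  exact hf.hasFDerivAt.comp_hasDerivAt t h1

/-- Near the origin, `{θ̂ ≥ 0}` lies above the graph of `ϑ`. -/
lemma eventually_graph_le {f : Eu (d + 1) → ℝ} {W : Set (Eu (d + 1))} (hf : ContDiffAt ℝ 1 f 0)
    (hpos : 0 < pd (Fin.last d) f 0) (hϑ : ContinuousAt ϑ 0) (hϑ0 : ϑ 0 = 0) (hW : W ∈ 𝓝 0)
    (hgraph : ∀ x ∈ W, f x = 0 ↔ x (Fin.last d) = ϑ (initPart x)) :
    ∀ᶠ x in 𝓝 (0 : Eu (d + 1)), 0 ≤ f x → ϑ (initPart x) ≤ x (Fin.last d) := by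
  have hpdc : ContinuousAt (pd (Fin.last d) f) 0 := by
    have h1 : ContDiffAt ℝ 0 (fderiv ℝ f) 0 := hf.fderiv_right (by norm_num)
    exact h1.continuousAt.clm_apply continuousAt_const
  have hev : ∀ᶠ x in 𝓝 (0 : Eu (d + 1)), DifferentiableAt ℝ f x ∧ 0 < pd (Fin.last d) f x ∧ x ∈ W := by
    filter_upwards [hf.eventually (by simp), hpdc.eventually (lt_mem_nhds hpos), hW] with x h1 h2 h3
    exact ⟨h1.differentiableAt (by norm_num), h2, h3⟩
  obtain ⟨ρ, hρ, hball⟩ := Metric.eventually_nhds_iff_ball.1 hev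
  -- The vertical projection of `x` onto the graph; by continuity it stays in the good ball when `x`
  -- is close to the origin.
  have hproj : ContinuousAt (fun x : Eu (d + 1) =>
      x + EuclideanSpace.single (Fin.last d) (ϑ (initPart x) - x (Fin.last d))) 0 := by
    have c1 : ContinuousAt (fun x : Eu (d + 1) => ϑ (initPart x)) 0 :=
      ContinuousAt.comp (g := ϑ) (by rwa [initPart_zero])
        (contDiff_initPart (n := 0)).continuous.continuousAt
    exact continuousAt_id.add ((contDiff_single_last (n := 0)).continuous.continuousAt.comp
      (c1.sub (contDiff_coord (n := 0) _).continuous.continuousAt))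
  have hproj0 : (0 : Eu (d + 1)) + EuclideanSpace.single (Fin.last d)
      (ϑ (initPart (0 : Eu (d + 1))) - (0 : Eu (d + 1)) (Fin.last d)) = 0 := by
    simp [initPart_zero, hϑ0]
  have hpm := hproj.eventually (show ∀ᶠ y in 𝓝 _, y ∈ Metric.ball (0 : Eu (d + 1)) ρ by
    simp only [hproj0]; exact Metric.ball_mem_nhds 0 hρ)
  filter_upwards [hpm, Metric.ball_mem_nhds (0 : Eu (d + 1)) hρ] with x hx1 hx2 hfx
  by_contra hlt
  push Not at hlt
  set a := ϑ (initPart x) - x (Fin.last d) with ha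
  have ha0 : 0 < a := sub_pos.2 hlt
  have hseg : ∀ t ∈ Icc 0 a, x + EuclideanSpace.single (Fin.last d) t ∈ Metric.ball 0 ρ := by
    intro t ht
    have hc := (convex_ball (0 : Eu (d + 1)) ρ) hx2 hx1 (a := 1 - t / a) (b := t / a)
      (by rw [sub_nonneg]; exact (div_le_one ha0).2 ht.2) (div_nonneg ht.1 ha0.le) (by ring)
    convert hc using 1
    ext i
    by_cases hi : i = Fin.last d
    · subst hi
      simp
      field_simp
      ring
    · simp [hi]
      ring
  -- Mean value theorem on the vertical segment from `x` up to the graph: `f` increases strictly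
  -- there and vanishes at the top, so `f x < 0`, against the assumption.
  obtain ⟨c, hc, hcs⟩ := exists_hasDerivAt_eq_slope
    (fun s => f (x + EuclideanSpace.single (Fin.last d) s))
    (fun s => pd (Fin.last d) f (x + EuclideanSpace.single (Fin.last d) s)) ha0
    (fun t ht => (hasDerivAt_add_single_last (hball _ (hseg t ht)).1).continuousAt.continuousWithinAt)
    (fun t ht => hasDerivAt_add_single_last (hball _ (hseg t (Ioo_subset_Icc_self ht))).1)
  have h1 := (hball _ (hseg c (Ioo_subset_Icc_self hc))).2.1
  have h2 : f (x + EuclideanSpace.single (Fin.last d) a) = 0 := by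
    refine (hgraph _ (hball _ (hseg a (right_mem_Icc.2 ha0.le))).2.2).2 ?_
    rw [initPart_add_single_last]
    simp [ha]
  have h3 : x + EuclideanSpace.single (Fin.last d) (0 : ℝ) = x := by simp
  rw [hcs, h2, h3, sub_zero, div_pos_iff_of_pos_right ha0] at h1
  linarith

/-- A pseudo-convex hypersurface carries a weight function which is strictly pseudo-convex at `x̃`
and which peaks at `x̃` on the side `θ ≥ θ(x̃)`. -/
theorem exists_weight {A : Eu (d + 1) → Matrix (Fin (d + 1)) (Fin (d + 1)) ℝ}
    {ω : Set (Eu (d + 1))} (hω : IsOpen ω) (hxt : xt ∈ ω)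
    (hAs : ∀ x ∈ ω, (A x).IsSymm) (hA : ∀ k l, ContDiffOn ℝ 2 (entries A k l) ω)
    (hθ : ContDiffOn ℝ 3 θ ω) (hH : IsPseudoConvexHypersurface A ω θ xt) :
    ∃ h : Eu (d + 1) → ℝ, ContDiffAt ℝ 3 h xt ∧ h xt = 1 ∧ fderiv ℝ h xt ≠ 0 ∧
      (∀ ξ : Fin (d + 1) → ℝ, ξ ≠ 0 → 0 < thetaForm (coordDir (d + 1)) (entries A) h xt ξ) ∧
      ∀ᶠ x in 𝓝 xt, θ xt ≤ θ x → x ≠ xt → h x < 1 := by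
  obtain ⟨O, hO, -, hpos, ϑ, V, W, hV, hϑ, hW, h0W, hWω, hgraph, κ, hκ, hpc⟩ := hH
  have h0V : (0 : Eu d) ∈ V := by
    have := (hWω 0 (subset_closure h0W)).2
    rwa [initPart_zero] at this
  have hϑ3 : ContDiffAt ℝ 3 ϑ 0 := hϑ.1.contDiffAt (hV.mem_nhds h0V)
  have hϑ0 : ϑ 0 = 0 := by
    have := (hgraph 0 h0W).1 (by simp [hatFun, fromFrame_zero])
    rw [initPart_zero] at this
    simpa using this.symm
  have hflat0 : flatten O xt ϑ xt = 0 := by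
    rw [flatten, toFrame_self, straighten, initPart_zero, hϑ0]
    simp
  have hunflat0 : unflatten O xt ϑ 0 = xt := by
    rw [← hflat0, unflatten_flatten hO]
  have hinit : initPart (toFrame O xt xt) = 0 := by rw [toFrame_self, initPart_zero]
  have hΦ : ContDiffAt ℝ 3 (flatten O xt ϑ) xt :=
    ContDiffAt.comp xt (contDiffAt_straighten (by rwa [hinit])) contDiff_toFrame.contDiffAt
  have hΨ : ContDiffAt ℝ 3 (unflatten O xt ϑ) 0 :=
    contDiff_fromFrame.contDiffAt.comp 0 (contDiffAt_straightenInv (by rwa [initPart_zero]))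
  have hΦ2 : ContDiffAt ℝ 2 (flatten O xt ϑ) xt := hΦ.of_le (by norm_num)
  have hΨ2 : ContDiffAt ℝ 2 (unflatten O xt ϑ) 0 := hΨ.of_le (by norm_num)
  have hωn : ω ∈ 𝓝 xt := hω.mem_nhds hxt
  have h0W' : (0 : Eu (d + 1)) ∈ closure (straighten ϑ '' W) := by
    refine subset_closure ⟨0, h0W, ?_⟩
    rw [straighten, initPart_zero, hϑ0]
    simp
  obtain ⟨-, ⟨k₀, hk₀⟩, hform⟩ := hpc 0 h0W'
  have hcomp : (psiTilde ∘ flatten O xt ϑ) ∘ unflatten O xt ϑ = psiTilde := by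
    funext y
    simp only [Function.comp, flatten_unflatten hO]
  have hh : ContDiffAt ℝ 3 (psiTilde ∘ flatten O xt ϑ) xt := contDiff_psiTilde.contDiffAt.comp xt hΦ
  have htilde : ∀ᶠ z in 𝓝 xt, ∀ i j, entries (tildeMatrix ϑ (hatMatrix O xt A)) i j (flatten O xt ϑ z)
      = gam (coordDir (d + 1)) (entries A) (fun z => flatten O xt ϑ z i)
          (fun z => flatten O xt ϑ z j) z := by
    have hc : Continuous (fun z => initPart (toFrame O xt z)) :=
      (contDiff_initPart (n := 0)).continuous.comp (contDiff_toFrame (n := 0)).continuous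
    have := (hc.continuousAt (x := xt)).eventually (show ∀ᶠ y in 𝓝 _, y ∈ V by
      simp only [hinit]; exact hV.mem_nhds h0V)
    filter_upwards [this] with z hz i j
    exact tildeMatrix_flatten hO A ((hϑ.1.contDiffAt (hV.mem_nhds hz)).of_le (by norm_num)) i j
  have hAd : ∀ i j, DifferentiableAt ℝ (entries A i j) xt := fun i j =>
    ((hA i j).contDiffAt hωn).differentiableAt (by norm_num)
  have hsym : ∀ x ∈ ω, ∀ i j, entries A i j x = entries A j i x := fun x hx i j =>
    ((hAs x hx).apply i j).symm
  have hcoord : ∀ i, ContDiffAt ℝ 2 (fun z => flatten O xt ϑ z i) xt := fun i =>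
    contDiffAt_euclidean.1 hΦ2 i
  have hTd : ∀ i j, DifferentiableAt ℝ (entries (tildeMatrix ϑ (hatMatrix O xt A)) i j)
      (flatten O xt ϑ xt) := by
    intro i j
    -- Differentiability of `Ã` at the origin is read off from `Ã = Γ(Φ_i, Φ_j) ∘ Φ⁻¹`, valid near
    -- the origin.
    have e1 : entries (tildeMatrix ϑ (hatMatrix O xt A)) i j =ᶠ[𝓝 0]
        (gam (coordDir (d + 1)) (entries A) (fun z => flatten O xt ϑ z i)
          (fun z => flatten O xt ϑ z j)) ∘ unflatten O xt ϑ := by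
      have := hΨ.continuousAt.eventually (by rw [hunflat0]; exact htilde)
      filter_upwards [this] with y hy
      rw [Function.comp, ← hy i j, flatten_unflatten hO]
    rw [hflat0]
    refine e1.differentiableAt_iff.2 (DifferentiableAt.comp 0 ?_ (hΨ.differentiableAt (by norm_num)))
    rw [hunflat0]
    exact differentiableAt_gam hAd (hcoord i) (hcoord j)
  have hTs : ∀ i j, entries (tildeMatrix ϑ (hatMatrix O xt A)) i j (flatten O xt ϑ xt)
      = entries (tildeMatrix ϑ (hatMatrix O xt A)) j i (flatten O xt ϑ xt) := by
    intro i j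
    rw [htilde.self_of_nhds i j, htilde.self_of_nhds j i]
    exact gam_comm (hsym xt hxt)
  refine ⟨psiTilde ∘ flatten O xt ϑ, hh, ?_, ?_, ?_, ?_⟩
  · simp [hflat0, psiTilde, initPart_zero]
  · intro hzero
    apply hk₀
    rw [pd, ← hcomp, fderiv_comp 0 (by rw [hunflat0]; exact hh.differentiableAt (by norm_num))
      (hΨ.differentiableAt (by norm_num)), hunflat0, hzero]
    simp
  · intro ξ hξ
    -- Every covector `ξ` is the gradient of a linear function, so the invariance statement, which
    -- is about gradients, covers all `ξ`.
    set F : Eu (d + 1) → ℝ := fun x => ∑ k, ξ k * x k with hF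
    have hFc : ContDiff ℝ 2 F := ContDiff.sum fun k _ => contDiff_const.mul (contDiff_coord k)
    have hFd : ∀ x i, fderiv ℝ F x (coordDir (d + 1) i) = ξ i := by
      intro x i
      have : HasFDerivAt F (∑ k, ξ k • (EuclideanSpace.proj k : Eu (d + 1) →L[ℝ] ℝ)) x :=
        HasFDerivAt.fun_sum fun k _ => (EuclideanSpace.proj (𝕜 := ℝ) k).hasFDerivAt.const_mul _
      rw [this.fderiv]
      simp [coordDir]
    have hf : ContDiffAt ℝ 2 (F ∘ unflatten O xt ϑ) 0 := hFc.contDiffAt.comp 0 hΨ2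
    have hfF : (F ∘ unflatten O xt ϑ) ∘ flatten O xt ϑ = F := by
      funext x
      simp only [Function.comp, unflatten_flatten hO]
    have inv := thetaForm_comp (f := F ∘ unflatten O xt ϑ) (h := psiTilde) hΦ2
      (by rwa [hflat0]) contDiff_psiTilde.contDiffAt htilde hAd hTd (hsym xt hxt) hTs
    rw [hfF] at inv
    simp only [hFd] at inv
    rw [inv]
    set η : Fin (d + 1) → ℝ := fun i =>
      fderiv ℝ (F ∘ unflatten O xt ϑ) (flatten O xt ϑ xt) (coordDir (d + 1) i) with hη
    have hTsym : (tildeMatrix ϑ (hatMatrix O xt A) 0).IsSymm := by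
      refine Matrix.IsSymm.ext fun i j => ?_
      have := hTs j i
      rwa [hflat0] at this
    rw [hflat0, ← dotProduct_Theta_mulVec hTsym]
    refine lt_of_lt_of_le (mul_pos hκ ?_) (hform η)
    -- The transported covector is nonzero because the chain rule for `Φ` recovers `ξ` from it.
    have hη0 : η ≠ 0 := by
      intro h0
      apply hξ
      funext i
      have : fderiv ℝ (F ∘ unflatten O xt ϑ) (flatten O xt ϑ xt) = 0 := by
        ext v
        rw [fderiv_apply_eq_sum]
        refine Finset.sum_eq_zero fun k _ => ?_
        rw [show fderiv ℝ (F ∘ unflatten O xt ϑ) (flatten O xt ϑ xt) (coordDir (d + 1) k) = η k from rfl,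
          h0]
        simp
      rw [← hFd xt i, ← hfF, fderiv_comp xt (by rw [hflat0]; exact hf.differentiableAt (by norm_num))
        (hΦ.differentiableAt (by norm_num)), this]
      simp
    rw [dotProduct]
    obtain ⟨i, hi⟩ := Function.ne_iff.1 hη0
    exact Finset.sum_pos' (fun j _ => mul_self_nonneg _) ⟨i, Finset.mem_univ _, mul_self_pos.2 hi⟩
  · have hθ1 : ContDiffAt ℝ 1 (hatFun O xt θ) 0 := by
      unfold hatFun
      refine ContDiffAt.sub (ContDiffAt.comp 0 ?_ contDiff_fromFrame.contDiffAt) contDiffAt_const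
      rw [fromFrame_zero]
      exact (hθ.contDiffAt hωn).of_le (by norm_num)
    have side := eventually_graph_le hθ1 hpos hϑ3.continuousAt hϑ0 (hW.mem_nhds h0W) hgraph
    have side' := ((contDiff_toFrame (n := 0) (O := O) (xt := xt)).continuous.continuousAt
      (x := xt)).eventually (by rw [toFrame_self]; exact side)
    have small : ∀ᶠ x in 𝓝 xt, flatten O xt ϑ x (Fin.last d) < 1 := by
      have hc : ContinuousAt (fun x => flatten O xt ϑ x (Fin.last d)) xt := (hcoord _).continuousAt
      refine hc.eventually (gt_mem_nhds ?_)
      simp [hflat0]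
    filter_upwards [side', small] with x hx1 hx2 hx3 hx4
    have hy := hx1 (by rw [hatFun, fromFrame_toFrame hO]; linarith)
    set y := flatten O xt ϑ x with hydef
    have hinit : initPart y = initPart (toFrame O xt x) := initPart_add_single_last _ _
    have hlast : y (Fin.last d) = toFrame O xt x (Fin.last d)
        + (-ϑ (initPart (toFrame O xt x)) + ‖initPart (toFrame O xt x)‖ ^ 2) := by
      simp [hydef, flatten, straighten]
    have hge : ‖initPart y‖ ^ 2 ≤ y (Fin.last d) := by
      rw [hlast, hinit]
      linarith
    -- If `y_n` vanished, `|y'|² ≤ y_n` would force `y = 0`, hence `x = x̃`.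
    have hypos : 0 < y (Fin.last d) := by
      refine lt_of_le_of_ne ((sq_nonneg _).trans hge) fun h0 => hx4 ?_
      have hi0 : initPart y = 0 := by
        rw [← h0] at hge
        have := le_antisymm hge (sq_nonneg _)
        simpa using this
      have hy0 : y = 0 := by
        ext i
        refine Fin.lastCases h0.symm (fun j => ?_) i
        have := congrArg (fun z : Eu d => z j) hi0
        simpa [initPart] using this
      rw [← unflatten_flatten (ϑ := ϑ) (xt := xt) hO x, ← hydef, hy0, hunflat0]
    change psiTilde y < 1
    rw [psiTilde]
    -- `(y_n - 1)² + |y'|² ≤ 1 - y_n(1 - y_n) < 1`, by `|y'|² ≤ y_n` and `0 < y_n < 1`. The term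
    -- `|x'|²` in the straightening map is there for this inequality.
    nlinarith

end Weight

/-! ### Continuous families of quadratic forms -/

/-- The minimum over the compact unit sphere is positive at `x₀` and by continuity loses at most
half near `x₀`; homogeneity extends the bound to all `ξ`. With a one-point space of parameters it is
plain coercivity of a positive form. -/
lemma eventually_coercive {X ι : Type*} [TopologicalSpace X] [Fintype ι] [Nonempty ι]
    {q : X → (ι → ℝ) → ℝ} {x₀ : X} (hq : Continuous (fun p : X × (ι → ℝ) => q p.1 p.2))
    (hhom : ∀ x (t : ℝ) ξ, q x (fun i => t * ξ i) = t ^ 2 * q x ξ)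
    (hpos : ∀ ξ, ξ ≠ 0 → 0 < q x₀ ξ) :
    ∃ c > 0, ∀ᶠ x in 𝓝 x₀, ∀ ξ, c * ∑ i, ξ i ^ 2 ≤ q x ξ := by
  classical
  set S : Set (ι → ℝ) := {ξ | ∑ i, ξ i ^ 2 = 1} with hS
  have hScl : IsClosed S :=
    isClosed_eq (continuous_finsetSum _ fun i _ => (continuous_apply i).pow 2) continuous_const
  have hScp : IsCompact S := by
    refine (isCompact_closedBall (0 : ι → ℝ) 1).of_isClosed_subset hScl fun ξ hξ => ?_
    rw [mem_closedBall_zero_iff, pi_norm_le_iff_of_nonneg zero_le_one]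
    intro i
    have h1 : ξ i ^ 2 ≤ ∑ j, ξ j ^ 2 :=
      Finset.single_le_sum (f := fun j => ξ j ^ 2) (fun j _ => sq_nonneg _) (Finset.mem_univ i)
    rw [hξ] at h1
    rwa [Real.norm_eq_abs, ← sq_le_one_iff_abs_le_one]
  have hSne : S.Nonempty := by
    obtain ⟨i₀⟩ := ‹Nonempty ι›
    exact ⟨Pi.single i₀ 1, by simp [hS, Pi.single_apply]⟩
  have hc0 : Continuous (q x₀) := hq.comp (continuous_const.prodMk continuous_id)
  obtain ⟨ξ₀, hξ₀, hmin⟩ := hScp.exists_isMinOn hSne hc0.continuousOn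
  have hξ₀0 : ξ₀ ≠ 0 := by
    rintro rfl
    simp [hS] at hξ₀
  have hm := hpos ξ₀ hξ₀0
  refine ⟨q x₀ ξ₀ / 2, by positivity, ?_⟩
  have tube : ∀ᶠ x in 𝓝 x₀, ∀ ξ ∈ S, q x₀ ξ₀ / 2 < q x ξ := by
    refine hScp.eventually_forall_of_forall_eventually fun ξ hξ => ?_
    have h1 : q x₀ ξ₀ / 2 < q x₀ ξ := by
      have : q x₀ ξ₀ ≤ q x₀ ξ := hmin hξ
      linarith
    exact hq.continuousAt.eventually (lt_mem_nhds h1)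
  filter_upwards [tube] with x hx ξ
  by_cases hξ : ξ = 0
  · subst hξ
    have := hhom x 0 0
    simp only [Pi.zero_apply, mul_zero, ne_eq, OfNat.ofNat_ne_zero, not_false_eq_true, zero_pow,
      zero_mul] at this
    change q x 0 = 0 at this
    simp [this]
  · have hN : 0 < ∑ i, ξ i ^ 2 := by
      obtain ⟨i, hi⟩ := Function.ne_iff.1 hξ
      exact Finset.sum_pos' (fun j _ => sq_nonneg _) ⟨i, Finset.mem_univ _, by
        have : ξ i ≠ 0 := hi
        positivity⟩
    set t := Real.sqrt (∑ i, ξ i ^ 2) with ht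
    have ht0 : 0 < t := Real.sqrt_pos.2 hN
    have ht2 : t ^ 2 = ∑ i, ξ i ^ 2 := Real.sq_sqrt hN.le
    have hmem : (fun i => t⁻¹ * ξ i) ∈ S := by
      simp only [hS, mem_ofPred_eq, mul_pow, ← Finset.mul_sum, ← ht2]
      field_simp
    have h2 := hx _ hmem
    rw [hhom] at h2
    rw [← ht2]
    have h3 : t ^ 2 * (t⁻¹ ^ 2 * q x ξ) = q x ξ := by field_simp
    nlinarith [mul_lt_mul_of_pos_left h2 (show 0 < t ^ 2 by positivity)]

lemma thetaForm_smul {E ι : Type*} [NormedAddCommGroup E] [NormedSpace ℝ E] [Fintype ι] {e : ι → E}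
    {g : ι → ι → E → ℝ} {h : E → ℝ} {z : E} (t : ℝ) (ξ : ι → ℝ) :
    thetaForm e g h z (fun i => t * ξ i) = t ^ 2 * thetaForm e g h z ξ := by
  have h1 : ∀ p, ∑ q, g q p z * (t * ξ q) = t * ∑ q, g q p z * ξ q := by
    intro p
    rw [Finset.mul_sum]
    exact Finset.sum_congr rfl fun q _ => by ring
  have h2 : ∀ p, ∑ k, ∑ l, fderiv ℝ (g k l) z (e p) * (t * ξ k) * fderiv ℝ h z (e l)
      = t * ∑ k, ∑ l, fderiv ℝ (g k l) z (e p) * ξ k * fderiv ℝ h z (e l) := by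
    intro p
    simp only [Finset.mul_sum]
    exact Finset.sum_congr rfl fun q _ => Finset.sum_congr rfl fun q _ => by ring
  have h3 : ∀ p, ∑ k, ∑ l, fderiv ℝ (g k l) z (e p) * (t * ξ k) * (t * ξ l)
      = t ^ 2 * ∑ k, ∑ l, fderiv ℝ (g k l) z (e p) * ξ k * ξ l := by
    intro p
    simp only [Finset.mul_sum]
    exact Finset.sum_congr rfl fun q _ => Finset.sum_congr rfl fun q _ => by ring
  unfold thetaForm
  simp only [h1, h2, h3]
  rw [mul_sub, mul_add]
  congr 1
  · congr 1
    · rw [mul_left_comm]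
      congr 1
      simp only [Finset.mul_sum (a := t ^ 2)]
      exact Finset.sum_congr rfl fun q _ => Finset.sum_congr rfl fun q _ => by ring
    · rw [mul_left_comm]
      congr 1
      simp only [Finset.mul_sum (a := t ^ 2)]
      exact Finset.sum_congr rfl fun q _ => by ring
  · rw [Finset.mul_sum]
    exact Finset.sum_congr rfl fun q _ => mul_left_comm _ _ _

lemma continuous_thetaForm {E ι : Type*} [NormedAddCommGroup E] [NormedSpace ℝ E] [Fintype ι]
    {e : ι → E} {g : ι → ι → E → ℝ} {h : E → ℝ} (hg : ∀ i j, ContDiff ℝ 1 (g i j))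
    (hh : ContDiff ℝ 2 h) :
    Continuous (fun p : E × (ι → ℝ) => thetaForm e g h p.1 p.2) := by
  have c1 : ∀ i j, Continuous (fun p : E × (ι → ℝ) => g i j p.1) := fun i j =>
    (hg i j).continuous.comp continuous_fst
  have c2 : ∀ i : ι, Continuous (fun p : E × (ι → ℝ) => p.2 i) := fun i =>
    (continuous_apply i).comp continuous_snd
  have c3 : ∀ i j k, Continuous (fun p : E × (ι → ℝ) => fderiv ℝ (g i j) p.1 (e k)) := fun i j k =>
    (contDiff_fderiv_apply_const (m := 0) (hg i j) (by norm_num) (e k)).continuous.comp continuous_fst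
  have c4 : ∀ k, Continuous (fun p : E × (ι → ℝ) => fderiv ℝ h p.1 (e k)) := fun k =>
    (contDiff_fderiv_apply_const (m := 1) hh (by norm_num) (e k)).continuous.comp continuous_fst
  have c5 : ∀ k l, Continuous (fun p : E × (ι → ℝ) => secondDeriv h p.1 (e k) (e l)) := fun k l =>
    (contDiff_fderiv_apply_const (m := 0) (contDiff_fderiv_apply_const (m := 1) hh (by norm_num)
      (e l)) (by norm_num) (e k)).continuous.comp continuous_fst
  unfold thetaForm
  fun_prop

/-! ### The wave operator and its weight -/

section SpaceTimeWeight

variable {d : ℕ}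

/-- The coordinate directions of space-time: `none` is the time direction. -/
def stDir : Option (Fin (d + 1)) → SpaceTime d
  | none => dirT
  | some k => dirX k

/-- The matrix `diag(A, -1)`. -/
def stMat (A : Eu (d + 1) → Matrix (Fin (d + 1)) (Fin (d + 1)) ℝ) :
    Option (Fin (d + 1)) → Option (Fin (d + 1)) → SpaceTime d → ℝ
  | none, none => fun _ => -1
  | none, some _ => fun _ => 0
  | some _, none => fun _ => 0
  | some k, some l => fun z => A z.1 k l

/-- The weight `h(x) - γ t²`. -/
def stWeight (h : Eu (d + 1) → ℝ) (γ : ℝ) (z : SpaceTime d) : ℝ := h z.1 - γ * z.2 ^ 2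

variable {A : Eu (d + 1) → Matrix (Fin (d + 1)) (Fin (d + 1)) ℝ} {h : Eu (d + 1) → ℝ} {γ : ℝ}
  {z : SpaceTime d}

lemma hasFDerivAt_comp_fst {f : Eu (d + 1) → ℝ} (hf : DifferentiableAt ℝ f z.1) :
    HasFDerivAt (fun w : SpaceTime d => f w.1)
      ((fderiv ℝ f z.1).comp (ContinuousLinearMap.fst ℝ _ _)) z :=
  hf.hasFDerivAt.comp z hasFDerivAt_fst

lemma fderiv_comp_fst_dirX {f : Eu (d + 1) → ℝ} (hf : DifferentiableAt ℝ f z.1) (k : Fin (d + 1)) :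
    fderiv ℝ (fun w : SpaceTime d => f w.1) z (dirX k) = fderiv ℝ f z.1 (coordDir (d + 1) k) := by
  rw [(hasFDerivAt_comp_fst hf).fderiv]
  rfl

lemma fderiv_comp_fst_dirT {f : Eu (d + 1) → ℝ} (hf : DifferentiableAt ℝ f z.1) :
    fderiv ℝ (fun w : SpaceTime d => f w.1) z dirT = 0 := by
  rw [(hasFDerivAt_comp_fst hf).fderiv]
  simp [dirT]

lemma hasFDerivAt_stWeight (hh : DifferentiableAt ℝ h z.1) :
    HasFDerivAt (stWeight h γ) ((fderiv ℝ h z.1).comp (ContinuousLinearMap.fst ℝ _ _)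
      - (2 * γ * z.2) • ContinuousLinearMap.snd ℝ _ _) z := by
  have h1 : HasFDerivAt (fun w : SpaceTime d => γ * w.2 ^ 2)
      ((2 * γ * z.2) • ContinuousLinearMap.snd ℝ _ _) z := by
    have := ((hasFDerivAt_snd (𝕜 := ℝ) (p := z)).pow 2).const_mul γ
    refine this.congr_fderiv ?_
    ext v
    · simp
    · simp
      ring
  exact (hasFDerivAt_comp_fst hh).sub h1

lemma fderiv_stWeight_dirX (hh : DifferentiableAt ℝ h z.1) (k : Fin (d + 1)) :
    fderiv ℝ (stWeight h γ) z (dirX k) = fderiv ℝ h z.1 (coordDir (d + 1) k) := by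
  rw [(hasFDerivAt_stWeight hh).fderiv]
  simp [dirX, coordDir]

lemma fderiv_stWeight_dirT (hh : DifferentiableAt ℝ h z.1) :
    fderiv ℝ (stWeight h γ) z dirT = -(2 * γ * z.2) := by
  rw [(hasFDerivAt_stWeight hh).fderiv]
  simp [dirT]

lemma eventually_differentiableAt_fst (hh : ContDiffAt ℝ 2 h z.1) :
    ∀ᶠ w : SpaceTime d in 𝓝 z, DifferentiableAt ℝ h w.1 :=
  continuousAt_fst.eventually ((hh.eventually (by simp)).mono fun _ hx =>
    hx.differentiableAt (by norm_num))

lemma secondDeriv_stWeight_dirX_right (hh : ContDiffAt ℝ 2 h z.1) (v : SpaceTime d)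
    (k : Fin (d + 1)) : secondDeriv (stWeight h γ) z v (dirX k)
      = fderiv ℝ (fun w : SpaceTime d => fderiv ℝ h w.1 (coordDir (d + 1) k)) z v := by
  unfold secondDeriv
  rw [Filter.EventuallyEq.fderiv_eq]
  filter_upwards [eventually_differentiableAt_fst hh] with w hw
  exact fderiv_stWeight_dirX hw k

lemma secondDeriv_stWeight_dirT_right (hh : ContDiffAt ℝ 2 h z.1) (v : SpaceTime d) :
    secondDeriv (stWeight h γ) z v dirT = -(2 * γ * v.2) := by
  unfold secondDeriv
  have h1 : (fun w : SpaceTime d => fderiv ℝ (stWeight h γ) w dirT) =ᶠ[𝓝 z]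
      fun w => -(2 * γ * w.2) := by
    filter_upwards [eventually_differentiableAt_fst hh] with w hw
    exact fderiv_stWeight_dirT hw
  have h2 : HasFDerivAt (fun w : SpaceTime d => -(2 * γ * w.2))
      (-((2 * γ) • ContinuousLinearMap.snd ℝ _ _)) z :=
    ((hasFDerivAt_snd (𝕜 := ℝ) (p := z)).const_mul (2 * γ)).neg
  rw [h1.fderiv_eq, h2.fderiv]
  simp

/-- Nothing mixes space and time: the matrix is block diagonal and independent of `t`, and the
weight is a sum. The time block contributes `2 · ∂_t²φ = -4γ`. -/
lemma thetaForm_stMat (hA : ∀ k l, DifferentiableAt ℝ (entries A k l) z.1)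
    (hh : ContDiffAt ℝ 2 h z.1) (ξ : Option (Fin (d + 1)) → ℝ) :
    thetaForm stDir (stMat A) (stWeight h γ) z ξ
      = thetaForm (coordDir (d + 1)) (entries A) h z.1 (fun k => ξ (some k))
        - 4 * γ * ξ none ^ 2 := by
  have hh1 : DifferentiableAt ℝ h z.1 := hh.differentiableAt (by norm_num)
  have dA : ∀ k l p, fderiv ℝ (fun w : SpaceTime d => A w.1 k l) z (dirX p)
      = fderiv ℝ (entries A k l) z.1 (coordDir (d + 1) p) := fun k l p =>
    fderiv_comp_fst_dirX (hA k l) p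
  have dA' : ∀ k l, fderiv ℝ (fun w : SpaceTime d => A w.1 k l) z dirT = 0 := fun k l =>
    fderiv_comp_fst_dirT (f := entries A k l) (hA k l)
  have d2 : ∀ k p, secondDeriv (stWeight h γ) z (dirX p) (dirX k)
      = secondDeriv h z.1 (coordDir (d + 1) p) (coordDir (d + 1) k) := by
    intro k p
    rw [secondDeriv_stWeight_dirX_right hh,
      fderiv_comp_fst_dirX (f := fun x => fderiv ℝ h x (coordDir (d + 1) k))
        (differentiableAt_fderiv_apply hh _)]
    rfl
  have d3 : ∀ k, secondDeriv (stWeight h γ) z dirT (dirX k) = 0 := by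
    intro k
    rw [secondDeriv_stWeight_dirX_right hh,
      fderiv_comp_fst_dirT (f := fun x => fderiv ℝ h x (coordDir (d + 1) k))
        (differentiableAt_fderiv_apply hh _)]
  unfold thetaForm
  simp only [Fintype.sum_option, stMat, stDir, dA, dA', d2, d3, fderiv_stWeight_dirX hh1,
    secondDeriv_stWeight_dirT_right hh, fderiv_fun_const, Pi.zero_apply, zero_apply]
  simp only [dirX, dirT, entries]
  simp
  ring

lemma gam_stMat_stWeight (hh : DifferentiableAt ℝ h z.1) :
    gam stDir (stMat A) (stWeight h γ) (stWeight h γ) z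
      = gam (coordDir (d + 1)) (entries A) h h z.1 - (2 * γ * z.2) ^ 2 := by
  unfold gam
  simp only [Fintype.sum_option, stMat, stDir, fderiv_stWeight_dirX hh, fderiv_stWeight_dirT hh,
    entries]
  simp
  ring

end SpaceTimeWeight

/-! ### Global coefficients and constants for the Carleman estimate. -/

section Localization

variable {d : ℕ} {A : Eu (d + 1) → Matrix (Fin (d + 1)) (Fin (d + 1)) ℝ} {h : Eu (d + 1) → ℝ}
  {γ : ℝ} {z : SpaceTime d}

/-- Extension by zero: near a point outside `U` the product vanishes identically. -/
lemma contDiff_mul_of_tsupport_subset {E : Type*} [NormedAddCommGroup E] [NormedSpace ℝ E]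
    {n : WithTop ℕ∞} {φ f : E → ℝ} {U : Set E} (hφ : ContDiff ℝ n φ) (hs : tsupport φ ⊆ U)
    (hU : IsOpen U) (hf : ContDiffOn ℝ n f U) : ContDiff ℝ n (fun z => φ z * f z) := by
  refine contDiff_iff_contDiffAt.2 fun z => ?_
  by_cases hz : z ∈ U
  · exact hφ.contDiffAt.mul (hf.contDiffAt (hU.mem_nhds hz))
  · have : (fun z => φ z * f z) =ᶠ[𝓝 z] fun _ => 0 := by
      filter_upwards [(isClosed_tsupport φ).isOpen_compl.mem_nhds fun h => hz (hs h)] with w hw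
      rw [image_eq_zero_of_notMem_tsupport hw, zero_mul]
    exact contDiffAt_const.congr_of_eventuallyEq this

lemma thetaForm_congr {E ι : Type*} [NormedAddCommGroup E] [NormedSpace ℝ E] [Fintype ι] {e : ι → E}
    {g g' : ι → ι → E → ℝ} {h h' : E → ℝ} {z : E} (hg : ∀ i j, g i j =ᶠ[𝓝 z] g' i j)
    (hh : h =ᶠ[𝓝 z] h') (ξ : ι → ℝ) : thetaForm e g h z ξ = thetaForm e g' h' z ξ := by
  have h1 : ∀ v w, secondDeriv h z v w = secondDeriv h' z v w := by
    intro v w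
    unfold secondDeriv
    rw [Filter.EventuallyEq.fderiv_eq]
    filter_upwards [hh.eventuallyEq_nhds] with x hx
    rw [hx.fderiv_eq]
  have h2 : ∀ i j, fderiv ℝ (g i j) z = fderiv ℝ (g' i j) z := fun i j => (hg i j).fderiv_eq
  have h3 : ∀ i j, g i j z = g' i j z := fun i j => (hg i j).eq_of_nhds
  unfold thetaForm
  simp only [h1, hh.fderiv_eq, h2, h3]

lemma gam_congr {E ι : Type*} [NormedAddCommGroup E] [NormedSpace ℝ E] [Fintype ι] {e : ι → E}
    {g g' : ι → ι → E → ℝ} {f f' h h' : E → ℝ} {z : E} (hg : ∀ i j, g i j z = g' i j z)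
    (hf : f =ᶠ[𝓝 z] f') (hh : h =ᶠ[𝓝 z] h') : gam e g f h z = gam e g' f' h' z := by
  unfold gam
  simp only [hg, hf.fderiv_eq, hh.fderiv_eq]

/-- Smooth global extensions of the wave operator and of its weight near `(x̃, 0)`, for which the
Carleman estimate holds. -/
theorem exists_carleman_data {ω : Set (Eu (d + 1))} {xt : Eu (d + 1)} (hω : IsOpen ω) (hxt : xt ∈ ω)
    {ϰ : ℝ} (hϰ : 1 ≤ ϰ) (hAs : ∀ x ∈ ω, (A x).IsSymm)
    (hlow : ∀ ξ : Fin (d + 1) → ℝ, ϰ⁻¹ * (ξ ⬝ᵥ ξ) ≤ ξ ⬝ᵥ (A xt *ᵥ ξ))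
    (hupp : ∀ ξ : Fin (d + 1) → ℝ, ξ ⬝ᵥ (A xt *ᵥ ξ) ≤ ϰ * (ξ ⬝ᵥ ξ))
    (hA : ∀ k l, ContDiffOn ℝ 2 (entries A k l) ω) (hh : ContDiffAt ℝ 3 h xt)
    (hh0 : fderiv ℝ h xt ≠ 0)
    (hΘ : ∀ ξ : Fin (d + 1) → ℝ, ξ ≠ 0 → 0 < thetaForm (coordDir (d + 1)) (entries A) h xt ξ) :
    ∃ γ > 0, ∃ (g : Option (Fin (d + 1)) → Option (Fin (d + 1)) → SpaceTime d → ℝ)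
      (φ : SpaceTime d → ℝ) (μ c R : ℝ), (∀ i j, ContDiff ℝ 2 (g i j)) ∧
      (∀ i j z, g i j z = g j i z) ∧ ContDiff ℝ 3 φ ∧ 0 < c ∧ 0 < R ∧
      (∀ z ∈ Metric.ball ((xt, 0) : SpaceTime d) R, (∀ i j, g i j z = stMat A i j z) ∧
        φ z = stWeight h γ z ∧
        (∀ ξ, c * ∑ i, ξ i ^ 2 ≤ thetaForm stDir g φ z ξ - μ * ∑ i, ∑ j, g i j z * ξ i * ξ j) ∧
        c ≤ thetaForm stDir g φ z (fun i => fderiv ℝ φ z (stDir i)) + μ * gam stDir g φ φ z) := by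
  obtain ⟨U₀, hU₀, hhU₀⟩ := hh.contDiffOn (m := 3) le_rfl (by simp)
  have hUn : U₀ ∩ ω ∈ 𝓝 xt := inter_mem hU₀ (hω.mem_nhds hxt)
  obtain ⟨ρ, hρ, hρU⟩ := Metric.mem_nhds_iff.1 hUn
  set z₀ : SpaceTime d := (xt, 0) with hz₀
  set B : Set (SpaceTime d) := Metric.ball z₀ ρ with hB
  have hBo : IsOpen B := Metric.isOpen_ball
  have hBfst : ∀ z ∈ B, z.1 ∈ U₀ ∩ ω := by
    intro z hz
    refine hρU ?_
    rw [hB, Metric.mem_ball, Prod.dist_eq] at hz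
    exact (le_max_left _ _).trans_lt hz
  let χ : ContDiffBump z₀ := ⟨ρ / 4, ρ / 2, by positivity, by linarith⟩
  have hχ : Metric.closedBall z₀ χ.rOut ⊆ B := Metric.closedBall_subset_ball (by
    change ρ / 2 < ρ
    linarith)
  -- the strict inequalities at the base point
  obtain ⟨κ, hκ, hκΘ⟩ := eventually_coercive (X := Unit)
    (q := fun _ ξ => thetaForm (coordDir (d + 1)) (entries A) h xt ξ) (x₀ := ())
    (by
      unfold thetaForm
      fun_prop) (fun _ t ξ => thetaForm_smul t ξ) hΘ
  have hκΘ' := hκΘ.self_of_nhds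
  -- By `A ≤ ϰ`, subtracting `μA` costs at most `κ/2` of the spatial positivity. In time, `-μg`
  -- contributes `+μ` and the weight `-4γ = -μ/2`, so `μ/2` remains.
  set μ := κ / (2 * ϰ) with hμ
  have hϰ0 : 0 < ϰ := by linarith
  have hμ0 : 0 < μ := by positivity
  set γ := μ / 8 with hγ
  have hγ0 : 0 < γ := by positivity
  -- Away from the ball the truncated matrix may degenerate. The Carleman estimate asks only for
  -- global smoothness and symmetry; positivity is required on the compact set alone.
  set g : Option (Fin (d + 1)) → Option (Fin (d + 1)) → SpaceTime d → ℝ := fun i j =>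
    match i, j with
    | none, none => fun _ => -1
    | none, some _ => fun _ => 0
    | some _, none => fun _ => 0
    | some k, some l => fun z => χ z * A z.1 k l with hg
  set φ : SpaceTime d → ℝ := fun z => χ z * stWeight h γ z with hφ
  have hAB : ∀ k l, ContDiffOn ℝ 2 (fun z : SpaceTime d => A z.1 k l) B := fun k l =>
    (hA k l).comp contDiff_fst.contDiffOn fun z hz => (hBfst z hz).2
  have hhB : ContDiffOn ℝ 3 (stWeight h γ) B :=
    (hhU₀.comp contDiff_fst.contDiffOn fun z hz => (hBfst z hz).1).sub
      (contDiff_const.mul (contDiff_snd.pow 2)).contDiffOn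
  have hgC : ∀ i j, ContDiff ℝ 2 (g i j) := by
    intro i j
    rcases i with _ | k <;> rcases j with _ | l
    · exact contDiff_const
    · exact contDiff_const
    · exact contDiff_const
    · exact contDiff_mul_of_tsupport_subset (χ.contDiff (n := 2)) (χ.tsupport_eq.trans_subset hχ) hBo
        (hAB k l)
  have hφC : ContDiff ℝ 3 φ :=
    contDiff_mul_of_tsupport_subset (χ.contDiff (n := 3)) (χ.tsupport_eq.trans_subset hχ) hBo hhB
  have hgs : ∀ i j z, g i j z = g j i z := by
    intro i j z
    rcases i with _ | k <;> rcases j with _ | l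
    · rfl
    · rfl
    · rfl
    · change χ z * A z.1 k l = χ z * A z.1 l k
      by_cases hz : z ∈ B
      · rw [(hAs z.1 (hBfst z hz).2).apply l k]
      · rw [χ.zero_of_le_dist, zero_mul, zero_mul]
        exact (not_le.1 fun h => hz (hχ h)).le
  have hχ1 : ∀ z ∈ Metric.ball z₀ (ρ / 4), χ z = 1 := fun z hz =>
    χ.one_of_mem_closedBall (Metric.ball_subset_closedBall hz)
  have hgA : ∀ z ∈ Metric.ball z₀ (ρ / 4), ∀ i j, g i j z = stMat A i j z := by
    intro z hz i j
    rcases i with _ | k <;> rcases j with _ | l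
    · rfl
    · rfl
    · rfl
    · change χ z * A z.1 k l = A z.1 k l
      rw [hχ1 z hz, one_mul]
  have hφh : ∀ z ∈ Metric.ball z₀ (ρ / 4), φ z = stWeight h γ z := by
    intro z hz
    rw [hφ]
    simp only
    rw [hχ1 z hz, one_mul]
  have hball : Metric.ball z₀ (ρ / 4) ∈ 𝓝 z₀ := Metric.ball_mem_nhds _ (by positivity)
  have hgev : ∀ i j, g i j =ᶠ[𝓝 z₀] stMat A i j := fun i j => by
    filter_upwards [hball] with z hz using hgA z hz i j
  have hφev : φ =ᶠ[𝓝 z₀] stWeight h γ := by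
    filter_upwards [hball] with z hz using hφh z hz
  have hh2 : ContDiffAt ℝ 2 h z₀.1 := hh.of_le (by norm_num)
  have hh1 : DifferentiableAt ℝ h z₀.1 := hh.differentiableAt (by norm_num)
  have hAd : ∀ k l, DifferentiableAt ℝ (entries A k l) z₀.1 := fun k l =>
    ((hA k l).contDiffAt (hω.mem_nhds hxt)).differentiableAt (by norm_num)
  have hθ₀ : ∀ ξ, thetaForm stDir g φ z₀ ξ = thetaForm (coordDir (d + 1)) (entries A) h xt
      (fun k => ξ (some k)) - 4 * γ * ξ none ^ 2 := fun ξ => by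
    rw [thetaForm_congr hgev hφev, thetaForm_stMat hAd hh2]
  have hsumA : ∀ ξ : Fin (d + 1) → ℝ, ∑ k, ∑ l, A xt k l * ξ k * ξ l = ξ ⬝ᵥ (A xt *ᵥ ξ) := by
    intro ξ
    simp only [dotProduct, Matrix.mulVec, Finset.mul_sum]
    exact Finset.sum_congr rfl fun k _ => Finset.sum_congr rfl fun l _ => by ring
  have hdot : ∀ ξ : Fin (d + 1) → ℝ, ξ ⬝ᵥ ξ = ∑ k, ξ k ^ 2 := fun ξ =>
    Finset.sum_congr rfl fun k _ => (sq (ξ k)).symm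
  have hpos₁ : ∀ ξ, ξ ≠ 0 → 0 < thetaForm stDir g φ z₀ ξ - μ * ∑ i, ∑ j, g i j z₀ * ξ i * ξ j := by
    intro ξ hξ
    have e1 : ∑ i, ∑ j, g i j z₀ * ξ i * ξ j
        = (fun k => ξ (some k)) ⬝ᵥ (A xt *ᵥ (fun k => ξ (some k))) - ξ none ^ 2 := by
      rw [← hsumA]
      have e0 : ∀ i j, g i j z₀ * ξ i * ξ j = stMat A i j z₀ * ξ i * ξ j := fun i j => by
        rw [hgA z₀ (mem_of_mem_nhds hball)]
      rw [Finset.sum_congr rfl fun i _ => Finset.sum_congr rfl fun j _ => e0 i j]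
      simp only [Fintype.sum_option, stMat]
      simp [hz₀]
      ring
    have e2 := hupp (fun k => ξ (some k))
    have e3 := hκΘ' (fun k => ξ (some k))
    rw [hdot] at e2
    rw [hθ₀, e1]
    have e4 : μ * ((fun k => ξ (some k)) ⬝ᵥ (A xt *ᵥ (fun k => ξ (some k))))
        ≤ κ / 2 * ∑ k, ξ (some k) ^ 2 := by
      refine (mul_le_mul_of_nonneg_left e2 hμ0.le).trans (le_of_eq ?_)
      rw [hμ]
      field_simp
    have e5 : 0 < κ / 2 * (∑ k, ξ (some k) ^ 2) + μ / 2 * ξ none ^ 2 := by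
      obtain ⟨i, hi⟩ := Function.ne_iff.1 hξ
      have hi' : 0 < ξ i ^ 2 := by
        have : ξ i ≠ 0 := hi
        positivity
      have hs0 : 0 ≤ ∑ k, ξ (some k) ^ 2 := Finset.sum_nonneg fun k _ => sq_nonneg _
      rcases i with _ | k
      · positivity
      · have : 0 < ∑ k, ξ (some k) ^ 2 :=
          Finset.sum_pos' (fun k _ => sq_nonneg _) ⟨k, Finset.mem_univ _, hi'⟩
        positivity
    have e6 : 4 * γ = μ / 2 := by rw [hγ]; ring
    rw [e6]
    linarith
  have hpos₂ : 0 < thetaForm stDir g φ z₀ (fun i => fderiv ℝ φ z₀ (stDir i))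
      + μ * gam stDir g φ φ z₀ := by
    set η : Fin (d + 1) → ℝ := fun k => fderiv ℝ h xt (coordDir (d + 1) k) with hη
    have hη0 : η ≠ 0 := by
      intro h0
      apply hh0
      ext v
      rw [fderiv_apply_eq_sum]
      refine Finset.sum_eq_zero fun k _ => ?_
      rw [show fderiv ℝ h xt (coordDir (d + 1) k) = η k from rfl, h0]
      simp
    have hηs : 0 < ∑ k, η k ^ 2 := by
      obtain ⟨i, hi⟩ := Function.ne_iff.1 hη0
      refine Finset.sum_pos' (fun k _ => sq_nonneg _) ⟨i, Finset.mem_univ _, ?_⟩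
      have : η i ≠ 0 := hi
      positivity
    have d1 : ∀ k, fderiv ℝ φ z₀ (stDir (some k)) = η k := fun k => by
      rw [hφev.fderiv_eq]
      exact fderiv_stWeight_dirX hh1 k
    have d2 : fderiv ℝ φ z₀ (stDir none) = 0 := by
      rw [hφev.fderiv_eq]
      refine (fderiv_stWeight_dirT hh1).trans ?_
      simp [hz₀]
    -- At `t = 0` the time derivative of the weight vanishes, so `Γ(φ, φ) = (A∇h|∇h)`, which is
    -- positive by ellipticity and `∇h ≠ 0`. Hence `μΓ(φ, φ)` helps.
    have e1 : gam stDir g φ φ z₀ = η ⬝ᵥ (A xt *ᵥ η) := by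
      rw [gam_congr (hgA z₀ (mem_of_mem_nhds hball)) hφev hφev, gam_stMat_stWeight hh1, ← hsumA]
      simp [hz₀, gam, entries, hη]
    rw [hθ₀, e1, d2]
    simp only [d1]
    have e2 := hΘ η hη0
    have e3 := hlow η
    rw [hdot] at e3
    have e4 : 0 < μ * (η ⬝ᵥ (A xt *ᵥ η)) := mul_pos hμ0 (lt_of_lt_of_le (by positivity) e3)
    have e5 : (fun k => η k) = η := rfl
    rw [e5]
    linarith
  -- persistence near the base point
  have hg1 : ∀ i j, ContDiff ℝ 1 (g i j) := fun i j => (hgC i j).of_le (by norm_num)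
  have hφ2 : ContDiff ℝ 2 φ := hφC.of_le (by norm_num)
  obtain ⟨c₁, hc₁, hev₁⟩ := eventually_coercive
    (q := fun z ξ => thetaForm stDir g φ z ξ - μ * ∑ i, ∑ j, g i j z * ξ i * ξ j)
    (x₀ := z₀) (by
      have c1 : ∀ i j, Continuous
          (fun p : SpaceTime d × (Option (Fin (d + 1)) → ℝ) => g i j p.1) := fun i j =>
        (hgC i j).continuous.comp continuous_fst
      have c2 := continuous_thetaForm (e := stDir) hg1 hφ2
      fun_prop) (fun z t ξ => by
      simp only [thetaForm_smul, mul_sub, Finset.mul_sum]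
      congr 1
      exact Finset.sum_congr rfl fun k _ => Finset.sum_congr rfl fun l _ => by ring) hpos₁
  have hcont₂ : Continuous (fun z => thetaForm stDir g φ z (fun i => fderiv ℝ φ z (stDir i))
      + μ * gam stDir g φ φ z) := by
    have c1 : Continuous (fun z : SpaceTime d => (z, fun i => fderiv ℝ φ z (stDir i))) :=
      continuous_id.prodMk (continuous_pi fun i =>
        (contDiff_fderiv_apply_const (m := 1) hφ2 (by norm_num) _).continuous)
    exact ((continuous_thetaForm (e := stDir) hg1 hφ2).comp c1).add (continuous_const.mul
      (ContDiff.gam (m := 1) hg1 hφ2 hφ2 (by norm_num)).continuous)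
  have hev₂ := hcont₂.continuousAt.eventually (lt_mem_nhds (half_lt_self hpos₂))
  set c₂ := (thetaForm stDir g φ z₀ (fun i => fderiv ℝ φ z₀ (stDir i))
      + μ * gam stDir g φ φ z₀) / 2 with hc₂
  have hc₂0 : 0 < c₂ := half_pos hpos₂
  obtain ⟨R, hR, hRb⟩ := Metric.eventually_nhds_iff_ball.1 ((hev₁.and hev₂).and
    (show ∀ᶠ z in 𝓝 z₀, z ∈ Metric.ball z₀ (ρ / 4) from hball))
  refine ⟨γ, hγ0, g, φ, μ, min c₁ c₂, R, hgC, hgs, hφC, lt_min hc₁ hc₂0, hR, ?_⟩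
  intro z hz
  obtain ⟨⟨h1, h2⟩, h3⟩ := hRb z hz
  refine ⟨hgA z h3, hφh z h3, fun ξ => ?_, ?_⟩
  · refine le_trans ?_ (h1 ξ)
    exact mul_le_mul_of_nonneg_right (min_le_left _ _)
      (Finset.sum_nonneg fun i _ => sq_nonneg _)
  · exact (min_le_right _ _).trans h2.le

end Localization

/-! ### Mollification -/

section Mollify

variable {E : Type*} [NormedAddCommGroup E] [NormedSpace ℝ E] [FiniteDimensional ℝ E]
  [MeasureSpace E] [BorelSpace E] [(volume : Measure E).IsAddHaarMeasure]
  {F : Type*} [NormedAddCommGroup F] [NormedSpace ℝ F] [CompleteSpace F]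

/-- A bump function supported in the ball of radius `1 / (n + 1)`. -/
def mollifier (E : Type*) [NormedAddCommGroup E] (n : ℕ) : ContDiffBump (0 : E) :=
  ⟨1 / (2 * ((n : ℝ) + 1)), 1 / ((n : ℝ) + 1), by positivity, by
    apply one_div_lt_one_div_of_lt <;> linarith [n.cast_nonneg (α := ℝ)]⟩

lemma tendsto_mollifier_rOut : Tendsto (fun n => (mollifier E n).rOut) atTop (𝓝 0) :=
  tendsto_one_div_add_atTop_nhds_zero_nat

/-- Convolution with a normed bump function. -/
def mollify (n : ℕ) (f : E → F) : E → F :=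
  (mollifier E n).normed volume ⋆[ContinuousLinearMap.lsmul ℝ ℝ, volume] f

lemma mollify_apply (n : ℕ) (f : E → F) (x : E) :
    mollify n f x = ∫ t, (mollifier E n).normed volume t • f (x - t) := rfl

lemma contDiff_mollify {n : ℕ} {f : E → F} (hf : LocallyIntegrable f) {m : ℕ∞} :
    ContDiff ℝ m (mollify n f) :=
  (mollifier E n).hasCompactSupport_normed.contDiff_convolution_left _
    (mollifier E n).contDiff_normed hf

lemma mollify_eq_zero {n : ℕ} {f : E → F} {K : Set E} (hf : ∀ x ∉ K, f x = 0) {x : E}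
    (hx : x ∉ Metric.cthickening (1 / ((n : ℝ) + 1)) K) : mollify n f x = 0 := by
  rw [mollify_apply]
  refine integral_eq_zero_of_ae (Eventually.of_forall fun t => ?_)
  change (mollifier E n).normed volume t • f (x - t) = 0
  by_cases ht : t ∈ Metric.ball (0 : E) (1 / ((n : ℝ) + 1))
  · rw [hf, smul_zero]
    intro hK
    refine hx (Metric.mem_cthickening_of_dist_le x (x - t) _ K hK ?_)
    rw [dist_eq_norm, sub_sub_cancel]
    exact (mem_ball_zero_iff.1 ht).le
  · have : (mollifier E n).normed volume t = 0 := by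
      rw [← Function.notMem_support, ContDiffBump.support_normed_eq]
      exact ht
    rw [this, zero_smul]

lemma norm_mollify_le {n : ℕ} {f : E → F} {M : ℝ} (hf : ∀ x, ‖f x‖ ≤ M) (x : E) :
    ‖mollify n f x‖ ≤ M := by
  rw [mollify_apply]
  have h1 : ∀ t, ‖(mollifier E n).normed volume t • f (x - t)‖
      ≤ (mollifier E n).normed volume t * M := by
    intro t
    rw [norm_smul, Real.norm_of_nonneg ((mollifier E n).nonneg_normed t)]
    exact mul_le_mul_of_nonneg_left (hf _) ((mollifier E n).nonneg_normed t)
  refine (norm_integral_le_of_norm_le ((mollifier E n).integrable_normed.mul_const M)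
    (Eventually.of_forall h1)).trans (le_of_eq ?_)
  rw [integral_mul_const, (mollifier E n).integral_normed, one_mul]

lemma fderiv_mollify {n : ℕ} {f : E → F} (hf : ContDiff ℝ 1 f) (hc : HasCompactSupport f)
    (x v : E) : fderiv ℝ (mollify n f) x v = mollify n (fun y => fderiv ℝ f y v) x := by
  have hρ : LocallyIntegrable ((mollifier E n).normed volume) volume :=
    (mollifier E n).integrable_normed.locallyIntegrable
  have h1 := hc.hasFDerivAt_convolution_right (ContinuousLinearMap.lsmul ℝ ℝ) hρ hf x
  rw [mollify, h1.fderiv, convolution_precompR_apply _ hρ (hc.fderiv ℝ)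
    (hf.continuous_fderiv (by norm_num))]
  rfl

/-- The kernel is a probability density: Jensen's inequality bounds `|ρ ∗ f|²` by the average of
translates of `|f|²`, and Tonelli with translation invariance finishes. -/
lemma eLpNorm_mollify_le {n : ℕ} {f : E → F} (hf : MemLp f 2) :
    eLpNorm (mollify n f) 2 ≤ eLpNorm f 2 := by
  set ρ := (mollifier E n).normed volume with hρ
  have hρ0 : ∀ t, 0 ≤ ρ t := (mollifier E n).nonneg_normed
  have hρm : Measurable fun t => ENNReal.ofReal (ρ t) :=
    (mollifier E n).continuous_normed.measurable.ennreal_ofReal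
  set ν : Measure E := volume.withDensity fun t => ENNReal.ofReal (ρ t) with hν
  have hνp : IsProbabilityMeasure ν := by
    refine ⟨?_⟩
    rw [hν, withDensity_apply _ MeasurableSet.univ, Measure.restrict_univ,
      ← ofReal_integral_eq_lintegral_ofReal (mollifier E n).integrable_normed
        (Eventually.of_forall hρ0), (mollifier E n).integral_normed, ENNReal.ofReal_one]
  have hfm : AEStronglyMeasurable (fun p : E × E => f (p.1 - p.2)) (volume.prod volume) :=
    hf.1.comp_quasiMeasurePreserving (quasiMeasurePreserving_sub_of_right_invariant volume volume)
  have hfm' : AEMeasurable (fun p : E × E => ‖f (p.1 - p.2)‖ₑ ^ (2 : ℝ)) (volume.prod ν) := by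
    refine (hfm.enorm.pow_const _).mono_ac ?_
    exact Measure.AbsolutelyContinuous.rfl.prod (withDensity_absolutelyContinuous _ _)
  have hpt : ∀ x, ‖mollify n f x‖ₑ ^ (2 : ℝ) ≤ ∫⁻ t, ‖f (x - t)‖ₑ ^ (2 : ℝ) ∂ν := by
    intro x
    have hmx : AEStronglyMeasurable (fun t => f (x - t)) ν := by
      refine AEStronglyMeasurable.mono_ac (withDensity_absolutelyContinuous _ _)
        (hf.1.comp_quasiMeasurePreserving
          (quasiMeasurePreserving_sub_left_of_right_invariant volume x))
    have h1 : ‖mollify n f x‖ₑ ≤ ∫⁻ t, ‖f (x - t)‖ₑ ∂ν := by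
      rw [mollify_apply]
      refine (enorm_integral_le_lintegral_enorm _).trans (le_of_eq ?_)
      rw [hν, lintegral_withDensity_eq_lintegral_mul_non_measurable _ hρm
        (Eventually.of_forall fun t => ENNReal.ofReal_lt_top)]
      refine lintegral_congr fun t => ?_
      rw [enorm_smul, Pi.mul_apply, Real.enorm_of_nonneg (hρ0 t)]
    have h2 : ∫⁻ t, ‖f (x - t)‖ₑ ∂ν ≤ (∫⁻ t, ‖f (x - t)‖ₑ ^ (2 : ℝ) ∂ν) ^ (1 / (2 : ℝ)) := by
      have := eLpNorm_le_eLpNorm_of_exponent_le (μ := ν) (p := 1) (q := 2) (by norm_num) hmx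
      rw [eLpNorm_one_eq_lintegral_enorm,
        eLpNorm_eq_lintegral_rpow_enorm_toReal (by norm_num) (by norm_num)] at this
      simpa using this
    calc ‖mollify n f x‖ₑ ^ (2 : ℝ) ≤ ((∫⁻ t, ‖f (x - t)‖ₑ ^ (2 : ℝ) ∂ν) ^ (1 / (2 : ℝ))) ^ (2 : ℝ) :=
          ENNReal.rpow_le_rpow (h1.trans h2) (by norm_num)
      _ = _ := by rw [← ENNReal.rpow_mul]; norm_num
  rw [eLpNorm_eq_lintegral_rpow_enorm_toReal (by norm_num) (by norm_num),
    eLpNorm_eq_lintegral_rpow_enorm_toReal (by norm_num) (by norm_num)]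
  refine ENNReal.rpow_le_rpow ?_ (by norm_num)
  simp only [ENNReal.toReal_ofNat]
  calc ∫⁻ x, ‖mollify n f x‖ₑ ^ (2 : ℝ) ≤ ∫⁻ x, ∫⁻ t, ‖f (x - t)‖ₑ ^ (2 : ℝ) ∂ν :=
        lintegral_mono hpt
    _ = ∫⁻ t, (∫⁻ x, ‖f (x - t)‖ₑ ^ (2 : ℝ)) ∂ν := lintegral_lintegral_swap hfm'
    _ = ∫⁻ t, (∫⁻ x, ‖f x‖ₑ ^ (2 : ℝ)) ∂ν := by
        refine lintegral_congr fun t => ?_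
        exact lintegral_sub_right_eq_self (μ := volume) (fun x => ‖f x‖ₑ ^ (2 : ℝ)) t
    _ = ∫⁻ x, ‖f x‖ₑ ^ (2 : ℝ) := by simp

lemma mollify_sub {n : ℕ} {f g : E → F} (hf : LocallyIntegrable f) (hg : LocallyIntegrable g) :
    mollify n (f - g) = mollify n f - mollify n g := by
  funext x
  have hc := (mollifier E n).hasCompactSupport_normed (μ := volume)
  have e1 := hc.convolutionExists_left (ContinuousLinearMap.lsmul ℝ ℝ)
    (mollifier E n).continuous_normed hf x
  have e2 := hc.convolutionExists_left (ContinuousLinearMap.lsmul ℝ ℝ)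
    (mollifier E n).continuous_normed hg x
  simp only [mollify_apply, Pi.sub_apply, smul_sub]
  exact integral_sub e1 e2

/-- Uniform continuity gives uniform convergence, and all the differences live in one compact set of
finite measure, the `1`-thickening of the support. -/
lemma tendsto_eLpNorm_mollify_sub_of_continuous {g : E → F} (hg : Continuous g)
    (hc : HasCompactSupport g) :
    Tendsto (fun n => eLpNorm (mollify n g - g) 2 volume) atTop (𝓝 0) := by
  set K := Metric.cthickening 1 (tsupport g) with hK
  have hKc : IsCompact K := hc.isCompact.cthickening
  have hzero : ∀ n, ∀ x ∉ K, (mollify n g - g) x = 0 := by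
    intro n x hx
    have h1 : mollify n g x = 0 := by
      refine mollify_eq_zero (K := tsupport g) (fun y hy => image_eq_zero_of_notMem_tsupport hy)
        fun h => hx (Metric.cthickening_mono ?_ _ h)
      rw [div_le_one (by positivity)]
      linarith [n.cast_nonneg (α := ℝ)]
    have h2 : g x = 0 := image_eq_zero_of_notMem_tsupport fun h =>
      hx (Metric.self_subset_cthickening _ h)
    rw [Pi.sub_apply, h1, h2, sub_zero]
  have huc : UniformContinuous g := hc.uniformContinuous_of_continuous hg
  have hvol : (volume K) ^ (1 / (2 : ℝ)) ≠ ∞ :=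
    ENNReal.rpow_ne_top_of_nonneg (by norm_num) hKc.measure_lt_top.ne
  rw [ENNReal.tendsto_nhds_zero]
  intro ε hε
  obtain ⟨δ, hδ, hδε⟩ : ∃ δ : ℝ, 0 < δ ∧ (volume K) ^ (1 / (2 : ℝ)) * ENNReal.ofReal δ ≤ ε := by
    rcases eq_or_ne ε ∞ with rfl | hε'
    · exact ⟨1, one_pos, le_top⟩
    set V := (volume K) ^ (1 / (2 : ℝ)) with hV
    refine ⟨ε.toReal / (V.toReal + 1), by
      have := ENNReal.toReal_pos hε.ne' hε'
      positivity, ?_⟩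
    rw [← ENNReal.ofReal_toReal hvol, ← ENNReal.ofReal_mul ENNReal.toReal_nonneg]
    refine ENNReal.ofReal_le_of_le_toReal ?_
    have h0 : 0 ≤ V.toReal := ENNReal.toReal_nonneg
    rw [ENNReal.toReal_ofReal h0, ← mul_div_assoc, div_le_iff₀ (by positivity)]
    nlinarith [ENNReal.toReal_nonneg (a := ε)]
  obtain ⟨r, hr, hrδ⟩ := Metric.uniformContinuous_iff.1 huc δ hδ
  have hev := (tendsto_mollifier_rOut (E := E)).eventually (gt_mem_nhds hr)
  filter_upwards [hev] with n hn
  have hpt : ∀ x, ‖(mollify n g - g) x‖ ≤ δ := by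
    intro x
    rw [Pi.sub_apply, ← dist_eq_norm]
    refine (mollifier E n).dist_normed_convolution_le hg.aestronglyMeasurable fun y hy => ?_
    exact (hrδ ((Metric.mem_ball.1 hy).trans hn)).le
  have e1 : eLpNorm (mollify n g - g) 2 volume
      = eLpNorm (mollify n g - g) 2 (volume.restrict K) := by
    rw [← eLpNorm_indicator_eq_eLpNorm_restrict hKc.measurableSet]
    congr 1
    funext x
    by_cases hx : x ∈ K
    · rw [indicator_of_mem hx]
    · rw [indicator_of_notMem hx, hzero n x hx]
  rw [e1]
  refine (eLpNorm_le_of_ae_bound (Eventually.of_forall hpt)).trans (le_trans (le_of_eq ?_) hδε)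
  simp

/-- Density of continuous compactly supported functions, with the contraction property of
mollification controlling the error uniformly in `n`. -/
lemma tendsto_eLpNorm_mollify_sub {f : E → F} (hf : MemLp f 2) :
    Tendsto (fun n => eLpNorm (mollify n f - f) 2 volume) atTop (𝓝 0) := by
  rw [ENNReal.tendsto_nhds_zero]
  intro ε hε
  have hε3 : ε / 3 ≠ 0 := by simpa using hε.ne'
  obtain ⟨g, hgc, hfg, hg, hgm⟩ := hf.exists_hasCompactSupport_eLpNorm_sub_le (by norm_num) hε3
  have hev := (ENNReal.tendsto_nhds_zero.1 (tendsto_eLpNorm_mollify_sub_of_continuous hg hgc))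
    (ε / 3) (pos_iff_ne_zero.2 hε3)
  filter_upwards [hev] with n hn
  have lf : LocallyIntegrable f := hf.locallyIntegrable (by norm_num)
  have lg : LocallyIntegrable g := hgm.locallyIntegrable (by norm_num)
  have e1 : mollify n f - f = mollify n (f - g) + (mollify n g - g) + (g - f) := by
    rw [mollify_sub lf lg]
    abel
  have m1 : AEStronglyMeasurable (mollify n (f - g)) volume :=
    (contDiff_mollify (lf.sub lg) (m := 0)).continuous.aestronglyMeasurable
  have m2 : AEStronglyMeasurable (mollify n g - g) volume :=
    ((contDiff_mollify lg (m := 0)).continuous.sub hg).aestronglyMeasurable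
  have m3 : AEStronglyMeasurable (g - f) volume := hgm.1.sub hf.1
  rw [e1]
  calc _ ≤ eLpNorm (mollify n (f - g) + (mollify n g - g)) 2 volume + eLpNorm (g - f) 2 volume :=
        eLpNorm_add_le (m1.add m2) m3 (by norm_num)
    _ ≤ eLpNorm (mollify n (f - g)) 2 volume + eLpNorm (mollify n g - g) 2 volume
        + eLpNorm (g - f) 2 volume := by
        gcongr
        exact eLpNorm_add_le m1 m2 (by norm_num)
    _ ≤ ε / 3 + ε / 3 + ε / 3 := by
        gcongr
        · exact (eLpNorm_mollify_le (hf.sub hgm)).trans hfg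
        · rw [eLpNorm_sub_comm]
          exact hfg
    _ = ε := ENNReal.add_thirds ε

end Mollify

/-! ### Weak derivatives -/

section WeakDeriv

variable {d : ℕ} {U V : Set (SpaceTime d)} {v : SpaceTime d} {f f' g g' : SpaceTime d → ℂ}

instance : (volume : Measure (SpaceTime d)).IsAddHaarMeasure :=
  inferInstanceAs ((volume : Measure (Eu (d + 1))).prod (volume : Measure ℝ)).IsAddHaarMeasure

lemma integrable_smul_of_tsupport_subset {φ : SpaceTime d → ℝ} (hφ : Continuous φ)
    (hc : HasCompactSupport φ) (hs : tsupport φ ⊆ U) (hf : LocallyIntegrableOn f U) :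
    Integrable (fun z => φ z • f z) := by
  have h1 : IntegrableOn (fun z => φ z • f z) (tsupport φ) :=
    (hf.integrableOn_compact_subset hs hc).continuousOn_smul hφ.continuousOn hc
  refine (integrableOn_iff_integrable_of_support_subset ?_).1 h1
  intro z hz
  refine subset_tsupport φ fun h0 => hz ?_
  change φ z • f z = 0
  rw [h0, zero_smul]

lemma setIntegral_smul_eq_integral {φ : SpaceTime d → ℝ} (hs : tsupport φ ⊆ U) :
    ∫ z in U, φ z • f z = ∫ z, φ z • f z := by
  refine setIntegral_eq_integral_of_forall_compl_eq_zero fun z hz => ?_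
  rw [image_eq_zero_of_notMem_tsupport fun h => hz (hs h), zero_smul]

/-- Mollification preserves integrals against locally integrable functions in the limit. -/
lemma tendsto_integral_mollify_smul {η : SpaceTime d → ℝ} (hη : Continuous η)
    (hc : HasCompactSupport η) {K : Set (SpaceTime d)} (hf : IntegrableOn f K) :
    Tendsto (fun n => ∫ z in K, mollify n η z • f z) atTop (𝓝 (∫ z in K, η z • f z)) := by
  obtain ⟨M, hM⟩ := hc.exists_bound_of_continuous hη
  refine tendsto_integral_of_dominated_convergence (fun z => M * ‖f z‖) ?_ (hf.norm.const_mul M)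
    ?_ ?_
  · intro n
    exact ((contDiff_mollify (hη.locallyIntegrable) (m := 0)).continuous.aestronglyMeasurable).smul
      hf.1
  · intro n
    refine Eventually.of_forall fun z => ?_
    rw [norm_smul]
    exact mul_le_mul_of_nonneg_right (norm_mollify_le hM z) (norm_nonneg _)
  · refine Eventually.of_forall fun z => Tendsto.smul_const ?_ _
    exact ContDiffBump.convolution_tendsto_right_of_continuous tendsto_mollifier_rOut hη z

/-- A weak derivative can be tested against `C¹` functions. -/
lemma HasWeakDeriv.integral_eq (hU : IsOpen U) (h : HasWeakDeriv U v f g) {η : SpaceTime d → ℝ}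
    (hη : ContDiff ℝ 1 η) (hc : HasCompactSupport η) (hs : tsupport η ⊆ U) :
    ∫ z, fderiv ℝ η z v • f z = -∫ z, η z • g z := by
  obtain ⟨hf, hg, htest⟩ := h
  -- Room for mollification: approximants of radius below `δ` are smooth test functions supported in
  -- one compact subset of `U`.
  obtain ⟨δ, hδ, hδU⟩ := hc.isCompact.exists_cthickening_subset_open hU hs
  set K := Metric.cthickening δ (tsupport η) with hKdef
  have hK : IsCompact K := hc.isCompact.cthickening
  have hηK : tsupport η ⊆ K := Metric.self_subset_cthickening _
  have hη' : Continuous (fun z => fderiv ℝ η z v) :=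
    (contDiff_fderiv_apply_const (m := 0) hη (by norm_num) v).continuous
  have hc' : HasCompactSupport (fun z => fderiv ℝ η z v) := hc.fderiv_apply ℝ v
  have hsmall : ∀ᶠ n : ℕ in atTop, 1 / ((n : ℝ) + 1) < δ :=
    (tendsto_one_div_add_atTop_nhds_zero_nat (𝕜 := ℝ)).eventually (gt_mem_nhds hδ)
  have hvan : ∀ ζ : SpaceTime d → ℝ, tsupport ζ ⊆ tsupport η →
      ∀ᶠ n : ℕ in atTop, ∀ z ∉ K, mollify n ζ z = 0 := by
    intro ζ hζ
    filter_upwards [hsmall] with n hn z hz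
    refine mollify_eq_zero (K := tsupport η)
      (fun y hy => image_eq_zero_of_notMem_tsupport fun h => hy (hζ h)) fun h => hz ?_
    exact Metric.cthickening_mono hn.le _ h
  have lim1 := tendsto_integral_mollify_smul hη' hc'
    (hf.integrableOn_compact_subset hδU hK)
  have lim2 := (tendsto_integral_mollify_smul hη.continuous hc
    (hg.integrableOn_compact_subset hδU hK)).neg
  have toK : ∀ {ζ : SpaceTime d → ℝ} {k : SpaceTime d → ℂ}, (∀ z ∉ K, ζ z = 0) →
      ∫ z in K, ζ z • k z = ∫ z, ζ z • k z := fun h0 =>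
    setIntegral_eq_integral_of_forall_compl_eq_zero fun z hz => by rw [h0 z hz, zero_smul]
  have heq : (fun n => ∫ z in K, mollify n (fun z => fderiv ℝ η z v) z • f z)
      =ᶠ[atTop] fun n => -∫ z in K, mollify n η z • g z := by
    filter_upwards [hvan η subset_rfl, hvan _ (tsupport_fderiv_apply_subset ℝ v)] with n h1 h2
    have hts : tsupport (mollify n η) ⊆ K := by
      refine closure_minimal (fun z hz => ?_) hK.isClosed
      by_contra h
      exact hz (h1 z h)
    have := htest (mollify n η) (contDiff_mollify hη.continuous.locallyIntegrable)
      (HasCompactSupport.intro hK h1) (hts.trans hδU)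
    simp only [fderiv_mollify hη hc] at this
    rw [toK h1, toK h2, ← setIntegral_smul_eq_integral (hts.trans hδU), ← this]
    refine (setIntegral_eq_integral_of_forall_compl_eq_zero fun z hz => ?_).symm
    rw [h2 z fun h => hz (hδU h), zero_smul]
  have := tendsto_nhds_unique (lim1.congr' heq) lim2
  rwa [toK fun z hz => image_eq_zero_of_notMem_tsupport fun h => hz (hηK h), toK fun z hz =>
    fderiv_apply_eq_zero_of_notMem_tsupport (fun h => hz (hηK h)) v] at this

/-- The difference is orthogonal to all test functions. This is what makes the arbitrary choice in
`weakDeriv` harmless. -/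
lemma HasWeakDeriv.ae_unique (hU : IsOpen U) (h : HasWeakDeriv U v f g)
    (h' : HasWeakDeriv U v f g') : g =ᵐ[volume.restrict U] g' := by
  have key : ∀ᵐ z, z ∈ U → (g - g') z = 0 := by
    refine hU.ae_eq_zero_of_integral_contDiff_smul_eq_zero (h.2.1.sub h'.2.1) ?_
    intro φ hφ hc hs
    have hφ1 : ContDiff ℝ 1 φ := hφ.of_le (by exact_mod_cast le_top)
    have e1 := h.integral_eq hU hφ1 hc hs
    have e2 := h'.integral_eq hU hφ1 hc hs
    have i1 := integrable_smul_of_tsupport_subset hφ.continuous hc hs h.2.1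
    have i2 := integrable_smul_of_tsupport_subset hφ.continuous hc hs h'.2.1
    simp only [Pi.sub_apply, smul_sub]
    rw [integral_sub i1 i2, sub_eq_zero]
    exact neg_injective (e1.symm.trans e2)
  rw [Filter.EventuallyEq, ae_restrict_iff' hU.measurableSet]
  filter_upwards [key] with z hz hzU
  exact sub_eq_zero.1 (hz hzU)

/-- Weak derivatives are local: test functions supported in `V` do not see `f`. Later this kills all
derivatives of `u` on the side `θ < θ(x̃)`. -/
lemma HasWeakDeriv.ae_eq_zero (hU : IsOpen U) (h : HasWeakDeriv U v f g) (hV : IsOpen V)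
    (hVU : V ⊆ U) (hf : ∀ᵐ z, z ∈ V → f z = 0) : ∀ᵐ z, z ∈ V → g z = 0 := by
  refine hV.ae_eq_zero_of_integral_contDiff_smul_eq_zero (h.2.1.mono_set hVU) fun φ hφ hc hs => ?_
  have hφ1 : ContDiff ℝ 1 φ := hφ.of_le (by exact_mod_cast le_top)
  have e1 := h.integral_eq hU hφ1 hc (hs.trans hVU)
  rw [integral_eq_zero_of_ae (f := fun z => fderiv ℝ φ z v • f z)] at e1
  · exact (neg_eq_zero.1 e1.symm)
  · filter_upwards [hf] with z hz
    change fderiv ℝ φ z v • f z = 0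
    by_cases hzV : z ∈ V
    · rw [hz hzV, smul_zero]
    · rw [fderiv_apply_eq_zero_of_notMem_tsupport fun h => hzV (hs h), zero_smul]

lemma LocallyIntegrableOn.congr_ae {f f' : SpaceTime d → ℂ} (hU : IsOpen U)
    (hf : LocallyIntegrableOn f U) (hff : f =ᵐ[volume.restrict U] f') : LocallyIntegrableOn f' U := by
  rw [locallyIntegrableOn_iff hU.isLocallyClosed] at hf ⊢
  intro K hK hKc
  exact (hf K hK hKc).congr_fun_ae (ae_restrict_of_ae_restrict_of_subset hK hff)

lemma HasWeakDeriv.congr (hU : IsOpen U) (h : HasWeakDeriv U v f g)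
    (hf : f =ᵐ[volume.restrict U] f') (hg : g =ᵐ[volume.restrict U] g') :
    HasWeakDeriv U v f' g' := by
  refine ⟨LocallyIntegrableOn.congr_ae hU h.1 hf, LocallyIntegrableOn.congr_ae hU h.2.1 hg,
    fun φ hφ hc hs => ?_⟩
  have e1 : ∫ z in U, fderiv ℝ φ z v • f' z = ∫ z in U, fderiv ℝ φ z v • f z :=
    integral_congr_ae (by filter_upwards [hf] with z hz; rw [hz])
  have e2 : ∫ z in U, φ z • g' z = ∫ z in U, φ z • g z :=
    integral_congr_ae (by filter_upwards [hg] with z hz; rw [hz])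
  rw [e1, e2]
  exact h.2.2 φ hφ hc hs

lemma weakDeriv_ae_eq (hU : IsOpen U) (h : HasWeakDeriv U v f g) :
    weakDeriv U v f =ᵐ[volume.restrict U] g := by
  have hex : ∃ g, HasWeakDeriv U v f g := ⟨g, h⟩
  rw [weakDeriv, dif_pos hex]
  exact hex.choose_spec.ae_unique hU h

lemma weakDeriv_ae_eq_of_ae_eq (hU : IsOpen U) (h : HasWeakDeriv U v f g)
    (hf : f =ᵐ[volume.restrict U] f') : weakDeriv U v f' =ᵐ[volume.restrict U] g :=
  weakDeriv_ae_eq hU (h.congr hU hf (ae_eq_refl _))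

/-- The product rule for a weak derivative and a `C¹` function. -/
lemma HasWeakDeriv.smul (hU : IsOpen U) (h : HasWeakDeriv U v f g) {a : SpaceTime d → ℝ}
    (ha : ContDiffOn ℝ 1 a U) :
    HasWeakDeriv U v (fun z => a z • f z) (fun z => a z • g z + fderiv ℝ a z v • f z) := by
  have ha' : ContinuousOn (fun z => fderiv ℝ a z v) U :=
    (ha.continuousOn_fderiv_of_isOpen hU (by norm_num)).clm_apply continuousOn_const
  refine ⟨h.1.continuousOn_smul hU.isLocallyClosed ha.continuousOn,
    (h.2.1.continuousOn_smul hU.isLocallyClosed ha.continuousOn).add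
      (h.1.continuousOn_smul hU.isLocallyClosed ha'), fun φ hφ hc hs => ?_⟩
  have hφ1 : ContDiff ℝ 1 φ := hφ.of_le (by exact_mod_cast le_top)
  -- The natural test function `φ · a` is only `C¹`, hence the need to test weak derivatives against
  -- `C¹` functions.
  have hη := contDiff_mul_of_tsupport_subset hφ1 hs hU ha
  have hηc : HasCompactSupport (fun z => φ z * a z) := hc.mul_right
  have hηs : tsupport (fun z => φ z * a z) ⊆ U :=
    (closure_mono (Function.support_mul_subset_left _ _)).trans hs
  have e1 := h.integral_eq hU hη hηc hηs
  have hd : ∀ z ∈ U, fderiv ℝ (fun z => φ z * a z) z v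
      = φ z * fderiv ℝ a z v + a z * fderiv ℝ φ z v := by
    intro z hz
    rw [fderiv_fun_mul ((hφ1.differentiable (by norm_num)) z)
      ((ha.contDiffAt (hU.mem_nhds hz)).differentiableAt (by norm_num))]
    simp
  have ets : tsupport (fun z => fderiv ℝ φ z v) ⊆ U := (tsupport_fderiv_apply_subset ℝ v).trans hs
  have i1 : Integrable (fun z => φ z • (a z • g z)) := integrable_smul_of_tsupport_subset
    hφ.continuous hc hs (h.2.1.continuousOn_smul hU.isLocallyClosed ha.continuousOn)
  have i2 : Integrable (fun z => φ z • (fderiv ℝ a z v • f z)) := integrable_smul_of_tsupport_subset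
    hφ.continuous hc hs (h.1.continuousOn_smul hU.isLocallyClosed ha')
  have i3 : Integrable (fun z => fderiv ℝ φ z v • (a z • f z)) := integrable_smul_of_tsupport_subset
    (contDiff_fderiv_apply_const (m := 0) hφ1 (by norm_num) v).continuous (hc.fderiv_apply ℝ v) ets
    (h.1.continuousOn_smul hU.isLocallyClosed ha.continuousOn)
  rw [setIntegral_smul_eq_integral ets, setIntegral_smul_eq_integral hs]
  simp only [smul_add]
  rw [integral_add i1 i2]
  have e2 : ∫ z, fderiv ℝ (fun z => φ z * a z) z v • f z
      = ∫ z, (φ z • (fderiv ℝ a z v • f z) + fderiv ℝ φ z v • (a z • f z)) := by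
    refine integral_congr_ae (Eventually.of_forall fun z => ?_)
    simp only
    by_cases hz : z ∈ U
    · rw [hd z hz, add_smul, mul_smul, mul_comm (a z), mul_smul]
    · rw [fderiv_apply_eq_zero_of_notMem_tsupport (fun h => hz (hηs h)),
        image_eq_zero_of_notMem_tsupport (fun h => hz (hs h)),
        fderiv_apply_eq_zero_of_notMem_tsupport (fun h => hz (hs h))]
      simp
  rw [e2, integral_add i2 i3] at e1
  simp only [mul_smul] at e1
  rw [eq_sub_of_add_eq' e1]
  ring

/-- Multiplication with a cutoff function extends weak derivatives to the whole space. -/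
lemma HasWeakDeriv.cutoff (hU : IsOpen U) (h : HasWeakDeriv U v f g) {χ : SpaceTime d → ℝ}
    (hχ : ContDiff ℝ 1 χ) (hc : HasCompactSupport χ) (hs : tsupport χ ⊆ U) :
    HasWeakDeriv univ v (fun z => χ z • f z) (fun z => χ z • g z + fderiv ℝ χ z v • f z) := by
  have hχ' : Continuous (fun z => fderiv ℝ χ z v) :=
    (contDiff_fderiv_apply_const (m := 0) hχ (by norm_num) v).continuous
  have ets : tsupport (fun z => fderiv ℝ χ z v) ⊆ U := (tsupport_fderiv_apply_subset ℝ v).trans hs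
  have i1 := integrable_smul_of_tsupport_subset hχ.continuous hc hs h.1
  have i2 := integrable_smul_of_tsupport_subset hχ.continuous hc hs h.2.1
  have i3 := integrable_smul_of_tsupport_subset hχ' (hc.fderiv_apply ℝ v) ets h.1
  refine ⟨i1.locallyIntegrable.locallyIntegrableOn _,
    (i2.add i3).locallyIntegrable.locallyIntegrableOn _, fun φ hφ hφc _ => ?_⟩
  have hφ1 : ContDiff ℝ 1 φ := hφ.of_le (by exact_mod_cast le_top)
  have hηs : tsupport (fun z => χ z * φ z) ⊆ U :=
    (closure_mono (Function.support_mul_subset_left _ _)).trans hs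
  have e1 := h.integral_eq hU (hχ.mul hφ1) hc.mul_right hηs
  have hφ' : Continuous (fun z => fderiv ℝ φ z v) :=
    (contDiff_fderiv_apply_const (m := 0) hφ1 (by norm_num) v).continuous
  have l1 : LocallyIntegrableOn (fun z => χ z • f z) (univ : Set (SpaceTime d)) :=
    i1.locallyIntegrable.locallyIntegrableOn _
  have l2 : LocallyIntegrableOn (fun z => χ z • g z) (univ : Set (SpaceTime d)) :=
    i2.locallyIntegrable.locallyIntegrableOn _
  have l3 : LocallyIntegrableOn (fun z => fderiv ℝ χ z v • f z) (univ : Set (SpaceTime d)) :=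
    i3.locallyIntegrable.locallyIntegrableOn _
  have j1 := integrable_smul_of_tsupport_subset hφ' (hφc.fderiv_apply ℝ v) (subset_univ _) l1
  have j2 := integrable_smul_of_tsupport_subset hφ.continuous hφc (subset_univ _) l2
  have j3 := integrable_smul_of_tsupport_subset hφ.continuous hφc (subset_univ _) l3
  simp only [Measure.restrict_univ, smul_add]
  rw [integral_add j2 j3]
  have e2 : ∫ z, fderiv ℝ (fun z => χ z * φ z) z v • f z
      = ∫ z, (φ z • (fderiv ℝ χ z v • f z) + fderiv ℝ φ z v • (χ z • f z)) := by
    refine integral_congr_ae (Eventually.of_forall fun z => ?_)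
    simp only
    rw [fderiv_fun_mul ((hχ.differentiable (by norm_num)) z) ((hφ1.differentiable (by norm_num)) z)]
    simp only [add_apply, smul_apply, smul_eq_mul]
    rw [add_smul, mul_smul, mul_smul, add_comm, smul_comm (χ z)]
  have e3 : ∫ z, (χ z * φ z) • g z = ∫ z, φ z • (χ z • g z) :=
    integral_congr_ae (Eventually.of_forall fun z => by simp only [mul_smul, smul_comm (χ z)])
  rw [e2, integral_add j3 j1, e3] at e1
  rw [eq_sub_of_add_eq' e1]
  ring

lemma HasWeakDeriv.sum {ι : Type*} (s : Finset ι) {f g : ι → SpaceTime d → ℂ} (hU : IsOpen U)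
    (h : ∀ i ∈ s, HasWeakDeriv U v (f i) (g i)) :
    HasWeakDeriv U v (fun z => ∑ i ∈ s, f i z) (fun z => ∑ i ∈ s, g i z) := by
  have hl : ∀ {k : ι → SpaceTime d → ℂ}, (∀ i ∈ s, LocallyIntegrableOn (k i) U) →
      LocallyIntegrableOn (fun z => ∑ i ∈ s, k i z) U := by
    intro k hk
    rw [locallyIntegrableOn_iff hU.isLocallyClosed]
    intro K hK hKc
    exact integrable_finsetSum _ fun i hi => (hk i hi).integrableOn_compact_subset hK hKc
  refine ⟨hl fun i hi => (h i hi).1, hl fun i hi => (h i hi).2.1, fun φ hφ hc hs => ?_⟩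
  have hφ1 : ContDiff ℝ 1 φ := hφ.of_le (by exact_mod_cast le_top)
  have ets : tsupport (fun z => fderiv ℝ φ z v) ⊆ U := (tsupport_fderiv_apply_subset ℝ v).trans hs
  simp only [Finset.smul_sum]
  rw [integral_finsetSum, integral_finsetSum, ← Finset.sum_neg_distrib]
  · exact Finset.sum_congr rfl fun i hi => (h i hi).2.2 φ hφ hc hs
  · exact fun i hi =>
      (integrable_smul_of_tsupport_subset hφ.continuous hc hs (h i hi).2.1).integrableOn
  · exact fun i hi => (integrable_smul_of_tsupport_subset
      (contDiff_fderiv_apply_const (m := 0) hφ1 (by norm_num) v).continuous (hc.fderiv_apply ℝ v) ets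
      (h i hi).1).integrableOn

/-- Mollification commutes with weak derivatives. -/
lemma HasWeakDeriv.fderiv_mollify (h : HasWeakDeriv univ v f g) (n : ℕ) (x : SpaceTime d) :
    fderiv ℝ (mollify n f) x v = mollify n g x := by
  have hf : LocallyIntegrable f := locallyIntegrableOn_univ.1 h.1
  set ρ := (mollifier (SpaceTime d) n).normed volume with hρ
  have hρc : HasCompactSupport ρ := (mollifier (SpaceTime d) n).hasCompactSupport_normed
  have hρC : ContDiff ℝ (⊤ : ℕ∞) ρ := (mollifier (SpaceTime d) n).contDiff_normed
  have hρ1 : ContDiff ℝ 1 ρ := hρC.of_le (by exact_mod_cast le_top)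
  have h1 := hρc.hasFDerivAt_convolution_left (ContinuousLinearMap.lsmul ℝ ℝ) hρ1 hf x
  have hex := (hρc.fderiv ℝ).convolutionExists_left
    ((ContinuousLinearMap.lsmul ℝ ℝ : ℝ →L[ℝ] ℂ →L[ℝ] ℂ).precompL (SpaceTime d))
    (hρ1.continuous_fderiv (by norm_num)) hf x
  have e1 : fderiv ℝ (mollify n f) x v = ∫ t, fderiv ℝ ρ t v • f (x - t) := by
    rw [mollify, h1.fderiv, convolution_def, ContinuousLinearMap.integral_apply hex]
    rfl
  have e2 : ∫ t, fderiv ℝ ρ t v • f (x - t) = ∫ t, fderiv ℝ ρ (x - t) v • f t := by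
    rw [← integral_sub_left_eq_self (fun t => fderiv ℝ ρ (x - t) v • f t) volume x]
    simp
  have hφC : ContDiff ℝ (⊤ : ℕ∞) (fun y => ρ (x - y)) := hρC.comp (contDiff_const.sub contDiff_id)
  have hφc : HasCompactSupport (fun y => ρ (x - y)) :=
    hρc.comp_homeomorph (Homeomorph.subLeft x)
  have hφd : ∀ y, fderiv ℝ (fun y => ρ (x - y)) y v = -fderiv ℝ ρ (x - y) v := by
    intro y
    have : HasFDerivAt (fun y => ρ (x - y)) ((fderiv ℝ ρ (x - y)).comp (-ContinuousLinearMap.id ℝ _)) y :=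
      ((hρ1.differentiable (by norm_num)) (x - y)).hasFDerivAt.comp y ((hasFDerivAt_id y).const_sub x)
    rw [this.fderiv]
    simp
  -- The reflected kernel `ρ(x - ·)` is itself an admissible test function.
  have e3 := h.2.2 (fun y => ρ (x - y)) hφC hφc (subset_univ _)
  simp only [Measure.restrict_univ, hφd, neg_smul, integral_neg, neg_inj] at e3
  rw [e1, e2, e3, mollify, convolution_lsmul_swap]

end WeakDeriv

/-! ### Carleman estimates for Sobolev functions -/

section L2Limits

variable {E : Type*} [NormedAddCommGroup E] [NormedSpace ℝ E] [FiniteDimensional ℝ E]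
  [MeasureSpace E] [BorelSpace E] [(volume : Measure E).IsAddHaarMeasure]

/-- Convergence in `L²`. -/
def TendstoL2 (F : ℕ → E → ℂ) (f : E → ℂ) : Prop :=
  (∀ n, MemLp (F n) 2) ∧ MemLp f 2 ∧ Tendsto (fun n => eLpNorm (F n - f) 2 volume) atTop (𝓝 0)

lemma TendstoL2.sum {ι : Type*} (s : Finset ι) {F : ι → ℕ → E → ℂ} {f : ι → E → ℂ}
    (h : ∀ i ∈ s, TendstoL2 (F i) (f i)) :
    TendstoL2 (fun n z => ∑ i ∈ s, F i n z) (fun z => ∑ i ∈ s, f i z) := by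
  refine ⟨fun n => memLp_finsetSum s fun i hi => (h i hi).1 n, memLp_finsetSum s fun i hi =>
    (h i hi).2.1, ?_⟩
  have h0 : Tendsto (fun n => ∑ i ∈ s, eLpNorm (F i n - f i) 2 volume) atTop (𝓝 0) := by
    simpa using tendsto_finsetSum s fun i hi => (h i hi).2.2
  refine tendsto_of_tendsto_of_tendsto_of_le_of_le tendsto_const_nhds h0 (fun n => zero_le)
    fun n => ?_
  have e : (fun z => ∑ i ∈ s, F i n z) - (fun z => ∑ i ∈ s, f i z) = ∑ i ∈ s, (F i n - f i) := by
    funext z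
    simp
  change eLpNorm ((fun z => ∑ i ∈ s, F i n z) - (fun z => ∑ i ∈ s, f i z)) 2 volume ≤ _
  rw [e]
  exact eLpNorm_sum_le (fun i hi => ((h i hi).1 n).1.sub (h i hi).2.1.1) (by norm_num)

lemma TendstoL2.add {F G : ℕ → E → ℂ} {f g : E → ℂ} (hF : TendstoL2 F f) (hG : TendstoL2 G g) :
    TendstoL2 (fun n z => F n z + G n z) (fun z => f z + g z) := by
  have := TendstoL2.sum (Finset.univ : Finset (Fin 2)) (F := ![F, G]) (f := ![f, g])
    fun i _ => by fin_cases i <;> simpa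
  simpa [Fin.sum_univ_two] using this

lemma MemLp.smul_of_continuous {f : E → ℂ} (hf : MemLp f 2) {a : E → ℝ} (ha : Continuous a)
    {K : Set E} (hK : IsCompact K) (hfK : ∀ z ∉ K, f z = 0) : MemLp (fun z => a z • f z) 2 := by
  obtain ⟨M, hM⟩ := hK.exists_bound_of_continuousOn ha.continuousOn
  refine hf.of_le_mul (c := M) (ha.aestronglyMeasurable.smul hf.1) (Eventually.of_forall fun z => ?_)
  by_cases hz : z ∈ K
  · rw [norm_smul]
    exact mul_le_mul_of_nonneg_right (hM z hz) (norm_nonneg _)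
  · rw [hfK z hz]
    simp

/-- Multipliers such as `e^{sφ}` are bounded on compact sets only, so all functions are required to
vanish outside a common `K`. -/
lemma TendstoL2.smul {F : ℕ → E → ℂ} {f : E → ℂ} (h : TendstoL2 F f) {a : E → ℝ}
    (ha : Continuous a) {K : Set E} (hK : IsCompact K) (hF : ∀ n, ∀ z ∉ K, F n z = 0)
    (hf : ∀ z ∉ K, f z = 0) : TendstoL2 (fun n z => a z • F n z) (fun z => a z • f z) := by
  refine ⟨fun n => MemLp.smul_of_continuous (h.1 n) ha hK (hF n),
    MemLp.smul_of_continuous h.2.1 ha hK hf, ?_⟩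
  obtain ⟨M, hM⟩ := hK.exists_bound_of_continuousOn ha.continuousOn
  have h0 : Tendsto (fun n => ENNReal.ofReal M * eLpNorm (F n - f) 2 volume) atTop (𝓝 0) := by
    simpa using ENNReal.Tendsto.const_mul h.2.2 (Or.inr ENNReal.ofReal_ne_top)
  refine tendsto_of_tendsto_of_tendsto_of_le_of_le tendsto_const_nhds h0 (fun n => zero_le)
    fun n => ?_
  refine eLpNorm_le_mul_eLpNorm_of_ae_le_mul (Eventually.of_forall fun z => ?_) 2
  simp only [Pi.sub_apply]
  by_cases hz : z ∈ K
  · rw [← smul_sub, norm_smul]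
    exact mul_le_mul_of_nonneg_right (hM z hz) (norm_nonneg _)
  · rw [hF n z hz, hf z hz]
    simp

lemma integral_norm_sq_eq_toReal {f : E → ℂ} (hf : MemLp f 2) :
    ∫ z, ‖f z‖ ^ 2 = (eLpNorm f 2 volume).toReal ^ 2 := by
  have h0 : 0 ≤ ∫ z, ‖f z‖ ^ 2 := integral_nonneg fun z => sq_nonneg _
  rw [hf.eLpNorm_eq_integral_rpow_norm (by norm_num) (by norm_num),
    ENNReal.toReal_ofReal (by positivity)]
  simp only [ENNReal.toReal_ofNat, Real.rpow_ofNat]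
  rw [← Real.rpow_natCast, ← Real.rpow_mul h0]
  norm_num

lemma TendstoL2.tendsto_integral {F : ℕ → E → ℂ} {f : E → ℂ} (h : TendstoL2 F f) :
    Tendsto (fun n => ∫ z, ‖F n z‖ ^ 2) atTop (𝓝 (∫ z, ‖f z‖ ^ 2)) := by
  have h1 : Tendsto (fun n => (h.1 n).toLp (F n)) atTop (𝓝 (h.2.1.toLp f)) :=
    (Lp.tendsto_Lp_iff_tendsto_eLpNorm'' _ h.1 f h.2.1).2 h.2.2
  have h2 := (h1.norm).pow 2
  simp only [Lp.norm_toLp] at h2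
  simpa only [integral_norm_sq_eq_toReal h.2.1, integral_norm_sq_eq_toReal (h.1 _)] using h2

lemma memLp_mollify {f : E → ℂ} (hf : MemLp f 2) (n : ℕ) : MemLp (mollify n f) 2 :=
  ⟨(contDiff_mollify (hf.locallyIntegrable (by norm_num)) (m := 0)).continuous.aestronglyMeasurable,
    (eLpNorm_mollify_le hf).trans_lt hf.2⟩

lemma tendstoL2_mollify {f : E → ℂ} (hf : MemLp f 2) (N : ℕ) :
    TendstoL2 (fun n => mollify (n + N) f) f :=
  ⟨fun _ => memLp_mollify hf _, hf, (tendsto_eLpNorm_mollify_sub hf).comp (tendsto_add_atTop_nat N)⟩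

end L2Limits

/-! ### From real to complex functions. -/

section ComplexCarleman

variable {E : Type*} [NormedAddCommGroup E] [NormedSpace ℝ E] [FiniteDimensional ℝ E]
  [MeasureSpace E] [BorelSpace E] [(volume : Measure E).IsAddHaarMeasure]
  {ι : Type*} [Fintype ι] {e : ι → E} {g : ι → ι → E → ℝ} {φ : E → ℝ}

lemma fderiv_clm_comp_apply {f : E → ℂ} (L : ℂ →L[ℝ] ℝ) {z : E} (hf : DifferentiableAt ℝ f z)
    (v : E) : fderiv ℝ (fun w => L (f w)) z v = L (fderiv ℝ f z v) := by
  have : HasFDerivAt (fun w => L (f w)) (L.comp (fderiv ℝ f z)) z :=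
    L.hasFDerivAt.comp z hf.hasFDerivAt
  rw [this.fderiv]
  rfl

/-- `∑ (g_{ij} ∂_i ∂_j f + ∂_i g_{ij} ∂_j f)`, in terms of the derivatives `f₁ j = ∂_j f` and
`f₂ j i = ∂_i ∂_j f`. -/
def divExpr (e : ι → E) (g : ι → ι → E → ℝ) (f₁ : ι → E → ℂ) (f₂ : ι → ι → E → ℂ) (z : E) : ℂ :=
  ∑ i, ∑ j, (g i j z • f₂ j i z + fderiv ℝ (g i j) z (e i) • f₁ j z)

/-- The operator has real coefficients, so it commutes with real-linear functionals, in particular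
with real and imaginary parts. -/
lemma divOp_clm_comp {f : E → ℂ} {f₁ : ι → E → ℂ} {f₂ : ι → ι → E → ℂ}
    (hg : ∀ i j, ContDiff ℝ 1 (g i j)) (hf : Differentiable ℝ f)
    (hf₁ : ∀ j, Differentiable ℝ (f₁ j)) (h₁ : ∀ j z, fderiv ℝ f z (e j) = f₁ j z)
    (h₂ : ∀ j i z, fderiv ℝ (f₁ j) z (e i) = f₂ j i z) (L : ℂ →L[ℝ] ℝ) (z : E) :
    divOp e g (fun w => L (f w)) z = L (divExpr e g f₁ f₂ z) := by
  have e1 : ∀ j w, fderiv ℝ (fun w => L (f w)) w (e j) = L (f₁ j w) := fun j w => by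
    rw [fderiv_clm_comp_apply L (hf w), h₁]
  unfold divOp divExpr
  simp only [e1, map_sum, map_add, map_smul, smul_eq_mul]
  refine Finset.sum_congr rfl fun i _ => ?_
  have dg : ∀ j, DifferentiableAt ℝ (g i j) z := fun j => (hg i j).differentiable (by norm_num) z
  have dL : ∀ j, DifferentiableAt ℝ (fun w => L (f₁ j w)) z := fun j =>
    L.differentiableAt.comp z (hf₁ j z)
  rw [fderiv_fun_sum fun j _ => (dg j).fun_mul (dL j), sum_apply]
  refine Finset.sum_congr rfl fun j _ => ?_
  rw [fderiv_fun_mul (dg j) (dL j)]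
  simp only [add_apply, smul_apply, smul_eq_mul]
  rw [fderiv_clm_comp_apply L (hf₁ j z), h₂, mul_comm (L (f₁ j z))]

lemma integrable_mul_clm_sq {ρ : E → ℝ} (hρ : Continuous ρ) {f : E → ℂ} (hf : Continuous f)
    (hc : HasCompactSupport f) (L : ℂ →L[ℝ] ℝ) : Integrable (fun z => ρ z * L (f z) ^ 2) := by
  refine Continuous.integrable_of_hasCompactSupport
    (hρ.mul ((L.continuous.comp hf).pow 2)) ?_
  refine HasCompactSupport.intro hc fun z hz => ?_
  rw [image_eq_zero_of_notMem_tsupport hz]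
  simp

lemma integral_mul_norm_sq {ρ : E → ℝ} (hρ : Continuous ρ) {f : E → ℂ} (hf : Continuous f)
    (hc : HasCompactSupport f) : ∫ z, ρ z * ‖f z‖ ^ 2
      = (∫ z, ρ z * Complex.reCLM (f z) ^ 2) + ∫ z, ρ z * Complex.imCLM (f z) ^ 2 := by
  rw [← integral_add (integrable_mul_clm_sq hρ hf hc _) (integrable_mul_clm_sq hρ hf hc _)]
  refine integral_congr_ae (Eventually.of_forall fun z => ?_)
  simp only [Complex.sq_norm, Complex.normSq_apply, Complex.reCLM_apply, Complex.imCLM_apply]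
  ring

/-- Real and imaginary parts satisfy the real estimate separately, and squared moduli add up. The
derivatives are passed as separate functions because for mollified Sobolev functions they arise as
mollified weak derivatives. -/
lemma carleman_complex {K : Set E} (hK : IsCompact K) (hg : ∀ i j, ContDiff ℝ 2 (g i j))
    (hφ : Continuous φ) {s C : ℝ}
    (hcar : ∀ v : E → ℝ, ContDiff ℝ 3 v → tsupport v ⊆ K →
      s * ∫ z, Real.exp (2 * s * φ z) * (∑ i, fderiv ℝ v z (e i) ^ 2 + v z ^ 2)
        ≤ C * ∫ z, Real.exp (2 * s * φ z) * divOp e g v z ^ 2)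
    {f : E → ℂ} {f₁ : ι → E → ℂ} {f₂ : ι → ι → E → ℂ} (hf : ContDiff ℝ 3 f) (hfK : tsupport f ⊆ K)
    (h₁ : ∀ j z, fderiv ℝ f z (e j) = f₁ j z) (h₂ : ∀ j i z, fderiv ℝ (f₁ j) z (e i) = f₂ j i z) :
    s * (∑ i, (∫ z, Real.exp (2 * s * φ z) * ‖f₁ i z‖ ^ 2)
        + ∫ z, Real.exp (2 * s * φ z) * ‖f z‖ ^ 2)
      ≤ C * ∫ z, Real.exp (2 * s * φ z) * ‖divExpr e g f₁ f₂ z‖ ^ 2 := by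
  obtain rfl : f₁ = fun j z => fderiv ℝ f z (e j) := by
    funext j z
    exact (h₁ j z).symm
  obtain rfl : f₂ = fun j i z => fderiv ℝ (fun w => fderiv ℝ f w (e j)) z (e i) := by
    funext j i z
    exact (h₂ j i z).symm
  have hg1 : ∀ i j, ContDiff ℝ 1 (g i j) := fun i j => (hg i j).of_le (by norm_num)
  have c1 : ∀ j, ContDiff ℝ 2 (fun z => fderiv ℝ f z (e j)) := fun j =>
    (hf.fderiv_right (m := 2) (by norm_num)).clm_apply contDiff_const
  have c2 : ∀ j i, ContDiff ℝ 1 (fun z => fderiv ℝ (fun w => fderiv ℝ f w (e j)) z (e i)) :=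
    fun j i => ((c1 j).fderiv_right (m := 1) (by norm_num)).clm_apply contDiff_const
  have t1 : ∀ j, tsupport (fun z => fderiv ℝ f z (e j)) ⊆ tsupport f := fun j =>
    tsupport_fderiv_apply_subset ℝ _
  have hc : HasCompactSupport f := hK.of_isClosed_subset (isClosed_tsupport f) hfK
  have hc1 : ∀ j, HasCompactSupport (fun z => fderiv ℝ f z (e j)) := fun j =>
    hc.fderiv_apply ℝ (e j)
  set P := divExpr e g (fun j z => fderiv ℝ f z (e j))
    (fun j i z => fderiv ℝ (fun w => fderiv ℝ f w (e j)) z (e i)) with hP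
  have hPc : Continuous P := by
    refine continuous_finsetSum _ fun i _ => continuous_finsetSum _ fun j _ => ?_
    exact ((hg i j).continuous.smul (c2 j i).continuous).add
      ((contDiff_fderiv_apply_const (m := 1) (hg i j) (by norm_num) _).continuous.smul
        (c1 j).continuous)
  have hPs : HasCompactSupport P := by
    refine HasCompactSupport.intro hc fun z hz => ?_
    refine Finset.sum_eq_zero fun i _ => Finset.sum_eq_zero fun j _ => ?_
    have z1 : fderiv ℝ f z (e j) = 0 :=
      image_eq_zero_of_notMem_tsupport (f := fun z => fderiv ℝ f z (e j)) fun h => hz (t1 j h)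
    have z2 : fderiv ℝ (fun w => fderiv ℝ f w (e j)) z (e i) = 0 :=
      image_eq_zero_of_notMem_tsupport
        (f := fun z => fderiv ℝ (fun w => fderiv ℝ f w (e j)) z (e i)) fun h =>
        hz (t1 j (tsupport_fderiv_apply_subset ℝ (f := fun w => fderiv ℝ f w (e j)) _ h))
    simp only [z1, z2, smul_zero, add_zero]
  have hρ : Continuous (fun z => Real.exp (2 * s * φ z)) :=
    Real.continuous_exp.comp (continuous_const.mul hφ)
  have part : ∀ L : ℂ →L[ℝ] ℝ,
      s * (∑ i, (∫ z, Real.exp (2 * s * φ z) * L (fderiv ℝ f z (e i)) ^ 2)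
        + ∫ z, Real.exp (2 * s * φ z) * L (f z) ^ 2)
      ≤ C * ∫ z, Real.exp (2 * s * φ z) * L (P z) ^ 2 := by
    intro L
    have := hcar (fun z => L (f z)) (L.contDiff.comp hf)
      ((closure_mono (Function.support_comp_subset (map_zero L) f)).trans hfK)
    have e1 : ∀ z, ∑ i, fderiv ℝ (fun w => L (f w)) z (e i) ^ 2 + L (f z) ^ 2
        = ∑ i, L (fderiv ℝ f z (e i)) ^ 2 + L (f z) ^ 2 := fun z => by
      congr 1
      refine Finset.sum_congr rfl fun i _ => ?_
      rw [fderiv_clm_comp_apply L (hf.differentiable (by norm_num) z)]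
    have e2 : ∀ z, divOp e g (fun w => L (f w)) z = L (P z) :=
      divOp_clm_comp hg1 (hf.differentiable (by norm_num))
        (fun j => (c1 j).differentiable (by norm_num)) (fun _ _ => rfl) (fun _ _ _ => rfl) L
    simp only [e1, e2, mul_add, Finset.mul_sum] at this
    rw [integral_add, integral_finsetSum] at this
    · exact this
    · exact fun i _ => integrable_mul_clm_sq hρ (c1 i).continuous (hc1 i) L
    · exact integrable_finsetSum _ fun i _ => integrable_mul_clm_sq hρ (c1 i).continuous (hc1 i) L
    · exact integrable_mul_clm_sq hρ hf.continuous hc L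
  have p1 := part Complex.reCLM
  have p2 := part Complex.imCLM
  rw [integral_mul_norm_sq hρ hf.continuous hc, integral_mul_norm_sq hρ hPc hPs,
    Finset.sum_congr rfl fun i _ => integral_mul_norm_sq hρ (c1 i).continuous (hc1 i),
    Finset.sum_add_distrib]
  linarith

end ComplexCarleman

/-! ### From smooth functions to functions with two weak derivatives in `L²`. -/

section WeakCarleman

variable {d : ℕ} {ι : Type*} [Fintype ι] {e : ι → SpaceTime d} {g : ι → ι → SpaceTime d → ℝ}
  {φ : SpaceTime d → ℝ}

lemma norm_exp_smul_sq (s x : ℝ) (w : ℂ) :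
    ‖Real.exp (s * x) • w‖ ^ 2 = Real.exp (2 * s * x) * ‖w‖ ^ 2 := by
  rw [norm_smul, Real.norm_of_nonneg (Real.exp_pos _).le, mul_pow, ← Real.exp_nat_mul]
  congr 2
  push_cast
  ring

/-- A Carleman estimate for test functions extends to functions with second weak derivatives in
`L²`. -/
lemma carleman_weak {z₀ : SpaceTime d} {r R : ℝ} (hr : 0 ≤ r) (hrR : r < R)
    (hg : ∀ i j, ContDiff ℝ 2 (g i j)) (hφ : Continuous φ) {s C : ℝ}
    (hcar : ∀ v : SpaceTime d → ℝ, ContDiff ℝ 3 v → tsupport v ⊆ Metric.closedBall z₀ R →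
      s * ∫ z, Real.exp (2 * s * φ z) * (∑ i, fderiv ℝ v z (e i) ^ 2 + v z ^ 2)
        ≤ C * ∫ z, Real.exp (2 * s * φ z) * divOp e g v z ^ 2)
    {v : SpaceTime d → ℂ} {v₁ : ι → SpaceTime d → ℂ} {v₂ : ι → ι → SpaceTime d → ℂ}
    (hv : MemLp v 2) (hv₁ : ∀ i, MemLp (v₁ i) 2) (hv₂ : ∀ i j, MemLp (v₂ i j) 2)
    (h₁ : ∀ i, HasWeakDeriv univ (e i) v (v₁ i))
    (h₂ : ∀ i j, HasWeakDeriv univ (e j) (v₁ i) (v₂ i j))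
    (z₁ : ∀ z ∉ Metric.closedBall z₀ r, v z = 0)
    (z₂ : ∀ i, ∀ z ∉ Metric.closedBall z₀ r, v₁ i z = 0)
    (z₃ : ∀ i j, ∀ z ∉ Metric.closedBall z₀ r, v₂ i j z = 0) :
    s * (∑ i, (∫ z, Real.exp (2 * s * φ z) * ‖v₁ i z‖ ^ 2)
        + ∫ z, Real.exp (2 * s * φ z) * ‖v z‖ ^ 2)
      ≤ C * ∫ z, Real.exp (2 * s * φ z) * ‖divExpr e g v₁ v₂ z‖ ^ 2 := by
  set K := Metric.closedBall z₀ R with hKdef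
  have hK : IsCompact K := isCompact_closedBall _ _
  have hrK : Metric.closedBall z₀ r ⊆ K := Metric.closedBall_subset_closedBall hrR.le
  -- The shift by `N` keeps every mollified function supported in the ball of radius `R`, where the
  -- estimate is available.
  obtain ⟨N, hN⟩ : ∃ N : ℕ, 1 / ((N : ℝ) + 1) < R - r :=
    exists_nat_one_div_lt (sub_pos.2 hrR)
  have hvan : ∀ w : SpaceTime d → ℂ, (∀ z ∉ Metric.closedBall z₀ r, w z = 0) →
      ∀ n, ∀ z ∉ K, mollify (n + N) w z = 0 := by
    intro w hw n z hz
    refine mollify_eq_zero hw fun h => hz ?_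
    have hn : 1 / (((n + N : ℕ) : ℝ) + 1) ≤ R - r := by
      refine le_trans ?_ hN.le
      apply one_div_le_one_div_of_le (by positivity)
      push_cast
      linarith [n.cast_nonneg (α := ℝ)]
    rw [cthickening_closedBall (by positivity) hr] at h
    exact Metric.closedBall_subset_closedBall (by linarith) h
  have hz : ∀ {w : SpaceTime d → ℂ}, (∀ z ∉ Metric.closedBall z₀ r, w z = 0) → ∀ z ∉ K, w z = 0 :=
    fun hw z hz => hw z fun h => hz (hrK h)
  have hE : Continuous (fun z => Real.exp (s * φ z)) :=
    Real.continuous_exp.comp (continuous_const.mul hφ)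
  -- Weighted integrals are squared `L²` norms of `e^{sφ}w`, so they converge. Two weak derivatives
  -- in `L²` are at hand, so the terms of the operator converge one by one and no commutator
  -- estimate is needed.
  have lim : ∀ {w : SpaceTime d → ℂ}, MemLp w 2 → (∀ z ∉ Metric.closedBall z₀ r, w z = 0) →
      Tendsto (fun n => ∫ z, Real.exp (2 * s * φ z) * ‖mollify (n + N) w z‖ ^ 2) atTop
        (𝓝 (∫ z, Real.exp (2 * s * φ z) * ‖w z‖ ^ 2)) := by
    intro w hw hw0
    have := ((tendstoL2_mollify hw N).smul hE hK (hvan w hw0) (hz hw0)).tendsto_integral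
    simpa only [norm_exp_smul_sq] using this
  have limP : Tendsto (fun n => ∫ z, Real.exp (2 * s * φ z) *
      ‖divExpr e g (fun i => mollify (n + N) (v₁ i)) (fun i j => mollify (n + N) (v₂ i j)) z‖ ^ 2)
      atTop (𝓝 (∫ z, Real.exp (2 * s * φ z) * ‖divExpr e g v₁ v₂ z‖ ^ 2)) := by
    have t : ∀ (w : SpaceTime d → ℂ), MemLp w 2 → (∀ z ∉ Metric.closedBall z₀ r, w z = 0) →
        ∀ a : SpaceTime d → ℝ, Continuous a → TendstoL2
          (fun n z => a z • mollify (n + N) w z) (fun z => a z • w z) := fun w hw hw0 a ha =>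
      (tendstoL2_mollify hw N).smul ha hK (hvan w hw0) (hz hw0)
    have cg : ∀ i j, Continuous (fun z => fderiv ℝ (g i j) z (e i)) := fun i j =>
      (contDiff_fderiv_apply_const (m := 1) (hg i j) (by norm_num) _).continuous
    have t1 : TendstoL2 (fun n z => divExpr e g (fun i => mollify (n + N) (v₁ i))
        (fun i j => mollify (n + N) (v₂ i j)) z) (divExpr e g v₁ v₂) :=
      TendstoL2.sum _ fun i _ => TendstoL2.sum _ fun j _ =>
        (t _ (hv₂ j i) (z₃ j i) _ (hg i j).continuous).add (t _ (hv₁ j) (z₂ j) _ (cg i j))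
    have p0 : ∀ (w₁ : ι → SpaceTime d → ℂ) (w₂ : ι → ι → SpaceTime d → ℂ) (z : SpaceTime d),
        (∀ i, w₁ i z = 0) → (∀ i j, w₂ i j z = 0) → divExpr e g w₁ w₂ z = 0 := by
      intro w₁ w₂ z hw₁ hw₂
      simp [divExpr, hw₁, hw₂]
    have := (t1.smul hE hK
      (fun n z hzK => p0 _ _ z (fun i => hvan _ (z₂ i) n z hzK) fun i j => hvan _ (z₃ i j) n z hzK)
      (fun z hzK => p0 _ _ z (fun i => hz (z₂ i) z hzK) fun i j => hz (z₃ i j) z hzK)).tendsto_integral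
    simpa only [norm_exp_smul_sq] using this
  refine le_of_tendsto_of_tendsto' (((tendsto_finsetSum _ fun i _ => lim (hv₁ i) (z₂ i)).add
    (lim hv z₁)).const_mul s) (limP.const_mul C) fun n => ?_
  refine carleman_complex hK hg hφ hcar
    (contDiff_mollify (hv.locallyIntegrable (by norm_num)) (m := 3)) ?_
    (fun j z => (h₁ j).fderiv_mollify _ z) (fun j i z => (h₂ j i).fderiv_mollify _ z)
  refine closure_minimal (fun z hz => ?_) hK.isClosed
  by_contra h
  exact hz (hvan v z₁ n z h)

end WeakCarleman

/-! ### Absorption -/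

/-- A family of weighted inequalities forces `N` to vanish where `Q ≤ D N`, when this holds on a
superlevel set of the weight. -/
lemma ae_eq_zero_of_weighted_le {X : Type*} [MeasurableSpace X] {μ : Measure X} {φ N Q : X → ℝ}
    {C D a s₀ : ℝ} (hφ : Measurable φ) (hN : ∀ z, 0 ≤ N z) (hQ : ∀ z, 0 ≤ Q z)
    (hC : 0 ≤ C) (iN : ∀ s, Integrable (fun z => Real.exp (2 * s * φ z) * N z) μ)
    (iQ : ∀ s, Integrable (fun z => Real.exp (2 * s * φ z) * Q z) μ)
    (h : ∀ s ≥ s₀, s * ∫ z, Real.exp (2 * s * φ z) * N z ∂μ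
      ≤ C * ∫ z, Real.exp (2 * s * φ z) * Q z ∂μ)
    (hD : ∀ᵐ z ∂μ, a < φ z → Q z ≤ D * N z) : ∀ᵐ z ∂μ, a < φ z → N z = 0 := by
  have iN0 : Integrable N μ := by simpa using iN 0
  have iQ0 : Integrable Q μ := by simpa using iQ 0
  set D' := max D 0 with hD'
  set S : Set X := {z | a < φ z} with hS
  have hSm : MeasurableSet S := measurableSet_lt measurable_const hφ
  have key : ∀ s : ℝ, max s₀ (2 * C * D' + 1) ≤ s →
      ∫ z in S, N z ∂μ ≤ 2 * C * (∫ z, Q z ∂μ) * s⁻¹ := by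
    intro s hs
    have hs1 : 2 * C * D' + 1 ≤ s := (le_max_right _ _).trans hs
    have hD0 : 0 ≤ D' := le_max_right _ _
    have hspos : 0 < s := by
      have : 0 ≤ 2 * C * D' := by positivity
      linarith
    -- On `{φ > a}` the source is bounded by `D'N`, to be absorbed on the left; elsewhere the
    -- exponential is at most `e^{2sa}`.
    have e1 : ∫ z, Real.exp (2 * s * φ z) * Q z ∂μ
        ≤ D' * (∫ z, Real.exp (2 * s * φ z) * N z ∂μ) + Real.exp (2 * s * a) * ∫ z, Q z ∂μ := by
      rw [← integral_const_mul, ← integral_const_mul, ← integral_add ((iN s).const_mul _)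
        (iQ0.const_mul _)]
      refine integral_mono_ae (iQ s) (((iN s).const_mul _).add (iQ0.const_mul _)) ?_
      filter_upwards [hD] with z hz
      have x0 := (Real.exp_pos (2 * s * φ z)).le
      have x1 := (Real.exp_pos (2 * s * a)).le
      by_cases hza : a < φ z
      · have h1 : Q z ≤ D' * N z :=
          (hz hza).trans (mul_le_mul_of_nonneg_right (le_max_left _ _) (hN z))
        have h2 := mul_le_mul_of_nonneg_left h1 x0
        have h3 := mul_nonneg x1 (hQ z)
        linarith
      · have h1 : Real.exp (2 * s * φ z) ≤ Real.exp (2 * s * a) :=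
          Real.exp_le_exp.2 (mul_le_mul_of_nonneg_left (not_lt.1 hza) (by positivity))
        have h2 := mul_le_mul_of_nonneg_right h1 (hQ z)
        have h3 := mul_nonneg hD0 (mul_nonneg x0 (hN z))
        linarith
    -- On `{φ > a}` the exponential is at least `e^{2sa}`. The two factors `e^{2sa}` cancel and
    -- leave a gain of `1/s`.
    have e2 : Real.exp (2 * s * a) * ∫ z in S, N z ∂μ ≤ ∫ z, Real.exp (2 * s * φ z) * N z ∂μ := by
      rw [← integral_const_mul]
      refine le_trans (setIntegral_mono_on (iN0.const_mul _).integrableOn (iN s).integrableOn hSm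
        fun z hz => ?_) (setIntegral_le_integral (iN s) (Eventually.of_forall fun z =>
          mul_nonneg (Real.exp_pos _).le (hN z)))
      refine mul_le_mul_of_nonneg_right (Real.exp_le_exp.2 ?_) (hN z)
      exact mul_le_mul_of_nonneg_left (le_of_lt hz) (by positivity)
    have e3 := h s ((le_max_left _ _).trans hs)
    set I := ∫ z, Real.exp (2 * s * φ z) * N z ∂μ with hI
    have hI0 : 0 ≤ I := integral_nonneg fun z => mul_nonneg (Real.exp_pos _).le (hN z)
    have e4 : s * I ≤ 2 * C * (Real.exp (2 * s * a) * ∫ z, Q z ∂μ) := by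
      have f1 := mul_le_mul_of_nonneg_left e1 hC
      have f2 : (2 * C * D') * I ≤ s * I := mul_le_mul_of_nonneg_right (by linarith) hI0
      linarith
    have e5 : Real.exp (2 * s * a) * (s * ∫ z in S, N z ∂μ)
        ≤ Real.exp (2 * s * a) * (2 * C * ∫ z, Q z ∂μ) := by
      have := mul_le_mul_of_nonneg_left e2 hspos.le
      linarith
    have e6 := le_of_mul_le_mul_left e5 (Real.exp_pos _)
    rw [← div_eq_mul_inv, le_div_iff₀ hspos]
    linarith
  have hlim : Tendsto (fun s : ℝ => 2 * C * (∫ z, Q z ∂μ) * s⁻¹) atTop (𝓝 0) := by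
    simpa using tendsto_inv_atTop_zero.const_mul (2 * C * ∫ z, Q z ∂μ)
  have h0 : ∫ z in S, N z ∂μ ≤ 0 := ge_of_tendsto hlim (eventually_atTop.2 ⟨_, key⟩)
  have h1 : ∫ z in S, N z ∂μ = 0 := le_antisymm h0 (integral_nonneg hN)
  rw [integral_eq_zero_iff_of_nonneg hN iN0.integrableOn, Filter.EventuallyEq,
    ae_restrict_iff' hSm] at h1
  exact h1

/-! ### The wave operator in terms of weak derivatives -/

section WaveOperator

variable {d : ℕ} {U : Set (SpaceTime d)} {u : SpaceTime d → ℂ}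
  {u₁ : Option (Fin (d + 1)) → SpaceTime d → ℂ}
  {u₂ : Option (Fin (d + 1)) → Option (Fin (d + 1)) → SpaceTime d → ℂ}
  {A : Eu (d + 1) → Matrix (Fin (d + 1)) (Fin (d + 1)) ℝ}

lemma MemH.exists_derivatives (hu : MemH U 2 u) :
    ∃ (u₁ : Option (Fin (d + 1)) → SpaceTime d → ℂ)
      (u₂ : Option (Fin (d + 1)) → Option (Fin (d + 1)) → SpaceTime d → ℂ),
      MemLp u 2 (volume.restrict U) ∧ (∀ i, MemLp (u₁ i) 2 (volume.restrict U)) ∧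
      (∀ i j, MemLp (u₂ i j) 2 (volume.restrict U)) ∧ (∀ i, HasWeakDeriv U (stDir i) u (u₁ i)) ∧
      ∀ i j, HasWeakDeriv U (stDir j) (u₁ i) (u₂ i j) := by
  obtain ⟨h0, h1⟩ := hu
  choose G hG hG' using h1
  choose G₂ hG₂ hG₂' using fun v => (hG' v).2
  exact ⟨fun i => G (stDir i), fun i j => G₂ (stDir i) (stDir j), h0, fun i => (hG' _).1,
    fun i j => hG₂' _ _, fun i => hG _, fun i j => hG₂ _ _⟩

/-- The wave operator, computed with given weak derivatives. -/
lemma waveOp_ae_eq (hU : IsOpen U) (hA : ∀ k l, ContDiffOn ℝ 1 (fun z => A z.1 k l) U)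
    (h₁ : ∀ i, HasWeakDeriv U (stDir i) u (u₁ i))
    (h₂ : ∀ i j, HasWeakDeriv U (stDir j) (u₁ i) (u₂ i j)) (q₀ : SpaceTime d → ℂ)
    (q : Fin (d + 1) → SpaceTime d → ℂ) (p : SpaceTime d → ℂ) :
    ∀ᵐ z ∂volume.restrict U, waveOp U A q₀ q p u z = divExpr stDir (stMat A) u₁ u₂ z
      + q₀ z * u₁ none z + ∑ j, q j z * u₁ (some j) z + p z * u z := by
  have w₁ : ∀ i, weakDeriv U (stDir i) u =ᵐ[volume.restrict U] u₁ i := fun i =>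
    weakDeriv_ae_eq hU (h₁ i)
  -- The outer derivative does not feel the choice of representative of the inner one, so the given
  -- version may be substituted.
  have wt : weakDeriv U dirT (weakDeriv U dirT u) =ᵐ[volume.restrict U] u₂ none none :=
    weakDeriv_ae_eq_of_ae_eq hU (h₂ none none) (w₁ none).symm
  have wx : ∀ l, weakDeriv U (dirX l)
      (fun w => ∑ k, (A w.1 l k : ℂ) * weakDeriv U (dirX k) u w) =ᵐ[volume.restrict U]
      fun z => ∑ k, (A z.1 l k • u₂ (some k) (some l) z
        + fderiv ℝ (fun w : SpaceTime d => A w.1 l k) z (dirX l) • u₁ (some k) z) := by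
    intro l
    refine weakDeriv_ae_eq_of_ae_eq hU (HasWeakDeriv.sum Finset.univ hU fun k _ =>
      (h₂ (some k) (some l)).smul hU (hA l k)) ?_
    have : ∀ᵐ z ∂volume.restrict U, ∀ k, weakDeriv U (dirX k) u z = u₁ (some k) z :=
      ae_all_iff.2 fun k => w₁ (some k)
    filter_upwards [this] with z hz
    simp only [hz, Complex.real_smul]
  filter_upwards [ae_all_iff.2 w₁, wt, ae_all_iff.2 wx] with z hz hzt hzx
  have hz0 : weakDeriv U dirT u z = u₁ none z := hz none
  have hzk : ∀ k, weakDeriv U (dirX k) u z = u₁ (some k) z := fun k => hz (some k)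
  unfold waveOp laplaceA
  simp only [hzt, hzx, hz0, hzk]
  congr 3
  unfold divExpr
  simp only [Fintype.sum_option, stMat, stDir]
  simp
  ring

lemma BoundedBy.ae_norm_le {M : ℝ} (hM : 0 ≤ M) {f : SpaceTime d → ℂ} (h : BoundedBy U M f) :
    ∀ᵐ z ∂volume.restrict U, ‖f z‖ ≤ M := by
  have h2 := h.2
  rw [eLpNorm_exponent_top] at h2
  filter_upwards [ae_le_eLpNormEssSup (f := f) (μ := volume.restrict U)] with z hz
  have := hz.trans h2
  rwa [← ofReal_norm, ENNReal.ofReal_le_ofReal_iff hM] at this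

/-- Functions whose time slices are supported in `{θ ≥ c}` vanish almost everywhere where
`θ < c`. -/
lemma ae_eq_zero_of_essSupport_subset {ω : Set (Eu (d + 1))} {J : Set ℝ} (hω : IsOpen ω)
    (hJ : IsOpen J) {θ : Eu (d + 1) → ℝ} (hθ : ContinuousOn θ ω) {c : ℝ}
    (hu : AEStronglyMeasurable u (volume.restrict (ω ×ˢ J)))
    (hs : ∀ᵐ t ∂volume.restrict J, essSupport ω (fun x => u (x, t)) ⊆ {x ∈ ω | c ≤ θ x}) :
    ∀ᵐ z : SpaceTime d, z ∈ (ω ∩ θ ⁻¹' Iio c) ×ˢ J → u z = 0 := by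
  set V := ω ∩ θ ⁻¹' Iio c with hV
  have hVo : IsOpen V := hθ.isOpen_inter_preimage hω isOpen_Iio
  have hVω : V ⊆ ω := inter_subset_left
  have hQm : MeasurableSet (ω ×ˢ J) := (hω.prod hJ).measurableSet
  -- Fubini applied to a measurable null set that contains the exceptional set, since the latter
  -- need not be measurable.
  have slices : ∀ {P : SpaceTime d → Prop}, (∀ᵐ z, P z) → ∀ᵐ t : ℝ, ∀ᵐ x, P (x, t) := by
    intro P hP
    have h1 : (volume : Measure (SpaceTime d)) (toMeasurable volume {z | ¬ P z}) = 0 := by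
      rw [measure_toMeasurable]
      exact hP
    rw [Measure.volume_eq_prod, Measure.prod_apply_symm (measurableSet_toMeasurable _ _),
      lintegral_eq_zero_iff (measurable_measure_prodMk_right (measurableSet_toMeasurable _ _))] at h1
    filter_upwards [h1] with t ht
    refine measure_mono_null (fun x hx => ?_) ht
    exact subset_toMeasurable _ _ hx
  -- A measurable representative is needed to pass from null slices back to a null set in
  -- space-time.
  set u' := hu.mk u with hu'
  have hu'm : StronglyMeasurable u' := hu.stronglyMeasurable_mk
  have huu : ∀ᵐ z, z ∈ ω ×ˢ J → u z = u' z := (ae_restrict_iff' hQm).1 hu.ae_eq_mk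
  have hsl : ∀ᵐ t : ℝ, t ∈ J → ∀ᵐ x, x ∈ V → u (x, t) = 0 := by
    filter_upwards [(ae_restrict_iff' hJ.measurableSet).1 hs] with t ht htJ
    have hsub := ht htJ
    -- Each point of `V` lies outside the essential support of the slice, so the slice vanishes
    -- almost everywhere near it. Countably many such neighbourhoods suffice.
    refine measure_null_of_locally_null _ fun x hx => ?_
    have hxV : x ∈ V := by
      by_contra h
      exact hx fun h' => absurd h' h
    have hxs : x ∉ essSupport ω (fun x => u (x, t)) := fun h => not_le.2 hxV.2 (hsub h).2
    have hN : ∃ N ∈ 𝓝 x, ∀ᵐ y ∂(volume.restrict (ω ∩ N)), u (y, t) = 0 := by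
      by_contra hcon
      exact hxs ⟨hVω hxV, fun N hN h => hcon ⟨N, hN, h⟩⟩
    obtain ⟨N, hN, hNu⟩ := hN
    obtain ⟨N', hN'N, hN'o, hxN'⟩ := mem_nhds_iff.1 hN
    refine ⟨{x | x ∈ V → u (x, t) = 0}ᶜ ∩ N', inter_mem_nhdsWithin _ (hN'o.mem_nhds hxN'), ?_⟩
    have h2 := ae_restrict_of_ae_restrict_of_subset
      (inter_subset_inter_right ω hN'N) hNu
    rw [ae_restrict_iff' (hω.inter hN'o).measurableSet] at h2
    refine measure_mono_null (fun y hy => ?_) h2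
    intro h3
    exact hy.1 fun hyV => h3 ⟨hVω hyV, hy.2⟩
  have hSm : MeasurableSet (V ×ˢ J ∩ {z | u' z ≠ 0}) :=
    (hVo.prod hJ).measurableSet.inter (hu'm.measurable (measurableSet_singleton 0)).compl
  have hS : (volume : Measure (SpaceTime d)) (V ×ˢ J ∩ {z | u' z ≠ 0}) = 0 := by
    rw [Measure.volume_eq_prod, Measure.prod_apply_symm hSm,
      lintegral_eq_zero_iff (measurable_measure_prodMk_right hSm)]
    filter_upwards [hsl, slices huu] with t ht1 ht2
    by_cases htJ : t ∈ J
    · change volume _ = 0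
      have : ∀ᵐ x, ¬ (x, t) ∈ V ×ˢ J ∩ {z | u' z ≠ 0} := by
        filter_upwards [ht1 htJ, ht2] with x hx1 hx2 hx3
        refine hx3.2 ?_
        rw [← hx2 ⟨hVω hx3.1.1, htJ⟩, hx1 hx3.1.1]
      exact measure_eq_zero_iff_ae_notMem.2 this
    · change volume _ = 0
      rw [show (fun x => (x, t)) ⁻¹' (V ×ˢ J ∩ {z | u' z ≠ 0}) = ∅ from ?_, measure_empty]
      ext x
      simp [htJ]
  have hS' : ∀ᵐ z : SpaceTime d, ¬ z ∈ V ×ˢ J ∩ {z | u' z ≠ 0} :=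
    measure_eq_zero_iff_ae_notMem.1 hS
  filter_upwards [hS', huu] with z hz1 hz2 hz3
  rw [hz2 ⟨hVω hz3.1, hz3.2⟩]
  by_contra h
  exact hz1 ⟨hz3, h⟩

end WaveOperator

/-! ### Local unique continuation -/

section LocalUniqueContinuation

variable {d : ℕ} {U V : Set (SpaceTime d)} {v : SpaceTime d} {f g f' g' : SpaceTime d → ℂ}

lemma HasWeakDeriv.add (hU : IsOpen U) (h : HasWeakDeriv U v f g) (h' : HasWeakDeriv U v f' g') :
    HasWeakDeriv U v (fun z => f z + f' z) (fun z => g z + g' z) := by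
  have := HasWeakDeriv.sum (Finset.univ : Finset (Fin 2)) (U := U) (v := v) (f := ![f, f'])
    (g := ![g, g']) hU fun i _ => by fin_cases i <;> simpa
  simpa [Fin.sum_univ_two] using this

/-- The cutoff is bounded and supported in `U`, so the product extends by zero from `U` to the whole
space within `L²`. -/
lemma MemLp.cutoff (hU : IsOpen U) (hf : MemLp f 2 (volume.restrict U)) {χ : SpaceTime d → ℝ}
    (hχ : Continuous χ) (hc : HasCompactSupport χ) (hs : tsupport χ ⊆ U) :
    MemLp (fun z => χ z • f z) 2 := by
  obtain ⟨M, hM⟩ := hc.exists_bound_of_continuous hχ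
  have h1 : MemLp (fun z => χ z • f z) 2 (volume.restrict U) :=
    hf.of_le_mul (c := M) (hχ.aestronglyMeasurable.smul hf.1) (Eventually.of_forall fun z => by
      rw [norm_smul]
      exact mul_le_mul_of_nonneg_right (hM z) (norm_nonneg _))
  have h2 := (memLp_indicator_iff_restrict hU.measurableSet).2 h1
  refine h2.ae_eq (Eventually.of_forall fun z => ?_)
  by_cases hz : z ∈ U
  · rw [indicator_of_mem hz]
  · change _ = χ z • f z
    rw [indicator_of_notMem hz, image_eq_zero_of_notMem_tsupport fun h => hz (hs h), zero_smul]

lemma integrable_exp_mul_norm_sq (hf : MemLp f 2) {φ : SpaceTime d → ℝ} (hφ : Continuous φ)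
    {K : Set (SpaceTime d)} (hK : IsCompact K) (hfK : ∀ z ∉ K, f z = 0) (s : ℝ) :
    Integrable (fun z => Real.exp (2 * s * φ z) * ‖f z‖ ^ 2) := by
  have := (MemLp.smul_of_continuous hf (a := fun z => Real.exp (s * φ z))
    (Real.continuous_exp.comp (continuous_const.mul hφ)) hK hfK).integrable_norm_pow (by norm_num)
  simpa only [norm_exp_smul_sq] using this

lemma memLp_divExpr {ι : Type*} [Fintype ι] {e : ι → SpaceTime d} {g : ι → ι → SpaceTime d → ℝ}
    {v₁ : ι → SpaceTime d → ℂ} {v₂ : ι → ι → SpaceTime d → ℂ} (hg : ∀ i j, ContDiff ℝ 2 (g i j))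
    {K : Set (SpaceTime d)} (hK : IsCompact K) (hv₁ : ∀ i, MemLp (v₁ i) 2)
    (hv₂ : ∀ i j, MemLp (v₂ i j) 2) (z₁ : ∀ i, ∀ z ∉ K, v₁ i z = 0)
    (z₂ : ∀ i j, ∀ z ∉ K, v₂ i j z = 0) : MemLp (divExpr e g v₁ v₂) 2 := by
  have cg : ∀ i j, Continuous (fun z => fderiv ℝ (g i j) z (e i)) := fun i j =>
    (contDiff_fderiv_apply_const (m := 1) (hg i j) (by norm_num) _).continuous
  exact memLp_finsetSum _ fun i _ => memLp_finsetSum _ fun j _ =>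
    (MemLp.smul_of_continuous (hv₂ j i) (hg i j).continuous hK (z₂ j i)).add
      (MemLp.smul_of_continuous (hv₁ j) (cg i j) hK (z₁ j))

lemma divExpr_eq_zero {ι : Type*} [Fintype ι] {e : ι → SpaceTime d} {g : ι → ι → SpaceTime d → ℝ}
    {v₁ : ι → SpaceTime d → ℂ} {v₂ : ι → ι → SpaceTime d → ℂ} {z : SpaceTime d}
    (z₁ : ∀ i, v₁ i z = 0) (z₂ : ∀ i j, v₂ i j z = 0) : divExpr e g v₁ v₂ z = 0 := by
  simp [divExpr, z₁, z₂]

/-- A function which satisfies a differential inequality and vanishes where the weight is large,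
away from the centre of a ball, vanishes near the centre. -/
theorem ae_eq_zero_of_carleman {ι : Type*} [Fintype ι] {e : ι → SpaceTime d}
    {g : ι → ι → SpaceTime d → ℝ} {φ : SpaceTime d → ℝ} {z₀ : SpaceTime d} {r R s₀ C a M : ℝ}
    (hr : 0 < r) (hrR : r < R) (hg : ∀ i j, ContDiff ℝ 2 (g i j)) (hφ : Continuous φ) (hC : 0 ≤ C)
    (hcar : ∀ s ≥ s₀, ∀ v : SpaceTime d → ℝ, ContDiff ℝ 3 v → tsupport v ⊆ Metric.closedBall z₀ R →
      s * ∫ z, Real.exp (2 * s * φ z) * (∑ i, fderiv ℝ v z (e i) ^ 2 + v z ^ 2)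
        ≤ C * ∫ z, Real.exp (2 * s * φ z) * divOp e g v z ^ 2)
    (hU : IsOpen U) (hrU : Metric.closedBall z₀ r ⊆ U)
    {u : SpaceTime d → ℂ} {u₁ : ι → SpaceTime d → ℂ} {u₂ : ι → ι → SpaceTime d → ℂ}
    (hu : MemLp u 2 (volume.restrict U)) (hu₁ : ∀ i, MemLp (u₁ i) 2 (volume.restrict U))
    (hu₂ : ∀ i j, MemLp (u₂ i j) 2 (volume.restrict U)) (h₁ : ∀ i, HasWeakDeriv U (e i) u (u₁ i))
    (h₂ : ∀ i j, HasWeakDeriv U (e j) (u₁ i) (u₂ i j))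
    (hdiv : ∀ᵐ z, z ∈ Metric.ball z₀ (r / 2) →
      ‖divExpr e g u₁ u₂ z‖ ≤ M * (∑ i, ‖u₁ i z‖ + ‖u z‖))
    (hV : IsOpen V) (hVU : V ⊆ U) (huV : ∀ᵐ z, z ∈ V → u z = 0)
    (hcov : ∀ z ∈ Metric.closedBall z₀ r, a < φ z → z ∈ V ∨ z ∈ Metric.ball z₀ (r / 2)) :
    ∀ᵐ z, z ∈ Metric.ball z₀ (r / 2) → a < φ z → u z = 0 := by
  set K := Metric.closedBall z₀ r with hKdef
  have hK : IsCompact K := isCompact_closedBall _ _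
  let χ : ContDiffBump z₀ := ⟨r / 2, r, by positivity, by linarith⟩
  have hχC : ContDiff ℝ 3 χ := χ.contDiff (n := 3)
  have hχ1C : ∀ i, ContDiff ℝ 2 (fun z => fderiv ℝ χ z (e i)) := fun i =>
    (hχC.fderiv_right (m := 2) (by norm_num)).clm_apply contDiff_const
  have hχ2C : ∀ i j, ContDiff ℝ 1 (fun z => fderiv ℝ (fun w => fderiv ℝ χ w (e i)) z (e j)) :=
    fun i j => ((hχ1C i).fderiv_right (m := 1) (by norm_num)).clm_apply contDiff_const
  have hχc : HasCompactSupport χ := χ.hasCompactSupport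
  have hχ1c : ∀ i, HasCompactSupport (fun z => fderiv ℝ χ z (e i)) := fun i =>
    hχc.fderiv_apply ℝ (e i)
  have hχ2c : ∀ i j, HasCompactSupport (fun z => fderiv ℝ (fun w => fderiv ℝ χ w (e i)) z (e j)) :=
    fun i j => (hχ1c i).fderiv_apply ℝ (e j)
  have tχ : tsupport χ = K := χ.tsupport_eq
  have tχ1 : ∀ i, tsupport (fun z => fderiv ℝ χ z (e i)) ⊆ K := fun i =>
    (tsupport_fderiv_apply_subset ℝ _).trans tχ.subset
  have tχ2 : ∀ i j, tsupport (fun z => fderiv ℝ (fun w => fderiv ℝ χ w (e i)) z (e j)) ⊆ K :=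
    fun i j => (tsupport_fderiv_apply_subset ℝ _).trans (tχ1 i)
  -- the localized function and its weak derivatives
  set v : SpaceTime d → ℂ := fun z => χ z • u z with hv
  set v₁ : ι → SpaceTime d → ℂ := fun i z => χ z • u₁ i z + fderiv ℝ χ z (e i) • u z with hv₁
  -- Leibniz expansion of `∂_j(χ u_i + χ_i u)`, where `u_i` and `χ_i` denote first derivatives.
  set v₂ : ι → ι → SpaceTime d → ℂ := fun i j z =>
    (χ z • u₂ i j z + fderiv ℝ χ z (e j) • u₁ i z) + (fderiv ℝ χ z (e i) • u₁ j z
      + fderiv ℝ (fun w => fderiv ℝ χ w (e i)) z (e j) • u z) with hv₂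
  have mv : MemLp v 2 := MemLp.cutoff hU hu hχC.continuous hχc (tχ.subset.trans hrU)
  have mv₁ : ∀ i, MemLp (v₁ i) 2 := fun i =>
    (MemLp.cutoff hU (hu₁ i) hχC.continuous hχc (tχ.subset.trans hrU)).add
      (MemLp.cutoff hU hu (hχ1C i).continuous (hχ1c i) ((tχ1 i).trans hrU))
  have mv₂ : ∀ i j, MemLp (v₂ i j) 2 := fun i j =>
    ((MemLp.cutoff hU (hu₂ i j) hχC.continuous hχc (tχ.subset.trans hrU)).add
      (MemLp.cutoff hU (hu₁ i) (hχ1C j).continuous (hχ1c j) ((tχ1 j).trans hrU))).add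
    ((MemLp.cutoff hU (hu₁ j) (hχ1C i).continuous (hχ1c i) ((tχ1 i).trans hrU)).add
      (MemLp.cutoff hU hu (hχ2C i j).continuous (hχ2c i j) ((tχ2 i j).trans hrU)))
  have d₁ : ∀ i, HasWeakDeriv univ (e i) v (v₁ i) := fun i =>
    (h₁ i).cutoff hU (hχC.of_le (by norm_num)) hχc (tχ.subset.trans hrU)
  have d₂ : ∀ i j, HasWeakDeriv univ (e j) (v₁ i) (v₂ i j) := fun i j =>
    ((h₂ i j).cutoff hU (hχC.of_le (by norm_num)) hχc (tχ.subset.trans hrU)).add isOpen_univ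
      ((h₁ j).cutoff hU ((hχ1C i).of_le (by norm_num)) (hχ1c i) ((tχ1 i).trans hrU))
  have o0 : ∀ z ∉ K, χ z = 0 := fun z hz => image_eq_zero_of_notMem_tsupport (tχ ▸ hz)
  have o1 : ∀ i, ∀ z ∉ K, fderiv ℝ χ z (e i) = 0 := fun i z hz =>
    image_eq_zero_of_notMem_tsupport (f := fun z => fderiv ℝ χ z (e i)) fun h => hz (tχ1 i h)
  have o2 : ∀ i j, ∀ z ∉ K, fderiv ℝ (fun w => fderiv ℝ χ w (e i)) z (e j) = 0 := fun i j z hz =>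
    image_eq_zero_of_notMem_tsupport
      (f := fun z => fderiv ℝ (fun w => fderiv ℝ χ w (e i)) z (e j)) fun h => hz (tχ2 i j h)
  have ov : ∀ z ∉ K, v z = 0 := fun z hz => by simp [hv, o0 z hz]
  have ov₁ : ∀ i, ∀ z ∉ K, v₁ i z = 0 := fun i z hz => by simp [hv₁, o0 z hz, o1 i z hz]
  have ov₂ : ∀ i j, ∀ z ∉ K, v₂ i j z = 0 := fun i j z hz => by
    simp [hv₂, o0 z hz, o1 i z hz, o1 j z hz, o2 i j z hz]
  -- inside the smaller ball nothing has changed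
  have hin : ∀ z ∈ Metric.ball z₀ (r / 2), v z = u z ∧ (∀ i, v₁ i z = u₁ i z) ∧
      ∀ i j, v₂ i j z = u₂ i j z := by
    intro z hz
    have c0 : (χ : SpaceTime d → ℝ) =ᶠ[𝓝 z] fun _ => 1 := by
      filter_upwards [Metric.isOpen_ball.mem_nhds hz] with w hw
      exact χ.one_of_mem_closedBall (Metric.ball_subset_closedBall hw)
    have c1 : ∀ i, (fun w => fderiv ℝ χ w (e i)) =ᶠ[𝓝 z] fun _ => 0 := by
      intro i
      filter_upwards [c0.eventuallyEq_nhds] with w hw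
      rw [hw.fderiv_eq]
      simp
    have c0' : χ z = 1 := c0.eq_of_nhds
    have c1' : ∀ i, fderiv ℝ χ z (e i) = 0 := fun i => (c1 i).eq_of_nhds
    have c2' : ∀ i j, fderiv ℝ (fun w => fderiv ℝ χ w (e i)) z (e j) = 0 := fun i j => by
      rw [(c1 i).fderiv_eq]
      simp
    refine ⟨by simp [hv, c0'], fun i => by simp [hv₁, c0', c1'], fun i j => ?_⟩
    simp [hv₂, c0', c1', c2']
  have hzero : ∀ᵐ z, z ∈ V → v z = 0 ∧ (∀ i, v₁ i z = 0) ∧ ∀ i j, v₂ i j z = 0 := by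
    have a1 : ∀ i, ∀ᵐ z, z ∈ V → u₁ i z = 0 := fun i => (h₁ i).ae_eq_zero hU hV hVU huV
    have a2 : ∀ i j, ∀ᵐ z, z ∈ V → u₂ i j z = 0 := fun i j =>
      (h₂ i j).ae_eq_zero hU hV hVU (a1 i)
    filter_upwards [huV, ae_all_iff.2 a1, ae_all_iff.2 fun i => ae_all_iff.2 (a2 i)]
      with z b0 b1 b2 hz
    refine ⟨by simp [hv, b0 hz], fun i => by simp [hv₁, b0 hz, b1 i hz], fun i j => ?_⟩
    simp [hv₂, b0 hz, b1 i hz, b1 j hz, b2 i j hz]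
  set P := divExpr e g v₁ v₂ with hP
  have mP : MemLp P 2 := memLp_divExpr hg hK mv₁ mv₂ ov₁ ov₂
  have oP : ∀ z ∉ K, P z = 0 := fun z hz =>
    divExpr_eq_zero (fun i => ov₁ i z hz) fun i j => ov₂ i j z hz
  set N : SpaceTime d → ℝ := fun z => ∑ i, ‖v₁ i z‖ ^ 2 + ‖v z‖ ^ 2 with hN
  have hN0 : ∀ z, 0 ≤ N z := fun z => by positivity
  have i1 : ∀ i s, Integrable (fun z => Real.exp (2 * s * φ z) * ‖v₁ i z‖ ^ 2) := fun i s =>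
    integrable_exp_mul_norm_sq (mv₁ i) hφ hK (ov₁ i) s
  have i2 : ∀ s, Integrable (fun z => Real.exp (2 * s * φ z) * ‖v z‖ ^ 2) := fun s =>
    integrable_exp_mul_norm_sq mv hφ hK ov s
  have iN : ∀ s, Integrable (fun z => Real.exp (2 * s * φ z) * N z) := by
    intro s
    simp only [hN, mul_add, Finset.mul_sum]
    exact (integrable_finsetSum _ fun i _ => i1 i s).add (i2 s)
  -- From `(a + b)² ≤ 2a² + 2b²` and the Cauchy–Schwarz bound for the sum of the first derivatives.
  set D : ℝ := M ^ 2 * (2 * Fintype.card ι + 2) with hD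
  have hD0 : 0 ≤ D := by positivity
  have final := ae_eq_zero_of_weighted_le (μ := volume) (φ := φ) (N := N) (Q := fun z => ‖P z‖ ^ 2)
    (C := C) (D := D) (a := a) (s₀ := s₀) hφ.measurable hN0 (fun z => sq_nonneg _) hC iN
    (fun s => integrable_exp_mul_norm_sq mP hφ hK oP s) ?_ ?_
  · filter_upwards [final] with z hz hzb hza
    have h0 := hz hza
    have h1 : ‖v z‖ ^ 2 ≤ 0 := by
      rw [← h0]
      exact le_add_of_nonneg_left (Finset.sum_nonneg fun i _ => sq_nonneg _)
    rw [← (hin z hzb).1]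
    exact norm_eq_zero.1 (pow_eq_zero_iff (two_ne_zero) |>.1 (le_antisymm h1 (sq_nonneg _)))
  · intro s hs
    have := carleman_weak hr.le hrR hg hφ (hcar s hs) mv mv₁ mv₂ d₁ d₂ ov ov₁ ov₂
    simp only [hN, mul_add, Finset.mul_sum]
    rw [integral_add (integrable_finsetSum _ fun i _ => i1 i s) (i2 s),
      integral_finsetSum _ fun i _ => i1 i s]
    exact this
  · filter_upwards [hzero, hdiv] with z b1 b2 hza
    by_cases hzK : z ∈ K
    · rcases hcov z hzK hza with hzV | hzb
      · obtain ⟨-, e1, e2⟩ := b1 hzV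
        rw [hP, divExpr_eq_zero e1 e2]
        simpa using mul_nonneg hD0 (hN0 z)
      · obtain ⟨e0, e1, e2⟩ := hin z hzb
        have hPz : P z = divExpr e g u₁ u₂ z := by
          rw [hP]
          simp only [divExpr, e1, e2]
        have k1 := b2 hzb
        have k2 : (∑ i, ‖u₁ i z‖) ^ 2 ≤ Fintype.card ι * ∑ i, ‖u₁ i z‖ ^ 2 :=
          sq_sum_le_card_mul_sum_sq
        have k3 : (0 : ℝ) ≤ ∑ i, ‖u₁ i z‖ ^ 2 := Finset.sum_nonneg fun i _ => sq_nonneg _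
        simp only [hN, e0, e1, hPz]
        calc ‖divExpr e g u₁ u₂ z‖ ^ 2 ≤ (M * (∑ i, ‖u₁ i z‖ + ‖u z‖)) ^ 2 :=
              pow_le_pow_left₀ (norm_nonneg _) k1 2
          _ ≤ M ^ 2 * (2 * (∑ i, ‖u₁ i z‖) ^ 2 + 2 * ‖u z‖ ^ 2) := by
              rw [mul_pow]
              refine mul_le_mul_of_nonneg_left ?_ (sq_nonneg _)
              nlinarith [sq_nonneg (∑ i, ‖u₁ i z‖ - ‖u z‖)]
          _ ≤ D * (∑ i, ‖u₁ i z‖ ^ 2 + ‖u z‖ ^ 2) := by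
              rw [hD, mul_assoc]
              refine mul_le_mul_of_nonneg_left ?_ (sq_nonneg _)
              have k4 : (0 : ℝ) ≤ Fintype.card ι * ‖u z‖ ^ 2 := by positivity
              nlinarith
    · simp only [oP z hzK, norm_zero]
      have := mul_nonneg hD0 (hN0 z)
      simpa using this

end LocalUniqueContinuation

/-! ### The geometry of the weight -/

section Geometry

variable {d : ℕ}

lemma divExpr_congr {ι : Type*} [Fintype ι] {e : ι → SpaceTime d} {g g' : ι → ι → SpaceTime d → ℝ}
    {v₁ : ι → SpaceTime d → ℂ} {v₂ : ι → ι → SpaceTime d → ℂ} {z : SpaceTime d}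
    (hg : ∀ i j, g i j =ᶠ[𝓝 z] g' i j) : divExpr e g v₁ v₂ z = divExpr e g' v₁ v₂ z := by
  refine Finset.sum_congr rfl fun i _ => Finset.sum_congr rfl fun j _ => ?_
  rw [(hg i j).eq_of_nhds, (hg i j).fderiv_eq]

/-- A continuous function which is `< 1` on the side `θ ≥ θ(x̃)` of a small ball, except at the
centre, is bounded away from `1` there outside a smaller ball. -/
lemma exists_level {ω : Set (Eu (d + 1))} {θ : Eu (d + 1) → ℝ} {z₀ : SpaceTime d} {r c : ℝ}
    {φ : SpaceTime d → ℝ} (hr : 0 < r) (hθ : ContinuousOn θ ω) (hφ : Continuous φ)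
    (hω : ∀ z ∈ Metric.closedBall z₀ r, z.1 ∈ ω)
    (hlt : ∀ z ∈ Metric.closedBall z₀ r, c ≤ θ z.1 → z ≠ z₀ → φ z < 1) :
    ∃ a < 1, ∀ z ∈ Metric.closedBall z₀ r, a < φ z → θ z.1 < c ∨ z ∈ Metric.ball z₀ (r / 2) := by
  have hK : IsCompact (Metric.closedBall z₀ r) := isCompact_closedBall _ _
  have hθ' : ContinuousOn (fun z : SpaceTime d => θ z.1) (Metric.closedBall z₀ r) :=
    hθ.comp continuous_fst.continuousOn hω
  set S := (Metric.closedBall z₀ r ∩ (fun z : SpaceTime d => θ z.1) ⁻¹' Ici c)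
    ∩ (Metric.ball z₀ (r / 2))ᶜ with hS
  have hSc : IsCompact S :=
    (hK.of_isClosed_subset (hθ'.preimage_isClosed_of_isClosed Metric.isClosed_closedBall isClosed_Ici)
      inter_subset_left).inter_right Metric.isOpen_ball.isClosed_compl
  obtain ⟨a, ha, haS⟩ : ∃ a < 1, ∀ z ∈ S, φ z ≤ a := by
    rcases S.eq_empty_or_nonempty with h | h
    · exact ⟨0, one_pos, by simp [h]⟩
    · obtain ⟨w, hw, hmax⟩ := hSc.exists_isMaxOn h hφ.continuousOn
      refine ⟨φ w, hlt w hw.1.1 hw.1.2 ?_, fun z hz => hmax hz⟩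
      rintro rfl
      exact hw.2 (Metric.mem_ball_self (by positivity))
  refine ⟨a, ha, fun z hz haz => ?_⟩
  by_contra hcon
  push Not at hcon
  exact absurd (haS z ⟨⟨hz, hcon.1⟩, hcon.2⟩) (not_le.2 haz)

end Geometry

end WaveUC

end

/-! ### Assembly of the weight, the Carleman estimate and the localization. -/

theorem mainTheorem5 (d : ℕ) (hd : 1 ≤ d)
    (Ω : Set (Eu (d + 1))) (hΩ : IsOpen Ω)
    (ϰ 𝔪 : ℝ) (hϰ : 1 ≤ ϰ) (h𝔪 : 0 < 𝔪)
    (A : Eu (d + 1) → Matrix (Fin (d + 1)) (Fin (d + 1)) ℝ) (hA : IsAdmissible Ω ϰ 𝔪 A)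
    (ω : Set (Eu (d + 1))) (hω : IsOpen ω) (hωΩ : ω ⊆ Ω)
    (xt : Eu (d + 1)) (hxt : xt ∈ ω)
    (θ : Eu (d + 1) → ℝ) (hθ : IsCkOneOn 3 ω θ)
    (hH : IsPseudoConvexHypersurface A ω θ xt) :
    ∃ B : Set (Eu (d + 1)), IsOpen B ∧ xt ∈ B ∧ B ⊆ ω ∧
      ∃ T₀ : ℝ, 0 < T₀ ∧ ∀ T : ℝ, T₀ ≤ T →
        ∃ τ : ℝ, 0 < τ ∧ τ ≤ T ∧
          ∀ (q₀ : SpaceTime d → ℂ) (q : Fin (d + 1) → SpaceTime d → ℂ) (p : SpaceTime d → ℂ),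
            BoundedBy (Ω ×ˢ Ioo (-T) T) 𝔪 q₀ →
            (∀ j, BoundedBy (Ω ×ˢ Ioo (-T) T) 𝔪 (q j)) →
            BoundedBy (Ω ×ˢ Ioo (-T) T) 𝔪 p →
            ∀ u : SpaceTime d → ℂ,
              MemH (ω ×ˢ Ioo (-T) T) 2 u →
              (∀ᵐ z ∂(volume.restrict (ω ×ˢ Ioo (-T) T)),
                waveOp (ω ×ˢ Ioo (-T) T) A q₀ q p u z = 0) →
              (∀ᵐ t ∂(volume.restrict (Ioo (-T) T)),
                essSupport ω (fun x => u (x, t)) ⊆ {x ∈ ω | θ xt ≤ θ x}) →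
              ∀ᵐ z ∂(volume.restrict (B ×ˢ Ioo (-τ) τ)), u z = 0 := by
  have hA2 : ∀ k l, ContDiffOn ℝ 2 (entries A k l) ω := fun k l => (hA.regular k l).1.mono hωΩ
  have hAs : ∀ x ∈ ω, (A x).IsSymm := fun x hx => hA.symm x (hωΩ hx)
  obtain ⟨h, hh, hh1, hh0, hΘ, hside⟩ := exists_weight hω hxt hAs hA2 hθ.1 hH
  obtain ⟨γ, hγ, g, φ, μ, c, R₀, hg, hgs, hφ, hc, hR₀, hball⟩ := exists_carleman_data hω hxt hϰ hAs
    (hA.lower xt (hωΩ hxt)) (hA.upper xt (hωΩ hxt)) hA2 hh hh0 hΘ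
  obtain ⟨δ, hδ, hδω⟩ := Metric.mem_nhds_iff.1 (Filter.inter_mem (hω.mem_nhds hxt) hside)
  set z₀ : SpaceTime d := (xt, 0) with hz₀
  -- `R < R₀` keeps the positivity of the forms and `R < δ` the peak property of `h`. The cutoff
  -- lives in the ball of radius `r = R/2`, which leaves room for mollification.
  obtain ⟨R, hR, hRR₀, hRδ⟩ : ∃ R > 0, R < R₀ ∧ R < δ :=
    ⟨min R₀ δ / 2, by positivity, by linarith [min_le_left R₀ δ], by linarith [min_le_right R₀ δ]⟩
  have hKball : Metric.closedBall z₀ R ⊆ Metric.ball z₀ R₀ := Metric.closedBall_subset_ball hRR₀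
  obtain ⟨C, hC, s₀, -, hcar⟩ := carleman_estimate (isCompact_closedBall z₀ R) hg hgs hφ hc
    (fun z hz => (hball z (hKball hz)).2.2.1) (fun z hz => (hball z (hKball hz)).2.2.2)
  set r := R / 2 with hr
  have hr0 : 0 < r := by positivity
  have hrR : r < R := by
    rw [hr]
    linarith
  have hfst : ∀ z ∈ Metric.closedBall z₀ r, z.1 ∈ Metric.ball xt δ := by
    intro z hz
    rw [Metric.mem_closedBall, Prod.dist_eq] at hz
    exact ((le_max_left _ _).trans hz).trans_lt (hrR.trans hRδ)
  have hφh : ∀ z ∈ Metric.closedBall z₀ r, φ z = h z.1 - γ * z.2 ^ 2 := fun z hz =>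
    (hball z (hKball (Metric.closedBall_subset_closedBall hrR.le hz))).2.1
  obtain ⟨a, ha, hcov⟩ := exists_level (c := θ xt) hr0 hθ.1.continuousOn hφ.continuous
    (fun z hz => (hδω (hfst z hz)).1) (by
      intro z hz hzθ hne
      rw [hφh z hz]
      by_cases hz1 : z.1 = xt
      · have hz2 : z.2 ≠ 0 := fun h2 => hne (Prod.ext hz1 h2)
        have : 0 < γ * z.2 ^ 2 := by positivity
        rw [hz1, hh1]
        linarith
      · have h1 : h z.1 < 1 := (hδω (hfst z hz)).2 hzθ hz1
        have : 0 ≤ γ * z.2 ^ 2 := by positivity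
        linarith)
  have hφ0 : φ z₀ = 1 := by
    rw [hφh z₀ (Metric.mem_closedBall_self hr0.le)]
    simp [hz₀, hh1]
  obtain ⟨ε, hε, hεφ⟩ := Metric.mem_nhds_iff.1
    (hφ.continuous.continuousAt.eventually (lt_mem_nhds (a := a) (by rwa [hφ0])))
  obtain ⟨σ, hσ, hσε, hσr⟩ : ∃ σ > 0, σ ≤ ε ∧ σ ≤ r / 2 :=
    ⟨min ε (r / 2), by positivity, min_le_left _ _, min_le_right _ _⟩
  -- Space-time carries the maximum metric, so balls are cylinders. `T ≥ 2r` ensures that the one of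
  -- radius `r` fits into `ω × (-T, T)`; `σ` serves as both spatial radius and half-length in time,
  -- independently of `T`.
  refine ⟨Metric.ball xt σ, Metric.isOpen_ball, Metric.mem_ball_self hσ, fun x hx => ?_,
    2 * r, by positivity, fun T hT => ⟨σ, hσ, by linarith, ?_⟩⟩
  · exact (hδω (Metric.ball_subset_ball (by linarith) hx)).1
  intro q₀ q p hq₀ hq hp u hu hwave hsupp
  set U : Set (SpaceTime d) := ω ×ˢ Ioo (-T) T with hU
  have hUo : IsOpen U := hω.prod isOpen_Ioo
  have hUΩ : U ⊆ Ω ×ˢ Ioo (-T) T := prod_mono hωΩ subset_rfl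
  have hrU : Metric.closedBall z₀ r ⊆ U := by
    intro z hz
    refine ⟨(hδω (hfst z hz)).1, ?_⟩
    rw [Metric.mem_closedBall, Prod.dist_eq] at hz
    have h2 := (le_max_right _ _).trans hz
    rw [Real.dist_eq] at h2
    have h3 : |z.2| ≤ r := by simpa [hz₀] using h2
    exact abs_lt.1 (by linarith)
  obtain ⟨u₁, u₂, hu0, hu₁, hu₂, hd₁, hd₂⟩ := MemH.exists_derivatives hu
  have hvan := ae_eq_zero_of_essSupport_subset hω isOpen_Ioo hθ.1.continuousOn hu0.1 hsupp
  have hVo : IsOpen ((ω ∩ θ ⁻¹' Iio (θ xt)) ×ˢ Ioo (-T) T) :=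
    (hθ.1.continuousOn.isOpen_inter_preimage hω isOpen_Iio).prod isOpen_Ioo
  -- The equation expresses the principal part through terms of order at most one, whose
  -- coefficients are bounded by `𝔪`.
  have hdiv : ∀ᵐ z, z ∈ Metric.ball z₀ (r / 2) →
      ‖divExpr stDir g u₁ u₂ z‖ ≤ 𝔪 * (∑ i, ‖u₁ i z‖ + ‖u z‖) := by
    have w := waveOp_ae_eq hUo (fun k l => ((hA2 k l).of_le (by norm_num)).comp
      contDiff_fst.contDiffOn fun z hz => hz.1) hd₁ hd₂ q₀ q p
    have b₀ := ae_restrict_of_ae_restrict_of_subset hUΩ (hq₀.ae_norm_le h𝔪.le)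
    have b₁ := ae_restrict_of_ae_restrict_of_subset hUΩ (ae_all_iff.2 fun j => (hq j).ae_norm_le h𝔪.le)
    have b₂ := ae_restrict_of_ae_restrict_of_subset hUΩ (hp.ae_norm_le h𝔪.le)
    have all := (ae_restrict_iff' hUo.measurableSet).1 (w.and (hwave.and (b₀.and (b₁.and b₂))))
    filter_upwards [all] with z hz hzb
    have hzr : z ∈ Metric.closedBall z₀ r := Metric.ball_subset_closedBall
      (Metric.ball_subset_ball (by linarith) hzb)
    obtain ⟨c0, c1, c2, c3, c4⟩ := hz (hrU hzr)
    have hzR : z ∈ Metric.ball z₀ R₀ := hKball (Metric.closedBall_subset_closedBall hrR.le hzr)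
    have hgA : ∀ i j, g i j =ᶠ[𝓝 z] stMat A i j := fun i j => by
      filter_upwards [Metric.isOpen_ball.mem_nhds hzR] with w hw using (hball w hw).1 i j
    rw [divExpr_congr hgA]
    rw [c1] at c0
    have e1 : divExpr stDir (stMat A) u₁ u₂ z
        = -(q₀ z * u₁ none z + ∑ j, q j z * u₁ (some j) z + p z * u z) := by
      linear_combination -c0
    rw [e1, norm_neg, Fintype.sum_option, mul_add, mul_add, Finset.mul_sum]
    refine (norm_add_le _ _).trans (add_le_add ((norm_add_le _ _).trans (add_le_add ?_ ?_)) ?_)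
    · rw [norm_mul]
      exact mul_le_mul_of_nonneg_right c2 (norm_nonneg _)
    · refine (norm_sum_le _ _).trans (Finset.sum_le_sum fun j _ => ?_)
      rw [norm_mul]
      exact mul_le_mul_of_nonneg_right (c3 j) (norm_nonneg _)
    · rw [norm_mul]
      exact mul_le_mul_of_nonneg_right c4 (norm_nonneg _)
  have concl := ae_eq_zero_of_carleman (a := a) hr0 hrR hg hφ.continuous hC.le hcar hUo hrU hu0 hu₁ hu₂
    hd₁ hd₂ hdiv hVo (prod_mono inter_subset_left subset_rfl) hvan (fun z hz haz => by
      rcases hcov z hz haz with h1 | h1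
      · exact Or.inl ⟨⟨(hrU hz).1, h1⟩, (hrU hz).2⟩
      · exact Or.inr h1)
  rw [ae_restrict_iff' (Metric.isOpen_ball.prod isOpen_Ioo).measurableSet]
  filter_upwards [concl] with z hz hzB
  have hzσ : z ∈ Metric.ball z₀ σ := by
    rw [hz₀, ← ball_prod_same, Real.ball_eq_Ioo]
    simpa using hzB
  exact hz (Metric.ball_subset_ball hσr hzσ) (hεφ (Metric.ball_subset_ball hσε hzσ))
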